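/- Let $\mathbb H^2\times\mathbb R=\{(x,y,z)\in\mathbb R^3: y>0\}$ with the metric $\langle\cdot,\cdot\rangle=\frac{dx^2+dy^2}{y^2}+dz^2$. Consider the three one-parameter groups of translations: vertical, $(x,y,z)\mapsto(x,y,z+t)$; parabolic, $(x,y,z)\mapsto(x+t,y,z)$; and hyperbolic, $(x,y,z)\mapsto(e^tx,e^ty,z)$, $t\in\mathbb R$; and the five vector fields $\partial_z$, $\partial_x$, $x\partial_x+y\partial_y$ (Killing) and $\partial_y$, $-\partial_y$ (conformal). Let $T=(T_t)_{t\in\mathbb R}$ be one of the three groups and $X$ one of the five fields (fifteen combinations). A grim reaper of type $(T,X)$ is a smooth immersion $\psi:\Sigma\to\mathbb H^2\times\mathbb R$ of a connected, orientable smooth surface $\Sigma$ (Hausdorff, second countable, without boundary) such that (i) $H=\langle N,X\rangle$ on $\Sigma$, where $N$ is a unit normal field along $\psi$ and $H$ is the mean curvature with respect to $N$, i.e. half the trace of the second fundamental form $b(V,W)=\langle N,\overline\nabla_VW\rangle$, with $\overline\nabla$ the Levi-Civita connection; (ii) $\psi$ is invariant by $T$: there is a continuous action $(\phi_t)_{t\in\mathbb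 R}$ of $\mathbb R$ on $\Sigma$ with $\psi\circ\phi_t=T_t\circ\psi$ for all $t\in\mathbb R$. Theorem. Every grim reaper of each of the fifteen types is an embedded surface: $\psi$ is a smooth embedding, that is, an immersion that is a homeomorphism onto its image. -/

import Mathlib

open scoped Manifold ContDiff

noncomputable section

namespace GrimReaper

/-- The coordinate space `ℝ³ ∋ (x, y, z)`. The space `ℍ² × ℝ` is its open subset `y > 0`, with the
metric `(dx² + dy²) / y² + dz²`. -/
abbrev Coord : Type := Fin 3 → ℝ

/-- The parameter space of a local parametrization of a surface. -/
abbrev Param : Type := EuclideanSpace ℝ (Fin 2)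

/-- The Riemannian metric `⟨v, w⟩` of `ℍ² × ℝ` at the point `q = (x, y, z)`, `y > 0`. -/
def inn (q v w : Coord) : ℝ := (v 0 * w 0 + v 1 * w 1) / q 1 ^ 2 + v 2 * w 2

/-- The Christoffel symbols of `ℍ² × ℝ` at `q`, as a bilinear map: the Levi-Civita connection is
`∇_v W = D_v W + christoffel q v (W q)`. -/
def christoffel (q v w : Coord) : Coord :=
  ![-(v 0 * w 1 + v 1 * w 0) / q 1, (v 0 * w 0 - v 1 * w 1) / q 1, 0]

/-- The connection is torsion free. -/
theorem christoffel_symm (q v w : Coord) : christoffel q v w = christoffel q w v := by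
  unfold christoffel
  congr 1
  · ring
  · congr 1
    ring

/-- The connection is compatible with the metric. -/
theorem hasDerivAt_inn (q u v w : Coord) (hq : 0 < q 1) :
    HasDerivAt (fun t : ℝ => inn (q + t • u) v w)
      (inn q (christoffel q u v) w + inn q v (christoffel q u w)) 0 := by
  have h1 : HasDerivAt (fun t : ℝ => q 1 + t * u 1) (u 1) 0 := by
    simpa using ((hasDerivAt_id (0 : ℝ)).mul_const (u 1)).const_add (q 1)
  have h2 : HasDerivAt
      (fun t : ℝ => (v 0 * w 0 + v 1 * w 1) / (q 1 + t * u 1) ^ 2 + v 2 * w 2) _ 0 :=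
    (((hasDerivAt_const (0 : ℝ) (v 0 * w 0 + v 1 * w 1)).div (h1.pow 2)
      (by simpa using hq.ne')).add_const (v 2 * w 2))
  have h3 : (fun t : ℝ => inn (q + t • u) v w) =
      fun t : ℝ => (v 0 * w 0 + v 1 * w 1) / (q 1 + t * u 1) ^ 2 + v 2 * w 2 := by
    funext t
    simp [inn]
  rw [h3]
  convert h2 using 1
  simp [inn, christoffel]
  field_simp
  ring

/-- The partial derivative `∂f/∂xᵢ` of a map of the parameter space. -/
def partialDeriv (i : Fin 2) (f : Param → Coord) (x : Param) : Coord :=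
  fderiv ℝ f x (EuclideanSpace.single i 1)

/-- The covariant derivative `∇_{f_i} f_j` along a local parametrization `f`. -/
def covDeriv (f : Param → Coord) (i j : Fin 2) (x : Param) : Coord :=
  partialDeriv i (partialDeriv j f) x +
    christoffel (f x) (partialDeriv i f x) (partialDeriv j f x)

/-- The first fundamental form `g_{ij} = ⟨f_i, f_j⟩`. -/
def firstForm (f : Param → Coord) (i j : Fin 2) (x : Param) : ℝ :=
  inn (f x) (partialDeriv i f x) (partialDeriv j f x)

/-- The second fundamental form `b_{ij} = ⟨n, ∇_{f_i} f_j⟩` with respect to the normal `n`. -/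
def secondForm (f : Param → Coord) (n : Coord) (i j : Fin 2) (x : Param) : ℝ :=
  inn (f x) n (covDeriv f i j x)

/-- The mean curvature
`H = (b₁₁ g₂₂ - 2 b₁₂ g₁₂ + b₂₂ g₁₁) / (2 (g₁₁ g₂₂ - g₁₂²))` at the parameter `x` of a local
parametrization `f`, with respect to the unit normal `n` at `f x`. -/
def meanCurvature (f : Param → Coord) (n : Coord) (x : Param) : ℝ :=
  (secondForm f n 0 0 x * firstForm f 1 1 x - 2 * secondForm f n 0 1 x * firstForm f 0 1 x
      + secondForm f n 1 1 x * firstForm f 0 0 x) /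
    (2 * (firstForm f 0 0 x * firstForm f 1 1 x - firstForm f 0 1 x ^ 2))

/-- The three one-parameter groups of translations. -/
inductive TranslationKind : Type
  | vertical
  | parabolic
  | hyperbolic

/-- The translation with parameter `t` of the given one-parameter group. -/
def translation : TranslationKind → ℝ → Coord → Coord
  | .vertical, t, q => ![q 0, q 1, q 2 + t]
  | .parabolic, t, q => ![q 0 + t, q 1, q 2]
  | .hyperbolic, t, q => ![Real.exp t * q 0, Real.exp t * q 1, q 2]

/-- The five kinds of fields in the translator equation: the Killing fields (`v`, `p`, `h`) and the
conformal fields (`cPlus`, `cMinus`). -/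
inductive FieldKind : Type
  | v
  | p
  | h
  | cPlus
  | cMinus

/-- The vector fields `∂_z`, `∂_x`, `x ∂_x + y ∂_y`, `∂_y` and `-∂_y`. -/
def field : FieldKind → Coord → Coord
  | .v, _ => ![0, 0, 1]
  | .p, _ => ![1, 0, 0]
  | .h, q => ![q 0, q 1, 0]
  | .cPlus, _ => ![0, 1, 0]
  | .cMinus, _ => ![0, -1, 0]

section

variable {M : Type*} [TopologicalSpace M] [ChartedSpace Param M]

/-- `ψ : M → ℍ² × ℝ` is a smooth immersion. -/
structure IsImmersedSurface (ψ : M → Coord) : Prop where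
  pos : ∀ p, 0 < ψ p 1
  immersion : Manifold.IsImmersion (𝓡 2) 𝓘(ℝ, Coord) ∞ ψ

/-- `N` is a continuous unit normal field along `ψ`. -/
structure IsUnitNormal (ψ N : M → Coord) : Prop where
  cont : Continuous N
  unit : ∀ p, inn (ψ p) (N p) (N p) = 1
  normal : ∀ (p : M) (v : TangentSpace (𝓡 2) p),
    inn (ψ p) (N p) (mfderiv (𝓡 2) 𝓘(ℝ, Coord) ψ p v) = 0

/-- The immersed surface `ψ` is orientable and satisfies `H = ⟨N, X⟩`, the mean curvature `H` being
computed in the local parametrizations `ψ ∘ e⁻¹`, `e` a chart of the surface. -/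
def IsTranslator (δ : FieldKind) (ψ : M → Coord) : Prop :=
  ∃ N : M → Coord, IsUnitNormal ψ N ∧
    ∀ e ∈ IsManifold.maximalAtlas (𝓡 2) ∞ M, ∀ p ∈ e.source,
      meanCurvature (ψ ∘ e.symm) (N p) (e p) = inn (ψ p) (N p) (field δ (ψ p))

/-- The immersed surface `ψ` is invariant by a one-parameter group of translations: the group acts
continuously on the surface and `ψ` is equivariant. -/
def IsInvariant (τ : TranslationKind) (ψ : M → Coord) : Prop :=
  ∃ φ : Flow ℝ M, ∀ (t : ℝ) (p : M), ψ (φ t p) = translation τ t (ψ p)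

/-- A grim reaper of kind `(τ, δ)`: an immersed surface in `ℍ² × ℝ` that satisfies the translator
equation of the field `δ` and is invariant by the translations `τ`. -/
structure IsGrimReaper (τ : TranslationKind) (δ : FieldKind) (ψ : M → Coord) : Prop where
  surface : IsImmersedSurface ψ
  translator : IsTranslator δ ψ
  invariant : IsInvariant τ ψ

end

end GrimReaper

end

/-! Choose coordinates (a, b, h) in which the group acts by h ↦ h + t. The flow identifies the
surface with the product of its slice {h = 0} and the line, so `ψ` is an embedding as soon as the
profile (a, b) embeds the slice in the plane (`isEmbedding_of_slice`). Turning the unit normal by a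
right angle gives a unit tangent (A, B) of the profile, and the translator equation becomes an
equation κ = P(a) A + R(a) B for the Euclidean curvature of the profile (`exists_isPlaneCurve`). The
coordinates are adapted to the field so that the coefficients do not depend on b; this is why
vertical cylinders over the field x∂_x + y∂_y use polar coordinates. For hyperbolic translations and
the fields ∂_x, ±∂_y the term ⟨N, X⟩ scales like 1/y along the orbits while the mean curvature is
constant along them, so both vanish (`profile_hyperbolic_of_scaling`).

Two mechanisms then give embeddedness.

If (P, R) = ρ(a)(c₁, c₂), the function τ = c₁A + c₂B satisfies a linear equation τ' = kτ. It
vanishes identically, and the profile is straight, or it vanishes nowhere. In both cases a linear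
function of (a, b) is strictly monotone along the curve
(`IsPlaneCurve.isEmbedding_of_proportional`).

In the three remaining cases (vertical with ∂_x or x∂_x + y∂_y, hyperbolic with ∂_z) there is a
function g such that G = g(a)A strictly increases along the curve away from equilibria
(`IsPlaneCurve.isEmbedding_of_lyapunov`). A curve through an equilibrium is the line a = const.
Otherwise G is a global parameter, so A vanishes at most once, and the curve is a graph over the
a-axis or has exactly one fold. The slopes m of the two arms of a fold solve the same first order
equation m' = (P + Rm)(1 + m²), so their difference solves a linear one and never vanishes. The gap
between the arms therefore grows away from the fold (`IsFoldedCurve.exists_gap`): the arms neither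
cross nor accumulate on one another. -/

noncomputable section

namespace GrimReaper

open Set Filter Topology

/-! ### Locally injective open maps from a connected space to the line -/

section LineTopology

variable {S : Type*} [TopologicalSpace S]

/-- Two overlapping open connected sets on which a continuous open map to the line is injective:
the map is injective on their union. -/
theorem injOn_union_of_isOpenMap [T2Space S] {G : S → ℝ} (hG : Continuous G) (hGo : IsOpenMap G)
    {J W : Set S} (hJ : IsOpen J) (hW : IsOpen W) (hJc : IsPreconnected J)
    (hWc : IsPreconnected W) (hJi : InjOn G J) (hWi : InjOn G W) (hJW : (J ∩ W).Nonempty) :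
    InjOn G (J ∪ W) := by
  have key : ∀ j ∈ J, ∀ w ∈ W, G j = G w → j = w := by
    -- The common values form an interval, covered by two disjoint open sets: the values taken at a
    -- point of `J ∩ W`, and the values `B` taken at two distinct points. The first set is nonempty,
    -- so connectedness excludes the second.
    set K := G '' J ∩ G '' W with hK
    have hKc : IsPreconnected K := by
      have h1 := (hJc.image G hG.continuousOn).ordConnected
      have h2 := (hWc.image G hG.continuousOn).ordConnected
      exact (h1.inter h2).isPreconnected
    set B := {k : ℝ | ∃ j ∈ J, ∃ w ∈ W, G j = k ∧ G w = k ∧ j ≠ w} with hB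
    have hBo : IsOpen B := by
      rw [isOpen_iff_mem_nhds]
      rintro k ⟨j, hj, w, hw, rfl, hk, hne⟩
      -- Hausdorffness is essential here: the statement fails on the line with a doubled point.
      obtain ⟨U, V, hU, hV, hjU, hwV, hUV⟩ := t2_separation hne
      have h1 : G '' (U ∩ J) ∈ 𝓝 (G j) :=
        (hGo _ (hU.inter hJ)).mem_nhds ⟨j, ⟨hjU, hj⟩, rfl⟩
      have h2 : G '' (V ∩ W) ∈ 𝓝 (G j) :=
        (hGo _ (hV.inter hW)).mem_nhds ⟨w, ⟨hwV, hw⟩, hk⟩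
      filter_upwards [h1, h2]
      rintro k ⟨j', hj', rfl⟩ ⟨w', hw', hk'⟩
      exact ⟨j', hj'.2, w', hw'.2, rfl, hk', fun h => hUV.le_bot ⟨hj'.1, h ▸ hw'.1⟩⟩
    have hAo : IsOpen (G '' (J ∩ W)) := hGo _ (hJ.inter hW)
    have hcover : K ⊆ G '' (J ∩ W) ∪ B := by
      rintro k ⟨⟨j, hj, rfl⟩, ⟨w, hw, hk⟩⟩
      by_cases h : j = w
      · exact Or.inl ⟨j, ⟨hj, h ▸ hw⟩, rfl⟩
      · exact Or.inr ⟨j, hj, w, hw, rfl, hk, h⟩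
    have hdisj : K ∩ (G '' (J ∩ W) ∩ B) = ∅ := by
      rw [eq_empty_iff_forall_notMem]
      rintro k ⟨-, ⟨x, hx, rfl⟩, ⟨j, hj, w, hw, h1, h2, hne⟩⟩
      exact hne ((hJi hj hx.1 h1).trans (hWi hw hx.2 h2).symm)
    obtain ⟨x, hx⟩ := hJW
    rcases isPreconnected_iff_subset_of_disjoint.1 hKc _ _ hAo hBo hcover hdisj with h | h
    · intro j hj w hw hjw
      obtain ⟨y, hy, hyj⟩ := h ⟨⟨j, hj, rfl⟩, ⟨w, hw, hjw.symm⟩⟩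
      exact (hJi hj hy.1 hyj.symm).trans (hWi hy.2 hw (hyj.trans hjw))
    · exfalso
      have hxK : G x ∈ K := ⟨⟨x, hx.1, rfl⟩, ⟨x, hx.2, rfl⟩⟩
      have : G x ∈ K ∩ (G '' (J ∩ W) ∩ B) := ⟨hxK, ⟨x, hx, rfl⟩, h hxK⟩
      rw [hdisj] at this
      exact this
  rintro x (hx | hx) y (hy | hy) hxy
  · exact hJi hx hy hxy
  · exact key x hx y hy hxy
  · exact (key y hy x hx hxy.symm).symm
  · exact hWi hx hy hxy

/-- A continuous open locally injective map from a connected Hausdorff space to the line is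
injective. -/
theorem injective_of_isOpenMap_of_locally_injOn [T2Space S] [PreconnectedSpace S] {G : S → ℝ}
    (hG : Continuous G) (hGo : IsOpenMap G)
    (hloc : ∀ p, ∃ W : Set S, IsOpen W ∧ p ∈ W ∧ IsPreconnected W ∧ InjOn G W) :
    Function.Injective G := by
  intro p q hpq
  -- The points that share with `p` an open connected set of injectivity form a clopen set;
  -- closedness is the previous lemma, which enlarges such a set by a neighbourhood.
  set E := {q : S | ∃ J : Set S, IsOpen J ∧ IsPreconnected J ∧ InjOn G J ∧ p ∈ J ∧ q ∈ J} with hE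
  have hEo : IsOpen E := by
    rw [isOpen_iff_mem_nhds]
    rintro q ⟨J, hJ, hJc, hJi, hp, hq⟩
    filter_upwards [hJ.mem_nhds hq] with r hr using ⟨J, hJ, hJc, hJi, hp, hr⟩
  have hEc : IsClosed E := by
    rw [← closure_subset_iff_isClosed]
    intro q hq
    obtain ⟨W, hW, hqW, hWc, hWi⟩ := hloc q
    obtain ⟨r, hrW, J, hJ, hJc, hJi, hp, hr⟩ := mem_closure_iff.1 hq W hW hqW
    exact ⟨J ∪ W, hJ.union hW, IsPreconnected.union r hr hrW hJc hWc,
      injOn_union_of_isOpenMap hG hGo hJ hW hJc hWc hJi hWi ⟨r, hr, hrW⟩, Or.inl hp, Or.inr hqW⟩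
  have hpE : p ∈ E := by
    obtain ⟨W, hW, hpW, hWc, hWi⟩ := hloc p
    exact ⟨W, hW, hWc, hWi, hpW, hpW⟩
  have hqE : q ∈ E := by
    rw [IsClopen.eq_univ ⟨hEc, hEo⟩ ⟨p, hpE⟩]
    trivial
  obtain ⟨J, -, -, hJi, hp, hq⟩ := hqE
  exact hJi hp hq hpq

end LineTopology

/-! ### Monotonicity, openness and linear uniqueness on the line -/

section RealLine

/-- A function with nonvanishing derivative on an interval is strictly monotone. -/
theorem strictMonoOn_or_strictAntiOn_of_hasDerivAt {f f' : ℝ → ℝ} {s : Set ℝ} (hs : OrdConnected s)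
    (hd : ∀ x ∈ s, HasDerivAt f (f' x) x) (hne : ∀ x ∈ s, f' x ≠ 0) :
    StrictMonoOn f s ∨ StrictAntiOn f s := by
  have hc : ContinuousOn f s := fun x hx => (hd x hx).continuousAt.continuousWithinAt
  rcases hasDerivWithinAt_forall_lt_or_forall_gt_of_forall_ne hs.convex
    (fun x hx => (hd x hx).hasDerivWithinAt) hne with h | h
  · refine Or.inr (strictAntiOn_of_deriv_neg hs.convex hc fun x hx => ?_)
    rw [(hd x (interior_subset hx)).deriv]
    exact h x (interior_subset hx)
  · refine Or.inl (strictMonoOn_of_deriv_pos hs.convex hc fun x hx => ?_)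
    rw [(hd x (interior_subset hx)).deriv]
    exact h x (interior_subset hx)

/-- A continuous strictly monotone function on an open set is open. -/
theorem nhds_le_map_of_strictMonoOn {f : ℝ → ℝ} {s : Set ℝ} (ho : IsOpen s)
    (hc : ContinuousOn f s) (hm : StrictMonoOn f s) {x : ℝ} (hx : x ∈ s) :
    𝓝 (f x) ≤ map f (𝓝 x) := by
  intro U hU
  rw [mem_map] at hU
  obtain ⟨δ, hδ, hsub⟩ := Metric.nhds_basis_closedBall.mem_iff.1 (inter_mem hU (ho.mem_nhds hx))
  rw [Real.closedBall_eq_Icc] at hsub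
  have h1 : x - δ ∈ Icc (x - δ) (x + δ) := ⟨le_rfl, by linarith⟩
  have h2 : x + δ ∈ Icc (x - δ) (x + δ) := ⟨by linarith, le_rfl⟩
  have h3 : Icc (f (x - δ)) (f (x + δ)) ∈ 𝓝 (f x) :=
    Icc_mem_nhds (hm (hsub h1).2 hx (by linarith)) (hm hx (hsub h2).2 (by linarith))
  filter_upwards [h3] with y hy
  obtain ⟨z, hz, rfl⟩ := intermediate_value_Icc (by linarith : x - δ ≤ x + δ)
    (hc.mono fun z hz => (hsub hz).2) hy
  exact (hsub hz).1

theorem nhds_le_map_of_strictAntiOn {f : ℝ → ℝ} {s : Set ℝ} (ho : IsOpen s)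
    (hc : ContinuousOn f s) (hm : StrictAntiOn f s) {x : ℝ} (hx : x ∈ s) :
    𝓝 (f x) ≤ map f (𝓝 x) := by
  have h := nhds_le_map_of_strictMonoOn ho hc.neg (fun x hx y hy hxy => neg_lt_neg (hm hx hy hxy)) hx
  have h2 := Filter.map_mono (m := fun y : ℝ => -y) h
  rw [Filter.map_map] at h2
  have h3 : map (fun y : ℝ => -y) (𝓝 (-f x)) = 𝓝 (f x) := by
    simpa using (Homeomorph.neg ℝ).map_nhds_eq (-f x)
  have h4 : (fun y : ℝ => -y) ∘ (fun x => -f x) = f := by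
    funext y
    simp
  change map _ (𝓝 (-f x)) ≤ map ((fun y : ℝ => -y) ∘ (fun x => -f x)) _ at h2
  rwa [h3, h4] at h2

/-- Uniqueness for the inequality `|f'| ≤ K |f|`. -/
theorem eq_zero_of_abs_deriv_le {f f' : ℝ → ℝ} {K u v x₀ : ℝ}
    (hd : ∀ x ∈ Icc u v, HasDerivAt f (f' x) x) (hb : ∀ x ∈ Icc u v, |f' x| ≤ K * |f x|)
    (hx₀ : x₀ ∈ Icc u v) (h0 : f x₀ = 0) : ∀ x ∈ Icc u v, f x = 0 := by
  intro x hx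
  rcases le_total x₀ x with h | h
  · refine eq_zero_of_abs_deriv_le_mul_abs_self_of_eq_zero_right (f' := f') (K := K) (a := x₀)
      (b := v) (fun y hy => (hd y ⟨hx₀.1.trans hy.1, hy.2⟩).continuousAt.continuousWithinAt)
      (fun y hy => (hd y ⟨hx₀.1.trans hy.1, hy.2.le⟩).hasDerivWithinAt) h0
      (fun y hy => hb y ⟨hx₀.1.trans hy.1, hy.2.le⟩) x ⟨h, hx.2⟩
  · have hmem : ∀ y ∈ Icc (-x₀) (-u), -y ∈ Icc u v := fun y hy =>
      ⟨by linarith [hy.2], by linarith [hy.1, hx₀.2]⟩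
    have hd' : ∀ y ∈ Icc (-x₀) (-u), HasDerivAt (fun y => f (-y)) (-f' (-y)) y := by
      intro y hy
      have := (hd (-y) (hmem y hy)).comp y (hasDerivAt_neg y)
      simpa [Function.comp_def] using this
    have := eq_zero_of_abs_deriv_le_mul_abs_self_of_eq_zero_right (f := fun y => f (-y))
      (f' := fun y => -f' (-y)) (K := K) (a := -x₀) (b := -u)
      (fun y hy => (hd' y hy).continuousAt.continuousWithinAt)
      (fun y hy => (hd' y ⟨hy.1, hy.2.le⟩).hasDerivWithinAt) (by simpa using h0)
      (fun y hy => by simpa using hb (-y) (hmem y ⟨hy.1, hy.2.le⟩)) (-x)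
      ⟨by linarith, by linarith [hx.1]⟩
    simpa using this

/-- Uniqueness for the linear equation `f' = k f` on an interval. -/
theorem eq_zero_of_hasDerivAt_mul {f k : ℝ → ℝ} {s : Set ℝ} (hs : OrdConnected s)
    (hd : ∀ x ∈ s, HasDerivAt f (k x * f x) x) (hk : ContinuousOn k s) {x₀ : ℝ} (hx₀ : x₀ ∈ s)
    (h0 : f x₀ = 0) : ∀ x ∈ s, f x = 0 := by
  intro x hx
  have hsub : Icc (min x₀ x) (max x₀ x) ⊆ s := hs.uIcc_subset hx₀ hx
  obtain ⟨K, hK⟩ := isCompact_Icc.exists_bound_of_continuousOn (hk.mono hsub)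
  refine eq_zero_of_abs_deriv_le (K := K) (fun y hy => hd y (hsub hy)) (fun y hy => ?_)
    ⟨min_le_left _ _, le_max_left _ _⟩ h0 x ⟨min_le_right _ _, le_max_right _ _⟩
  rw [abs_mul]
  exact mul_le_mul_of_nonneg_right (hK y hy) (abs_nonneg _)

end RealLine

/-! ### Calculus along a curve with local coordinates -/

section TangentialDerivative

variable {S : Type*} [TopologicalSpace S]

/-- A family of local coordinates of a one-dimensional manifold, each with a speed. -/
structure IsCurveAtlas (𝒜 : Set (OpenPartialHomeomorph S ℝ × (ℝ → ℝ))) : Prop where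
  cover : ∀ p, ∃ x ∈ 𝒜, p ∈ x.1.source
  ordConnected : ∀ x ∈ 𝒜, OrdConnected x.1.target
  speed_ne : ∀ x ∈ 𝒜, ∀ s ∈ x.1.target, x.2 s ≠ 0
  speed_cont : ∀ x ∈ 𝒜, ContinuousOn x.2 x.1.target

/-- In each local coordinate `F' = μ F₁`, where `μ` is the speed. -/
def HasTangentDeriv (𝒜 : Set (OpenPartialHomeomorph S ℝ × (ℝ → ℝ))) (F F₁ : S → ℝ) : Prop :=
  ∀ x ∈ 𝒜, ∀ s ∈ x.1.target, HasDerivAt (F ∘ x.1.symm) (x.2 s * F₁ (x.1.symm s)) s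

variable {𝒜 : Set (OpenPartialHomeomorph S ℝ × (ℝ → ℝ))}

theorem HasTangentDeriv.congr {F F₁ F₂ : S → ℝ} (h : HasTangentDeriv 𝒜 F F₁)
    (h12 : ∀ p, F₁ p = F₂ p) : HasTangentDeriv 𝒜 F F₂ := by
  rwa [← funext h12]

theorem HasTangentDeriv.add {F F₁ E E₁ : S → ℝ} (hF : HasTangentDeriv 𝒜 F F₁)
    (hE : HasTangentDeriv 𝒜 E E₁) :
    HasTangentDeriv 𝒜 (fun p => F p + E p) (fun p => F₁ p + E₁ p) := by
  intro x hx s hs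
  refine ((hF x hx s hs).add (hE x hx s hs)).congr_deriv ?_
  ring

theorem HasTangentDeriv.mul {F F₁ E E₁ : S → ℝ} (hF : HasTangentDeriv 𝒜 F F₁)
    (hE : HasTangentDeriv 𝒜 E E₁) :
    HasTangentDeriv 𝒜 (fun p => F p * E p) (fun p => F₁ p * E p + F p * E₁ p) := by
  intro x hx s hs
  refine ((hF x hx s hs).mul (hE x hx s hs)).congr_deriv ?_
  simp only [Function.comp_apply]
  ring

theorem HasTangentDeriv.const_mul {F F₁ : S → ℝ} (c : ℝ) (hF : HasTangentDeriv 𝒜 F F₁) :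
    HasTangentDeriv 𝒜 (fun p => c * F p) (fun p => c * F₁ p) := by
  intro x hx s hs
  refine ((hF x hx s hs).const_mul c).congr_deriv ?_
  ring

theorem HasTangentDeriv.sub_const {F F₁ : S → ℝ} (c : ℝ) (hF : HasTangentDeriv 𝒜 F F₁) :
    HasTangentDeriv 𝒜 (fun p => F p - c) F₁ :=
  fun x hx s hs => (hF x hx s hs).sub_const c

theorem HasTangentDeriv.scomp {F F₁ : S → ℝ} {g g' : ℝ → ℝ} (hF : HasTangentDeriv 𝒜 F F₁)
    (hg : ∀ p, HasDerivAt g (g' (F p)) (F p)) :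
    HasTangentDeriv 𝒜 (fun p => g (F p)) (fun p => g' (F p) * F₁ p) := by
  intro x hx s hs
  refine ((hg (x.1.symm s)).comp s (hF x hx s hs)).congr_deriv ?_
  ring

/-- A function with nonvanishing tangential derivative on a connected curve is an open embedding
into the line. -/
theorem IsCurveAtlas.isOpenEmbedding [T2Space S] [PreconnectedSpace S] (h𝒜 : IsCurveAtlas 𝒜)
    {F F₁ : S → ℝ} (hF : Continuous F) (hd : HasTangentDeriv 𝒜 F F₁) (hne : ∀ p, F₁ p ≠ 0) :
    IsOpenEmbedding F := by
  have hmono : ∀ x ∈ 𝒜, StrictMonoOn (F ∘ x.1.symm) x.1.target ∨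
      StrictAntiOn (F ∘ x.1.symm) x.1.target := fun x hx =>
    strictMonoOn_or_strictAntiOn_of_hasDerivAt (h𝒜.ordConnected x hx) (hd x hx)
      fun s hs => mul_ne_zero (h𝒜.speed_ne x hx s hs) (hne _)
  have hopen : IsOpenMap F := by
    rw [isOpenMap_iff_nhds_le]
    intro p
    obtain ⟨x, hx, hp⟩ := h𝒜.cover p
    have hs : x.1 p ∈ x.1.target := x.1.map_source hp
    have hc : ContinuousOn (F ∘ x.1.symm) x.1.target := fun s hs =>
      (hd x hx s hs).continuousAt.continuousWithinAt
    have h1 : 𝓝 ((F ∘ x.1.symm) (x.1 p)) ≤ map (F ∘ x.1.symm) (𝓝 (x.1 p)) := by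
      rcases hmono x hx with h | h
      · exact nhds_le_map_of_strictMonoOn x.1.open_target hc h hs
      · exact nhds_le_map_of_strictAntiOn x.1.open_target hc h hs
    rwa [← Filter.map_map, x.1.symm_map_nhds_eq hp, Function.comp_apply, x.1.left_inv hp] at h1
  refine IsOpenEmbedding.of_continuous_injective_isOpenMap hF ?_ hopen
  refine injective_of_isOpenMap_of_locally_injOn hF hopen fun p => ?_
  obtain ⟨x, hx, hp⟩ := h𝒜.cover p
  refine ⟨x.1.source, x.1.open_source, hp, ?_, ?_⟩
  · rw [← x.1.symm_image_target_eq_source]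
    exact (h𝒜.ordConnected x hx).isPreconnected.image _ x.1.continuousOn_symm
  · have hinj : InjOn (F ∘ x.1.symm) x.1.target := by
      rcases hmono x hx with h | h
      · exact h.injOn
      · exact h.injOn
    intro q hq r hr hqr
    have := hinj (x.1.map_source hq) (x.1.map_source hr)
      (by simpa [x.1.left_inv hq, x.1.left_inv hr] using hqr)
    exact x.1.injOn hq hr this

/-- A function whose tangential derivative is locally bounded by a multiple of it vanishes
identically if it has a zero. -/
theorem IsCurveAtlas.eq_zero_of_abs_tangentDeriv_le [PreconnectedSpace S] (h𝒜 : IsCurveAtlas 𝒜)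
    {F F₁ : S → ℝ} (hF : Continuous F) (hd : HasTangentDeriv 𝒜 F F₁)
    (hb : ∀ p, F p = 0 → ∃ C, ∀ᶠ q in 𝓝 p, |F₁ q| ≤ C * |F q|) {p : S} (hp : F p = 0) :
    ∀ q, F q = 0 := by
  have hcl : IsClosed {q | F q = 0} := isClosed_eq hF continuous_const
  -- In a local coordinate near a zero the derivative is at most K|F|, where K is `C` times a local
  -- bound of the speed, so linear uniqueness applies.
  have hop : IsOpen {q | F q = 0} := by
    rw [isOpen_iff_mem_nhds]
    intro q hq
    obtain ⟨C, hC⟩ := hb q hq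
    obtain ⟨x, hx, hqx⟩ := h𝒜.cover q
    have hs : x.1 q ∈ x.1.target := x.1.map_source hqx
    have hμ : ∀ᶠ s in 𝓝 (x.1 q), |x.2 s| < |x.2 (x.1 q)| + 1 := by
      have := ((h𝒜.speed_cont x hx).continuousAt (x.1.open_target.mem_nhds hs)).abs
      exact this.eventually_lt continuousAt_const (lt_add_one _)
    have hC' : ∀ᶠ s in 𝓝 (x.1 q), |F₁ (x.1.symm s)| ≤ C * |F (x.1.symm s)| := by
      have := x.1.tendsto_symm hqx
      exact this.eventually hC
    obtain ⟨δ, hδ, hsub⟩ := Metric.nhds_basis_closedBall.mem_iff.1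
      (inter_mem (inter_mem hμ hC') (x.1.open_target.mem_nhds hs))
    rw [Real.closedBall_eq_Icc] at hsub
    have hz := eq_zero_of_abs_deriv_le (f := F ∘ x.1.symm)
      (f' := fun s => x.2 s * F₁ (x.1.symm s)) (K := (|x.2 (x.1 q)| + 1) * C)
      (fun s hs => hd x hx s (hsub hs).2)
      (fun s hs => by
        have h1 : |x.2 s| < |x.2 (x.1 q)| + 1 := (hsub hs).1.1
        have h2 : |F₁ (x.1.symm s)| ≤ C * |F (x.1.symm s)| := (hsub hs).1.2
        rw [abs_mul, mul_assoc]
        exact mul_le_mul h1.le h2 (abs_nonneg _) (by positivity))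
      (x₀ := x.1 q) ⟨by linarith, by linarith⟩ (by simpa [x.1.left_inv hqx] using hq)
    have hev : ∀ᶠ r in 𝓝 q, x.1 r ∈ Icc (x.1 q - δ) (x.1 q + δ) :=
      (x.1.continuousAt hqx).eventually (Icc_mem_nhds (by linarith) (by linarith))
    filter_upwards [hev, x.1.open_source.mem_nhds hqx] with r hr hrx
    simpa [x.1.left_inv hrx] using hz _ hr
  intro q
  have := IsClopen.eq_univ ⟨hcl, hop⟩ ⟨p, hp⟩
  exact (this ▸ mem_univ q : q ∈ {q | F q = 0})

/-- Derivatives with respect to the global parameter given by a function with nonvanishing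
tangential derivative. -/
theorem IsCurveAtlas.hasDerivAt_of_leftInverse (h𝒜 : IsCurveAtlas 𝒜) {G G₁ F F₁ : S → ℝ}
    (hG : IsOpenEmbedding G) (hGd : HasTangentDeriv 𝒜 G G₁) (hne : ∀ p, G₁ p ≠ 0)
    (hFd : HasTangentDeriv 𝒜 F F₁) {θ : ℝ → S} (hθ : ∀ p, θ (G p) = p) (p : S) :
    HasDerivAt (F ∘ θ) (F₁ p / G₁ p) (G p) := by
  obtain ⟨x, hx, hp⟩ := h𝒜.cover p
  have hs : x.1 p ∈ x.1.target := x.1.map_source hp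
  have hr : range G ∈ 𝓝 (G p) := hG.isOpen_range.mem_nhds ⟨p, rfl⟩
  have hGθ : ∀ᶠ y in 𝓝 (G p), G (θ y) = y := by
    filter_upwards [hr]
    rintro y ⟨q, rfl⟩
    rw [hθ]
  have hθc : ContinuousAt θ (G p) := by
    have h1 : 𝓝 (G p) = map G (𝓝 p) := (hG.map_nhds_eq p).symm
    rw [ContinuousAt, h1, hθ, tendsto_map'_iff]
    have : θ ∘ G = id := funext hθ
    rw [this]
    exact tendsto_id
  have hsrc : ∀ᶠ y in 𝓝 (G p), θ y ∈ x.1.source :=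
    hθc.eventually (by rw [hθ]; exact x.1.open_source.mem_nhds hp)
  have hrc : ContinuousAt (x.1 ∘ θ) (G p) :=
    ContinuousAt.comp (by rw [hθ]; exact x.1.continuousAt hp) hθc
  have hrp : (x.1 ∘ θ) (G p) = x.1 p := by simp [hθ]
  have hGx := hGd x hx _ hs
  have hFx := hFd x hx _ hs
  rw [x.1.left_inv hp] at hGx hFx
  have hμ := h𝒜.speed_ne x hx _ hs
  -- Read in the coordinate `x`, `θ` inverts `G`, whose derivative there is the speed times `G₁`.
  -- The speed cancels against the one in the derivative of `F`.
  have hinv : HasDerivAt (x.1 ∘ θ) (x.2 (x.1 p) * G₁ p)⁻¹ (G p) := by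
    refine HasDerivAt.of_local_left_inverse (f := G ∘ x.1.symm) hrc (by rw [hrp]; exact hGx)
      (mul_ne_zero hμ (hne p)) ?_
    filter_upwards [hGθ, hsrc] with y hy hyx
    simp [x.1.left_inv hyx, hy]
  have hcomp := HasDerivAt.comp (G p) (h₂ := F ∘ x.1.symm) (by rw [hrp]; exact hFx) hinv
  refine (hcomp.congr_of_eventuallyEq ?_).congr_deriv ?_
  · filter_upwards [hsrc] with y hyx
    simp [x.1.left_inv hyx]
  · have := hne p
    field_simp

end TangentialDerivative

/-! ### Plane curves with a single fold -/

section FoldedCurve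

/-- The derivative of the inverse of a function with nonvanishing derivative on an interval. -/
theorem hasDerivAt_inverse {α α' r : ℝ → ℝ} {J : Set ℝ} (hJ : OrdConnected J) (hJo : IsOpen J)
    (hd : ∀ s ∈ J, HasDerivAt α (α' s) s) (hne : ∀ s ∈ J, α' s ≠ 0)
    (hr : ∀ s ∈ J, r (α s) = s) : ∀ s ∈ J, HasDerivAt r (α' s)⁻¹ (α s) := by
  intro s hs
  have hc : ContinuousOn α J := fun x hx => (hd x hx).continuousAt.continuousWithinAt
  have hle : 𝓝 (α s) ≤ map α (𝓝 s) := by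
    rcases strictMonoOn_or_strictAntiOn_of_hasDerivAt hJ hd hne with h | h
    · exact nhds_le_map_of_strictMonoOn hJo hc h hs
    · exact nhds_le_map_of_strictAntiOn hJo hc h hs
  have hrα : ∀ᶠ t in 𝓝 s, r (α t) = t := by
    filter_upwards [hJo.mem_nhds hs] with t ht using hr t ht
  have hcr : ContinuousAt r (α s) := by
    rw [ContinuousAt, hr s hs]
    refine Tendsto.mono_left ?_ hle
    rw [tendsto_map'_iff]
    exact tendsto_id.congr' (by filter_upwards [hrα] with t ht using ht.symm)
  refine HasDerivAt.of_local_left_inverse hcr (by rw [hr s hs]; exact hd s hs) (hne s hs) ?_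
  refine hle (mem_map.2 ?_)
  filter_upwards [hrα] with t ht
  simp only [mem_preimage, mem_ofPred_eq, ht]

/-- A plane curve `(α, β)` with unit tangent `(A, B)`, whose curvature is
`P(α) A + R(α) B`, and whose first coordinate increases before and decreases after the
parameter `0`. -/
structure IsFoldedCurve (P R : ℝ → ℝ) (Ω J : Set ℝ) (α β A B ν : ℝ → ℝ) : Prop where
  isOpen : IsOpen J
  ordConnected : OrdConnected J
  zero_mem : (0 : ℝ) ∈ J
  contP : ContinuousOn P Ω
  contR : ContinuousOn R Ω
  mem : ∀ s ∈ J, α s ∈ Ω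
  speed_pos : ∀ s ∈ J, 0 < ν s
  unit : ∀ s ∈ J, A s ^ 2 + B s ^ 2 = 1
  deriv_fst : ∀ s ∈ J, HasDerivAt α (ν s * A s) s
  deriv_snd : ∀ s ∈ J, HasDerivAt β (ν s * B s) s
  deriv_A : ∀ s ∈ J, HasDerivAt A (-(ν s * (P (α s) * A s + R (α s) * B s) * B s)) s
  deriv_B : ∀ s ∈ J, HasDerivAt B (ν s * (P (α s) * A s + R (α s) * B s) * A s) s
  pos : ∀ s ∈ J, s < 0 → 0 < A s
  neg : ∀ s ∈ J, 0 < s → A s < 0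

variable {P R : ℝ → ℝ} {Ω J : Set ℝ} {α β A B ν : ℝ → ℝ}

theorem hasDerivAt_comp_neg {f : ℝ → ℝ} {d s : ℝ} (h : HasDerivAt f d (-s)) :
    HasDerivAt (fun s => f (-s)) (-d) s := by
  simpa [Function.comp_def] using h.comp s (hasDerivAt_neg s)

/-- Reversal of the parameter. -/
theorem IsFoldedCurve.reverse (h : IsFoldedCurve P R Ω J α β A B ν) :
    IsFoldedCurve P R Ω {s | -s ∈ J} (fun s => α (-s)) (fun s => β (-s)) (fun s => -A (-s))
      (fun s => -B (-s)) (fun s => ν (-s)) where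
  isOpen := h.isOpen.preimage continuous_neg
  ordConnected := by
    refine ⟨fun x hx y hy z hz => ?_⟩
    exact h.ordConnected.out hy hx ⟨neg_le_neg hz.2, neg_le_neg hz.1⟩
  zero_mem := by simpa using h.zero_mem
  contP := h.contP
  contR := h.contR
  mem s hs := h.mem _ hs
  speed_pos s hs := h.speed_pos _ hs
  unit s hs := by simpa using h.unit _ hs
  deriv_fst s hs := (hasDerivAt_comp_neg (h.deriv_fst _ hs)).congr_deriv (by ring)
  deriv_snd s hs := (hasDerivAt_comp_neg (h.deriv_snd _ hs)).congr_deriv (by ring)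
  deriv_A s hs := (hasDerivAt_comp_neg (h.deriv_A _ hs)).neg.congr_deriv (by ring)
  deriv_B s hs := (hasDerivAt_comp_neg (h.deriv_B _ hs)).neg.congr_deriv (by ring)
  pos s hs h0 := by simpa using h.neg _ hs (by linarith)
  neg s hs h0 := by simpa using h.pos _ hs (by linarith)

theorem IsFoldedCurve.strictMonoOn (h : IsFoldedCurve P R Ω J α β A B ν) :
    StrictMonoOn α (J ∩ Iic 0) := by
  refine strictMonoOn_of_deriv_pos (h.ordConnected.inter ordConnected_Iic).convex
    (fun s hs => (h.deriv_fst s hs.1).continuousAt.continuousWithinAt) fun s hs => ?_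
  rw [interior_inter, interior_Iic] at hs
  have hsJ := interior_subset hs.1
  rw [(h.deriv_fst s hsJ).deriv]
  exact mul_pos (h.speed_pos s hsJ) (h.pos s hsJ hs.2)

theorem IsFoldedCurve.strictAntiOn (h : IsFoldedCurve P R Ω J α β A B ν) :
    StrictAntiOn α (J ∩ Ici 0) := by
  intro s hs t ht hst
  have := h.reverse.strictMonoOn (a := -t) ⟨by simpa using ht.1, by simpa using ht.2⟩ (b := -s)
    ⟨by simpa using hs.1, by simpa using hs.2⟩ (by linarith)
  simpa using this

/-- The points on both sides of the fold, close to it. -/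
theorem IsFoldedCurve.exists_tip (h : IsFoldedCurve P R Ω J α β A B ν) {U : Set ℝ}
    (hU : U ∈ 𝓝 (0 : ℝ)) : ∃ x₁ < α 0, ∀ s ∈ J, x₁ < α s → s ∈ U ∩ J := by
  obtain ⟨δ, hδ, hsub⟩ := Metric.nhds_basis_closedBall.mem_iff.1
    (inter_mem hU (h.isOpen.mem_nhds h.zero_mem))
  rw [Real.closedBall_eq_Icc] at hsub
  have h1 : -δ ∈ J := (hsub ⟨by linarith, by linarith⟩).2
  have h2 : δ ∈ J := (hsub ⟨by linarith, by linarith⟩).2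
  -- `α` increases up to the parameter 0 and decreases after it, so a parameter outside [-δ, δ] has
  -- `α` at most the larger of the two end values.
  refine ⟨max (α (-δ)) (α δ), max_lt ?_ ?_, fun s hs hx => hsub ⟨?_, ?_⟩⟩
  · exact h.strictMonoOn ⟨h1, by simpa using hδ.le⟩ ⟨h.zero_mem, le_refl (0 : ℝ)⟩ (by simpa using hδ)
  · exact h.strictAntiOn ⟨h.zero_mem, le_refl (0 : ℝ)⟩ ⟨h2, hδ.le⟩ hδ
  · by_contra hlt
    have hlt' : s ≤ -δ := by linarith [not_le.1 hlt]
    have := h.strictMonoOn.monotoneOn ⟨hs, by simp only [mem_Iic]; linarith⟩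
      ⟨h1, by simpa using hδ.le⟩ hlt'
    exact absurd ((le_max_left _ _).trans_lt hx) (not_lt.2 this)
  · by_contra hlt
    have hlt' : δ ≤ s := by linarith [not_le.1 hlt]
    have := h.strictAntiOn.antitoneOn ⟨h2, hδ.le⟩ ⟨hs, by simp only [mem_Ici]; linarith⟩ hlt'
    exact absurd ((le_max_right _ _).trans_lt hx) (not_lt.2 this)

/-- On an arm of the curve that is a graph over the first axis, the slope solves an equation of
first order. -/
theorem IsFoldedCurve.hasDerivAt_graph (h : IsFoldedCurve P R Ω J α β A B ν) {J₁ : Set ℝ}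
    (hsub : J₁ ⊆ J) (hJ : OrdConnected J₁) (hJo : IsOpen J₁) (hA : ∀ s ∈ J₁, A s ≠ 0) {r : ℝ → ℝ}
    (hr : ∀ s ∈ J₁, r (α s) = s) : ∀ x ∈ α '' J₁,
      HasDerivAt (β ∘ r) (B (r x) / A (r x)) x ∧
      HasDerivAt (fun x => B (r x) / A (r x))
        ((P x + R x * (B (r x) / A (r x))) * (1 + (B (r x) / A (r x)) ^ 2)) x := by
  rintro _ ⟨s, hs, rfl⟩
  have hν := (h.speed_pos s (hsub hs)).ne'
  have hAs := hA s hs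
  have hrd : HasDerivAt r (ν s * A s)⁻¹ (α s) := by
    refine hasDerivAt_inverse (α' := fun s => ν s * A s) hJ hJo
      (fun s hs => h.deriv_fst s (hsub hs))
      (fun s hs => mul_ne_zero (h.speed_pos s (hsub hs)).ne' (hA s hs)) hr s hs
  have hrs := hr s hs
  constructor
  · refine (HasDerivAt.comp (α s) (by rw [hrs]; exact h.deriv_snd s (hsub hs)) hrd).congr_deriv ?_
    rw [hrs]
    field_simp
  · have hq := (h.deriv_B s (hsub hs)).div (h.deriv_A s (hsub hs)) hAs
    have := HasDerivAt.comp (α s) (h₂ := fun s => B s / A s) (by rw [hrs]; exact hq) hrd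
    refine this.congr_deriv ?_
    rw [hrs]
    have hu := h.unit s (hsub hs)
    have hu' : A s ^ 2 + B s ^ 2 ≠ 0 := by rw [hu]; norm_num
    field_simp
    ring

/-- The heights of the two arms over the same point of the first axis differ by more and more away
from the fold. -/
theorem IsFoldedCurve.exists_gap (h : IsFoldedCurve P R Ω J α β A B ν) {x₀ : ℝ}
    (hx₀ : x₀ < α 0) : ∃ y, x₀ < y ∧ y < α 0 ∧ ∃ δ > 0, ∀ s ∈ J, ∀ t ∈ J, 0 < s → t < 0 →
      α s = α t → α s < y → δ ≤ |β s - β t| := by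
  set J₁ := J ∩ Ioi 0 with hJ₁
  set J₂ := J ∩ Iio 0 with hJ₂
  have hoc₁ : OrdConnected J₁ := h.ordConnected.inter ordConnected_Ioi
  have hoc₂ : OrdConnected J₂ := h.ordConnected.inter ordConnected_Iio
  have ho₁ : IsOpen J₁ := h.isOpen.inter isOpen_Ioi
  have ho₂ : IsOpen J₂ := h.isOpen.inter isOpen_Iio
  have hi₁ : InjOn α J₁ := h.strictAntiOn.injOn.mono (inter_subset_inter_right _ Ioi_subset_Ici_self)
  have hi₂ : InjOn α J₂ := h.strictMonoOn.injOn.mono (inter_subset_inter_right _ Iio_subset_Iic_self)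
  have hA₁ : ∀ s ∈ J₁, A s ≠ 0 := fun s hs => (h.neg s hs.1 hs.2).ne
  have hA₂ : ∀ s ∈ J₂, A s ≠ 0 := fun s hs => (h.pos s hs.1 hs.2).ne'
  set r₁ := Function.invFunOn α J₁
  set r₂ := Function.invFunOn α J₂
  have hr₁ : ∀ s ∈ J₁, r₁ (α s) = s := fun s hs => hi₁.leftInvOn_invFunOn hs
  have hr₂ : ∀ s ∈ J₂, r₂ (α s) = s := fun s hs => hi₂.leftInvOn_invFunOn hs
  have hg₁ := h.hasDerivAt_graph inter_subset_left hoc₁ ho₁ hA₁ hr₁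
  have hg₂ := h.hasDerivAt_graph inter_subset_left hoc₂ ho₂ hA₂ hr₂
  -- The interval over which both arms are graphs; `r₁` and `r₂` lift it to the arms, whose slopes
  -- are `m₁` and `m₂` below.
  set X := α '' J₁ ∩ α '' J₂ with hX
  have hXo : OrdConnected X := by
    have h1 := (hoc₁.isPreconnected.image α fun s hs =>
      (h.deriv_fst s hs.1).continuousAt.continuousWithinAt).ordConnected
    have h2 := (hoc₂.isPreconnected.image α fun s hs =>
      (h.deriv_fst s hs.1).continuousAt.continuousWithinAt).ordConnected
    exact h1.inter h2
  -- all points slightly before the fold lie under both arms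
  obtain ⟨δ₀, hδ₀, hball⟩ := Metric.nhds_basis_closedBall.mem_iff.1 (h.isOpen.mem_nhds h.zero_mem)
  rw [Real.closedBall_eq_Icc] at hball
  have hmJ : -δ₀ ∈ J := hball ⟨by linarith, by linarith⟩
  have hpJ : δ₀ ∈ J := hball ⟨by linarith, by linarith⟩
  have hXtip : ∃ x₁ < α 0, Ioo x₁ (α 0) ⊆ X := by
    have hlt₁ : α δ₀ < α 0 := h.strictAntiOn ⟨h.zero_mem, le_refl (0 : ℝ)⟩ ⟨hpJ, hδ₀.le⟩ hδ₀
    have hlt₂ : α (-δ₀) < α 0 :=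
      h.strictMonoOn ⟨hmJ, by simpa using hδ₀.le⟩ ⟨h.zero_mem, le_refl (0 : ℝ)⟩ (by simpa using hδ₀)
    refine ⟨max (α (-δ₀)) (α δ₀), max_lt hlt₂ hlt₁, fun x hx => ⟨?_, ?_⟩⟩
    · obtain ⟨s, hs, rfl⟩ := intermediate_value_Icc' hδ₀.le
        (fun s hs => (h.deriv_fst s (hball ⟨by linarith [hs.1], by linarith [hs.2]⟩)).continuousAt.continuousWithinAt)
        ⟨((le_max_right _ _).trans_lt hx.1).le, hx.2.le⟩
      refine ⟨s, ⟨hball ⟨by linarith [hs.1], by linarith [hs.2]⟩, lt_of_le_of_ne hs.1 ?_⟩, rfl⟩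
      rintro rfl
      exact lt_irrefl _ hx.2
    · obtain ⟨s, hs, rfl⟩ := intermediate_value_Icc (by linarith : -δ₀ ≤ 0)
        (fun s hs => (h.deriv_fst s (hball ⟨by linarith [hs.1], by linarith [hs.2]⟩)).continuousAt.continuousWithinAt)
        ⟨((le_max_left _ _).trans_lt hx.1).le, hx.2.le⟩
      refine ⟨s, ⟨hball ⟨by linarith [hs.1], by linarith [hs.2]⟩, lt_of_le_of_ne hs.2 ?_⟩, rfl⟩
      rintro rfl
      exact lt_irrefl _ hx.2
  obtain ⟨x₁, hx₁, hXsub⟩ := hXtip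
  set m₁ := fun x => B (r₁ x) / A (r₁ x)
  set m₂ := fun x => B (r₂ x) / A (r₂ x)
  have hrmem₁ : ∀ x ∈ X, r₁ x ∈ J₁ ∧ α (r₁ x) = x := by
    rintro _ ⟨⟨s, hs, rfl⟩, -⟩
    rw [hr₁ s hs]
    exact ⟨hs, rfl⟩
  have hrmem₂ : ∀ x ∈ X, r₂ x ∈ J₂ ∧ α (r₂ x) = x := by
    rintro _ ⟨-, ⟨s, hs, rfl⟩⟩
    rw [hr₂ s hs]
    exact ⟨hs, rfl⟩
  -- `A` changes sign at the fold, hence vanishes there, and the tangent is a unit vector.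
  have hB0 : B 0 ≠ 0 := by
    have hA0 : A 0 = 0 := by
      have hc : ContinuousAt A 0 := (h.deriv_A 0 h.zero_mem).continuousAt
      refine le_antisymm ?_ ?_
      · refine le_of_tendsto (hc.mono_left (nhdsWithin_le_nhds (s := Ioi 0))) ?_
        filter_upwards [self_mem_nhdsWithin, nhdsWithin_le_nhds (h.isOpen.mem_nhds h.zero_mem)]
          with s hs hsJ using (h.neg s hsJ hs).le
      · refine ge_of_tendsto (hc.mono_left (nhdsWithin_le_nhds (s := Iio 0))) ?_
        filter_upwards [self_mem_nhdsWithin, nhdsWithin_le_nhds (h.isOpen.mem_nhds h.zero_mem)]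
          with s hs hsJ using (h.pos s hsJ hs).le
    intro hB
    have := h.unit 0 h.zero_mem
    rw [hA0, hB] at this
    norm_num at this
  -- Subtracting the two slope equations gives w' = kw for the difference w, so one zero would make
  -- the slopes equal on all of `X`. Near the fold, however, `B` has the sign of `B 0` on both arms
  -- while `A` has opposite signs, so the slopes have opposite signs.
  have hne : ∀ x ∈ X, m₁ x - m₂ x ≠ 0 := by
    intro x hx hzero
    have hall := eq_zero_of_hasDerivAt_mul (f := fun x => m₁ x - m₂ x)
      (k := fun x => P x * (m₁ x + m₂ x) + R x * (1 + m₁ x ^ 2 + m₁ x * m₂ x + m₂ x ^ 2)) hXo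
      (fun y hy => ((hg₁ y hy.1).2.sub (hg₂ y hy.2).2).congr_deriv (by simp only [m₁, m₂]; ring))
      (by
        have hXΩ : X ⊆ Ω := by
          rintro _ ⟨⟨s, hs, rfl⟩, -⟩
          exact h.mem s hs.1
        have c₁ : ContinuousOn m₁ X := fun y hy =>
          (hg₁ y hy.1).2.continuousAt.continuousWithinAt
        have c₂ : ContinuousOn m₂ X := fun y hy =>
          (hg₂ y hy.2).2.continuousAt.continuousWithinAt
        have cP := h.contP.mono hXΩ
        have cR := h.contR.mono hXΩ
        fun_prop) hx hzero
    have hBc : ContinuousAt B 0 := (h.deriv_B 0 h.zero_mem).continuousAt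
    have hU : {s | 0 < B s * B 0} ∈ 𝓝 (0 : ℝ) := by
      have : ContinuousAt (fun s => B s * B 0) 0 := hBc.mul continuousAt_const
      exact this.eventually_const_lt (mul_self_pos.2 hB0)
    obtain ⟨x₂, hx₂, htip⟩ := h.exists_tip hU
    obtain ⟨y, hy⟩ := exists_between (max_lt hx₁ hx₂)
    have hyX : y ∈ X := hXsub ⟨(le_max_left _ _).trans_lt hy.1, hy.2⟩
    have hz := hall y hyX
    obtain ⟨hs₁, he₁⟩ := hrmem₁ y hyX
    obtain ⟨hs₂, he₂⟩ := hrmem₂ y hyX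
    have b₁ : 0 < B (r₁ y) * B 0 :=
      (htip _ hs₁.1 (by rw [he₁]; exact (le_max_right _ _).trans_lt hy.1)).1
    have b₂ : 0 < B (r₂ y) * B 0 :=
      (htip _ hs₂.1 (by rw [he₂]; exact (le_max_right _ _).trans_lt hy.1)).1
    have a₁ := h.neg _ hs₁.1 hs₁.2
    have a₂ := h.pos _ hs₂.1 hs₂.2
    have e₁ : m₁ y * B 0 < 0 := by
      have : m₁ y * B 0 = B (r₁ y) * B 0 / A (r₁ y) := by simp only [m₁]; ring
      rw [this]
      exact div_neg_of_pos_of_neg b₁ a₁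
    have e₂ : 0 < m₂ y * B 0 := by
      have : m₂ y * B 0 = B (r₂ y) * B 0 / A (r₂ y) := by simp only [m₂]; ring
      rw [this]
      exact div_pos b₂ a₂
    have e₃ : m₁ y = m₂ y := sub_eq_zero.1 hz
    rw [e₃] at e₁
    exact lt_asymm e₁ e₂
  -- The height difference has derivative m₁ - m₂ ≠ 0, so it is strictly monotone, and it tends to 0
  -- at the fold. Hence it has one sign and its absolute value grows away from the fold.
  set D := fun x => (β ∘ r₁) x - (β ∘ r₂) x with hD
  have hDmono := strictMonoOn_or_strictAntiOn_of_hasDerivAt (f := D)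
    (f' := fun x => m₁ x - m₂ x) hXo
    (fun y hy => (hg₁ y hy.1).1.sub (hg₂ y hy.2).1) hne
  have hDlim : ∀ ε > 0, ∃ x₂ < α 0, ∀ x ∈ X, x₂ < x → |D x| < ε := by
    intro ε hε
    have hβc : ContinuousAt β 0 := (h.deriv_snd 0 h.zero_mem).continuousAt
    have hU : {s | |β s - β 0| < ε / 2} ∈ 𝓝 (0 : ℝ) := by
      have : ContinuousAt (fun s => |β s - β 0|) 0 := (hβc.sub continuousAt_const).abs
      exact this.eventually_lt continuousAt_const (by simpa using hε)
    obtain ⟨x₂, hx₂, htip⟩ := h.exists_tip hU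
    refine ⟨x₂, hx₂, fun x hx hlt => ?_⟩
    obtain ⟨hs₁, he₁⟩ := hrmem₁ x hx
    obtain ⟨hs₂, he₂⟩ := hrmem₂ x hx
    have b₁ : |β (r₁ x) - β 0| < ε / 2 := (htip _ hs₁.1 (by rw [he₁]; exact hlt)).1
    have b₂ : |β (r₂ x) - β 0| < ε / 2 := (htip _ hs₂.1 (by rw [he₂]; exact hlt)).1
    have e : D x = (β (r₁ x) - β 0) - (β (r₂ x) - β 0) := by simp only [hD, Function.comp]; ring
    rw [e]
    linarith [abs_sub (β (r₁ x) - β 0) (β (r₂ x) - β 0)]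
  have hXlt : ∀ x ∈ X, x < α 0 := by
    rintro _ ⟨⟨s, hs, rfl⟩, -⟩
    exact h.strictAntiOn ⟨h.zero_mem, le_refl (0 : ℝ)⟩ ⟨hs.1, Ioi_subset_Ici_self hs.2⟩ hs.2
  have hgrow : ∀ x ∈ X, ∀ y ∈ X, x < y → |D y| < |D x| := by
    have key : ∀ E : ℝ → ℝ, StrictMonoOn E X →
        (∀ ε > 0, ∃ x₂ < α 0, ∀ x ∈ X, x₂ < x → |E x| < ε) →
        ∀ x ∈ X, ∀ y ∈ X, x < y → |E y| < |E x| := by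
      intro E hE hlim
      have hneg : ∀ x ∈ X, E x ≤ 0 := by
        intro x hx
        by_contra hpos
        obtain ⟨x₂, hx₂, hsm⟩ := hlim (E x) (not_le.1 hpos)
        obtain ⟨y, hy⟩ := exists_between (max_lt (hXlt x hx) (max_lt hx₁ hx₂))
        have hxy : x < y := (le_max_left _ _).trans_lt hy.1
        have hx₁y : x₁ < y := ((le_max_left _ _).trans (le_max_right _ _)).trans_lt hy.1
        have hx₂y : x₂ < y := ((le_max_right _ _).trans (le_max_right _ _)).trans_lt hy.1
        have hyX : y ∈ X := hXsub ⟨hx₁y, hy.2⟩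
        have h1 := hsm y hyX hx₂y
        have h2 := hE hx hyX hxy
        linarith [le_abs_self (E y)]
      intro x hx y hy hxy
      rw [abs_of_nonpos (hneg x hx), abs_of_nonpos (hneg y hy)]
      exact neg_lt_neg (hE hx hy hxy)
    rcases hDmono with hm | hm
    · exact key D hm hDlim
    · intro x hx y hy hxy
      have := key (fun x => -D x) (fun a ha b hb hab => neg_lt_neg (hm ha hb hab))
        (by simpa only [abs_neg] using hDlim) x hx y hy hxy
      simpa only [abs_neg] using this
  -- The bound is `|D y|`; comparison with a point `z` nearer to the fold shows that it is positive.
  obtain ⟨y, hy⟩ := exists_between (max_lt hx₀ hx₁)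
  obtain ⟨z, hz⟩ := exists_between hy.2
  have hyX : y ∈ X := hXsub ⟨(le_max_right _ _).trans_lt hy.1, hy.2⟩
  have hzX : z ∈ X := hXsub ⟨(le_max_right _ _).trans_lt (hy.1.trans hz.1), hz.2⟩
  refine ⟨y, (le_max_left _ _).trans_lt hy.1, hy.2, |D y|,
    (abs_nonneg _).trans_lt (hgrow y hyX z hzX hz.1), fun s hs t ht hs0 ht0 hst hsy => ?_⟩
  have hxX : α s ∈ X := ⟨⟨s, ⟨hs, hs0⟩, rfl⟩, ⟨t, ⟨ht, ht0⟩, hst.symm⟩⟩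
  have := (hgrow _ hxX y hyX hsy).le
  simp only [hD, Function.comp_apply] at this ⊢
  rwa [hr₁ s ⟨hs, hs0⟩, hst, hr₂ t ⟨ht, ht0⟩] at this

/-- A folded curve does not come back to its arm with positive parameters. -/
theorem IsFoldedCurve.exists_nhds_of_pos (h : IsFoldedCurve P R Ω J α β A B ν) {s : ℝ} (hs : s ∈ J)
    (hs0 : 0 < s) {U : Set ℝ} (hU : U ∈ 𝓝 s) :
    ∃ V ∈ 𝓝 (α s, β s), ∀ t ∈ J, (α t, β t) ∈ V → t ∈ U := by
  have hx₀ : α s < α 0 := h.strictAntiOn ⟨h.zero_mem, le_refl (0 : ℝ)⟩ ⟨hs, hs0.le⟩ hs0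
  obtain ⟨y, hsy, hy0, δ, hδ, hgap⟩ := h.exists_gap hx₀
  have hm : StrictAntiOn α (J ∩ Ioi 0) := h.strictAntiOn.mono (inter_subset_inter_right _ Ioi_subset_Ici_self)
  have ho : IsOpen (J ∩ Ioi 0) := h.isOpen.inter isOpen_Ioi
  have hle := nhds_le_map_of_strictAntiOn ho
    (fun s hs => (h.deriv_fst s hs.1).continuousAt.continuousWithinAt) hm ⟨hs, hs0⟩
  set W := {r | |β r - β s| < δ / 2} with hW
  have hWn : W ∈ 𝓝 s := by
    have : ContinuousAt (fun r => |β r - β s|) s :=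
      ((h.deriv_snd s hs).continuousAt.sub continuousAt_const).abs
    exact this.eventually_lt continuousAt_const (by simpa using hδ)
  -- Each point of this neighbourhood lies under a parameter `r` of the positive arm with `r ∈ U`
  -- and height within δ/2 of `β s`. A point of the other arm that were equally close in height
  -- would violate the gap δ.
  have hV₁ : α '' (U ∩ W ∩ (J ∩ Ioi 0)) ∩ Iio y ∈ 𝓝 (α s) :=
    inter_mem (hle (image_mem_map (inter_mem (inter_mem hU hWn) (ho.mem_nhds ⟨hs, hs0⟩))))
      (Iio_mem_nhds hsy)
  have hV₂ : Metric.ball (β s) (δ / 2) ∈ 𝓝 (β s) := Metric.ball_mem_nhds _ (by linarith)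
  refine ⟨_, prod_mem_nhds hV₁ hV₂, ?_⟩
  rintro t ht ⟨⟨⟨r, ⟨⟨hrU, hrW⟩, hrJ⟩, hrt⟩, hty⟩, hb⟩
  rcases lt_trichotomy t 0 with h0 | h0 | h0
  · exfalso
    have h1 := hgap r hrJ.1 t ht hrJ.2 h0 hrt (by rw [hrt]; exact hty)
    have h2 : |β t - β s| < δ / 2 := by simpa [Real.dist_eq] using hb
    have h3 : |β r - β s| < δ / 2 := hrW
    have e : β r - β t = (β r - β s) - (β t - β s) := by ring
    rw [e] at h1
    linarith [abs_sub (β r - β s) (β t - β s)]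
  · exfalso
    rw [h0] at hty
    exact lt_asymm hy0 hty
  · rwa [← hm.injOn hrJ ⟨ht, h0⟩ hrt]

/-- A folded curve is embedded. -/
theorem IsFoldedCurve.exists_nhds (h : IsFoldedCurve P R Ω J α β A B ν) {s : ℝ} (hs : s ∈ J)
    {U : Set ℝ} (hU : U ∈ 𝓝 s) : ∃ V ∈ 𝓝 (α s, β s), ∀ t ∈ J, (α t, β t) ∈ V → t ∈ U := by
  rcases lt_trichotomy s 0 with h0 | h0 | h0
  · have hU' : {r | -r ∈ U} ∈ 𝓝 (-s) :=
      continuous_neg.continuousAt.preimage_mem_nhds (by simpa using hU)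
    obtain ⟨V, hV, hVU⟩ := h.reverse.exists_nhds_of_pos (s := -s) (by simpa using hs)
      (by simpa using h0) hU'
    refine ⟨V, by simpa using hV, fun t ht hmem => ?_⟩
    simpa using hVU (-t) (by simpa using ht) (by simpa using hmem)
  · subst h0
    obtain ⟨x₁, hx₁, htip⟩ := h.exists_tip hU
    exact ⟨_, prod_mem_nhds (Ioi_mem_nhds hx₁) univ_mem, fun t ht hmem => (htip t ht hmem.1).1⟩
  · exact h.exists_nhds_of_pos hs h0 hU

end FoldedCurve

/-! ### Embeddedness criteria for curves with κ = P(a) A + R(a) B -/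

section PlaneCurve

variable {S : Type*} [TopologicalSpace S]

/-- A curve in the plane, with coordinates `(a, b)` and unit tangent field `(A, B)`, whose curvature
is `P(a) A + R(a) B`. -/
structure IsPlaneCurve (𝒜 : Set (OpenPartialHomeomorph S ℝ × (ℝ → ℝ))) (P R : ℝ → ℝ) (Ω : Set ℝ)
    (a b A B : S → ℝ) : Prop where
  atlas : IsCurveAtlas 𝒜
  cont_a : Continuous a
  cont_b : Continuous b
  cont_A : Continuous A
  cont_B : Continuous B
  mem : ∀ p, a p ∈ Ω
  unit : ∀ p, A p ^ 2 + B p ^ 2 = 1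
  deriv_a : HasTangentDeriv 𝒜 a A
  deriv_b : HasTangentDeriv 𝒜 b B
  deriv_A : HasTangentDeriv 𝒜 A fun p => -((P (a p) * A p + R (a p) * B p) * B p)
  deriv_B : HasTangentDeriv 𝒜 B fun p => (P (a p) * A p + R (a p) * B p) * A p

variable {𝒜 : Set (OpenPartialHomeomorph S ℝ × (ℝ → ℝ))} {P R : ℝ → ℝ} {Ω : Set ℝ}
  {a b A B : S → ℝ}

/-- A curve along which a linear function of the coordinates has nonvanishing derivative is
embedded. -/
theorem IsPlaneCurve.isEmbedding_of_linear [T2Space S] [ConnectedSpace S]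
    (h : IsPlaneCurve 𝒜 P R Ω a b A B) (c₁ c₂ : ℝ) (hne : ∀ p, c₁ * A p + c₂ * B p ≠ 0) :
    IsEmbedding fun p => (a p, b p) := by
  have ho := h.atlas.isOpenEmbedding
    ((continuous_const.mul h.cont_a).add (continuous_const.mul h.cont_b))
    ((h.deriv_a.const_mul c₁).add (h.deriv_b.const_mul c₂)) hne
  exact IsEmbedding.of_comp (g := fun x : ℝ × ℝ => c₁ * x.1 + c₂ * x.2)
    (h.cont_a.prodMk h.cont_b) (by fun_prop) ho.isEmbedding

/-- If the curvature is a multiple of the slope with respect to a fixed direction, the curve is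
either a line in that direction or transversal to it. -/
theorem IsPlaneCurve.isEmbedding_of_proportional [T2Space S] [ConnectedSpace S]
    (h : IsPlaneCurve 𝒜 P R Ω a b A B) {ρ : ℝ → ℝ} {c₁ c₂ : ℝ} (hc : c₁ ^ 2 + c₂ ^ 2 ≠ 0)
    (hρ : ContinuousOn ρ Ω) (hP : ∀ x ∈ Ω, P x = ρ x * c₁) (hR : ∀ x ∈ Ω, R x = ρ x * c₂) :
    IsEmbedding fun p => (a p, b p) := by
  -- Here κ = ρτ, and the tangent turns by (A, B)' = κ(-B, A), so τ' = ρτ(c₂A - c₁B).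
  set τ : S → ℝ := fun p => c₁ * A p + c₂ * B p with hτ
  set k : S → ℝ := fun p => ρ (a p) * (c₂ * A p - c₁ * B p) with hk
  have hτd : HasTangentDeriv 𝒜 τ fun p => k p * τ p := by
    refine ((h.deriv_A.const_mul c₁).add (h.deriv_B.const_mul c₂)).congr fun p => ?_
    simp only [hk, hτ, hP _ (h.mem p), hR _ (h.mem p)]
    ring
  have hτc : Continuous τ := (continuous_const.mul h.cont_A).add (continuous_const.mul h.cont_B)
  have hkc : Continuous k :=
    (hρ.comp_continuous h.cont_a h.mem).mul
      ((continuous_const.mul h.cont_A).sub (continuous_const.mul h.cont_B))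
  by_cases hz : ∃ p, τ p = 0
  · obtain ⟨p, hp⟩ := hz
    have hall := h.atlas.eq_zero_of_abs_tangentDeriv_le hτc hτd (fun p _ => by
      refine ⟨|k p| + 1, ?_⟩
      have : ∀ᶠ q in 𝓝 p, |k q| < |k p| + 1 :=
        hkc.abs.continuousAt.eventually_lt continuousAt_const (lt_add_one _)
      filter_upwards [this] with q hq
      rw [abs_mul]
      exact mul_le_mul_of_nonneg_right hq.le (abs_nonneg _)) hp
    -- The tangent is orthogonal to (c₁, c₂) everywhere, so its component along (-c₂, c₁) cannot
    -- vanish.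
    refine h.isEmbedding_of_linear (-c₂) c₁ fun q hq => hc ?_
    have h1 : c₁ * A q + c₂ * B q = 0 := hall q
    have h2 := h.unit q
    linear_combination (-(c₁ ^ 2 + c₂ ^ 2)) * h2 + (c₁ * A q + c₂ * B q) * h1 +
      (-c₂ * A q + c₁ * B q) * hq
  · exact h.isEmbedding_of_linear c₁ c₂ (not_exists.1 hz)

/-- An equilibrium of the curve: a point with `A = 0` where `R(a) = 0`. -/
theorem IsPlaneCurve.eq_zero_of_equilibrium [ConnectedSpace S]
    (h : IsPlaneCurve 𝒜 P R Ω a b A B) (hP : ContinuousOn P Ω)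
    (hR : ∀ x ∈ Ω, DifferentiableAt ℝ R x) {p : S} (hA : A p = 0) (hRp : R (a p) = 0) :
    ∀ q, A q = 0 := by
  -- The squared distance to the equilibrium in the (a, A)-plane. Differentiability of `R` at its
  -- zero `a p` gives |R(a)| ≤ C|a - a p| nearby, and together with |B| ≤ 1 this bounds |E'| by a
  -- multiple of E.
  set E : S → ℝ := fun q => (a q - a p) * (a q - a p) + A q * A q with hE
  have hEd := ((h.deriv_a.sub_const (a p)).mul (h.deriv_a.sub_const (a p))).add
    (h.deriv_A.mul h.deriv_A)
  have hEc : Continuous E :=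
    ((h.cont_a.sub continuous_const).mul (h.cont_a.sub continuous_const)).add
      (h.cont_A.mul h.cont_A)
  have hPc : Continuous fun q => P (a q) := hP.comp_continuous h.cont_a h.mem
  have hall := h.atlas.eq_zero_of_abs_tangentDeriv_le hEc hEd (fun q hq => by
    have hq1 : a q = a p := by
      have h1 := mul_self_nonneg (a q - a p)
      have h2 := mul_self_nonneg (A q)
      have h3 : (a q - a p) * (a q - a p) + A q * A q = 0 := hq
      have : (a q - a p) * (a q - a p) = 0 := by linarith
      linarith [mul_self_eq_zero.1 this]
    obtain ⟨C, hC⟩ := ((hR _ (h.mem p)).hasDerivAt.isBigO_sub).bound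
    have hC' : ∀ᶠ r in 𝓝 q, |R (a r)| ≤ C * |a r - a p| := by
      have ht : Tendsto a (𝓝 q) (𝓝 (a p)) := by
        have := h.cont_a.tendsto q
        rwa [hq1] at this
      have := ht.eventually hC
      simpa [hRp] using this
    have hP' : ∀ᶠ r in 𝓝 q, |P (a r)| < |P (a q)| + 1 :=
      hPc.abs.continuousAt.eventually_lt continuousAt_const (lt_add_one _)
    refine ⟨1 + 2 * (|P (a q)| + 1) + |C|, ?_⟩
    filter_upwards [hC', hP'] with r h1 h2
    have hB : |B r| ≤ 1 := abs_le_one_iff_mul_self_le_one.2 (by nlinarith [h.unit r])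
    have hBB : |B r * B r| ≤ 1 := by
      rw [abs_mul]
      nlinarith [abs_nonneg (B r)]
    set u := a r - a p with hu
    have hRle : |R (a r)| ≤ |C| * |u| :=
      h1.trans (mul_le_mul_of_nonneg_right (le_abs_self C) (abs_nonneg _))
    have hEr : |E r| = u * u + A r * A r :=
      abs_of_nonneg (add_nonneg (mul_self_nonneg _) (mul_self_nonneg _))
    have h3 : |u| * |A r| ≤ (u * u + A r * A r) / 2 := by
      nlinarith [sq_nonneg (|u| - |A r|), sq_abs u, sq_abs (A r)]
    have e : (A r * u + u * A r) +
        (-((P (a r) * A r + R (a r) * B r) * B r) * A r +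
          A r * -((P (a r) * A r + R (a r) * B r) * B r)) =
        2 * (u * A r) - 2 * (P (a r) * B r * (A r * A r)) - 2 * (R (a r) * A r * (B r * B r)) := by
      ring
    rw [e, hEr]
    have t1 : |2 * (u * A r)| ≤ u * u + A r * A r := by
      rw [abs_mul, abs_mul, abs_two]
      linarith
    have t2 : |2 * (P (a r) * B r * (A r * A r))| ≤
        2 * (|P (a q)| + 1) * (u * u + A r * A r) := by
      rw [abs_mul, abs_mul, abs_mul, abs_two, abs_mul_self]
      have : |P (a r)| * |B r| ≤ |P (a q)| + 1 := by
        calc |P (a r)| * |B r| ≤ |P (a r)| * 1 := mul_le_mul_of_nonneg_left hB (abs_nonneg _)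
          _ ≤ _ := by linarith
      have h4 := mul_le_mul this (le_add_of_nonneg_left (mul_self_nonneg u) :
        A r * A r ≤ u * u + A r * A r) (mul_self_nonneg _) (by positivity)
      linarith
    have t3 : |2 * (R (a r) * A r * (B r * B r))| ≤ |C| * (u * u + A r * A r) := by
      rw [abs_mul, abs_mul, abs_mul, abs_two]
      have h5 : |R (a r)| * |A r| ≤ |C| * (|u| * |A r|) := by
        rw [← mul_assoc]
        exact mul_le_mul_of_nonneg_right hRle (abs_nonneg _)
      have h6 : |R (a r)| * |A r| * |B r * B r| ≤ |R (a r)| * |A r| * 1 :=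
        mul_le_mul_of_nonneg_left hBB (by positivity)
      have h7 := mul_le_mul_of_nonneg_left h3 (abs_nonneg C)
      linarith
    have t4 := abs_sub (2 * (u * A r) - 2 * (P (a r) * B r * (A r * A r)))
      (2 * (R (a r) * A r * (B r * B r)))
    have t5 := abs_sub (2 * (u * A r)) (2 * (P (a r) * B r * (A r * A r)))
    linarith) (p := p) (by simp only [hE, hA]; ring)
  intro q
  have h1 := mul_self_nonneg (a q - a p)
  have h2 := mul_self_nonneg (A q)
  have h3 : (a q - a p) * (a q - a p) + A q * A q = 0 := hall q
  exact mul_self_eq_zero.1 (by linarith)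

/-- A curve with a function `g(a) A` that increases along it, away from equilibria, is embedded. -/
theorem IsPlaneCurve.isEmbedding_of_lyapunov [T2Space S] [ConnectedSpace S]
    (h : IsPlaneCurve 𝒜 P R Ω a b A B) (hP : ContinuousOn P Ω)
    (hR : ∀ x ∈ Ω, DifferentiableAt ℝ R x) {g g' : ℝ → ℝ}
    (hg : ∀ x ∈ Ω, HasDerivAt g (g' x) x)
    (hform : ∀ x ∈ Ω, ∀ X Y : ℝ, X ^ 2 + Y ^ 2 = 1 → (X ≠ 0 ∨ R x ≠ 0) →
      0 < g' x * X ^ 2 - g x * P x * X * Y - g x * R x * Y ^ 2) :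
    IsEmbedding fun p => (a p, b p) := by
  -- Through an equilibrium `A` vanishes identically, so |B| = 1 and `b` is monotone.
  by_cases heq : ∃ p, A p = 0 ∧ R (a p) = 0
  · obtain ⟨p₀, hA₀, hR₀⟩ := heq
    have hall := h.eq_zero_of_equilibrium hP hR hA₀ hR₀
    refine h.isEmbedding_of_linear 0 1 fun p hp => ?_
    have := h.unit p
    rw [hall p] at this
    have hB : B p = 0 := by simpa using hp
    rw [hB] at this
    norm_num at this
  by_cases hA : ∃ p, A p = 0
  swap
  · exact h.isEmbedding_of_linear 1 0 fun p hp => hA ⟨p, by simpa using hp⟩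
  obtain ⟨p₀, hp₀⟩ := hA
  -- Away from equilibria the derivative `G₁` is positive by `hform`, so `G` serves as a global
  -- parameter, with value 0 at the zero `p₀` of `A`.
  set G : S → ℝ := fun p => g (a p) * A p with hG
  set G₁ : S → ℝ := fun p =>
    g' (a p) * A p ^ 2 - g (a p) * P (a p) * A p * B p - g (a p) * R (a p) * B p ^ 2 with hG₁
  have hG₁pos : ∀ p, 0 < G₁ p := fun p => by
    refine hform _ (h.mem p) _ _ (h.unit p) ?_
    by_contra hcon
    push Not at hcon
    exact heq ⟨p, hcon⟩
  have hG₁ne : ∀ p, G₁ p ≠ 0 := fun p => (hG₁pos p).ne'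
  have hgc : Continuous fun p => g (a p) := by
    rw [continuous_iff_continuousAt]
    exact fun p => ContinuousAt.comp (hg _ (h.mem p)).continuousAt h.cont_a.continuousAt
  have hGd : HasTangentDeriv 𝒜 G G₁ := by
    refine ((h.deriv_a.scomp fun p => hg _ (h.mem p)).mul h.deriv_A).congr fun p => ?_
    simp only [hG₁]
    ring
  have hGe : IsOpenEmbedding G := h.atlas.isOpenEmbedding (hgc.mul h.cont_A) hGd hG₁ne
  have hG0 : G p₀ = 0 := by simp only [hG, hp₀, mul_zero]
  have hg0 : g (a p₀) * R (a p₀) < 0 := by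
    have hu := h.unit p₀
    have := hG₁pos p₀
    simp only [hG₁, hp₀] at this hu
    nlinarith
  -- A zero of g(a) is a zero of `G`, hence is `p₀`; but at `p₀` positivity of `G₁` reads gR < 0. So
  -- g(a) has a constant sign, and the sign of `A` is that of the parameter `G` or its opposite.
  have hgne : ∀ p, g (a p) ≠ 0 := by
    intro p hp
    have : p = p₀ := hGe.injective (by rw [hG0]; simp only [hG, hp, zero_mul])
    rw [this] at hp
    rw [hp, zero_mul] at hg0
    exact lt_irrefl _ hg0
  set θ := Function.invFun G
  have hθ : ∀ p, θ (G p) = p := Function.leftInverse_invFun hGe.injective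
  have hD : ∀ {F F₁ : S → ℝ}, HasTangentDeriv 𝒜 F F₁ → ∀ p,
      HasDerivAt (F ∘ θ) (F₁ p / G₁ p) (G p) := fun hF p =>
    h.atlas.hasDerivAt_of_leftInverse hGe hGd hG₁ne hF hθ p
  have hJo : IsOpen (range G) := hGe.isOpen_range
  have hJc : OrdConnected (range G) := (isPreconnected_range hGe.continuous).ordConnected
  have hJ0 : (0 : ℝ) ∈ range G := ⟨p₀, hG0⟩
  have hRc : ContinuousOn R Ω := fun x hx => (hR x hx).continuousAt.continuousWithinAt
  have hfold : ∀ p, ∀ U ∈ 𝓝 (G p), ∃ V ∈ 𝓝 (a p, b p), ∀ q, (a q, b q) ∈ V → G q ∈ U := by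
    rcases lt_or_gt_of_ne (hgne p₀) with hsign | hsign
    · have hgneg : ∀ p, g (a p) < 0 := by
        intro p
        by_contra hcon
        obtain ⟨q, hq⟩ := mem_range_of_exists_le_of_exists_ge hgc ⟨p₀, hsign.le⟩ ⟨p, not_lt.1 hcon⟩
        exact hgne q hq
      have hf : IsFoldedCurve P R Ω (range G) (a ∘ θ) (b ∘ θ) (A ∘ θ) (B ∘ θ)
          (fun s => 1 / G₁ (θ s)) := by
        refine ⟨hJo, hJc, hJ0, hP, hRc, ?_, ?_, ?_, ?_, ?_, ?_, ?_, ?_, ?_⟩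
        · rintro _ ⟨p, rfl⟩
          exact h.mem _
        · rintro _ ⟨p, rfl⟩
          exact one_div_pos.2 (hG₁pos _)
        · rintro _ ⟨p, rfl⟩
          exact h.unit _
        · rintro _ ⟨p, rfl⟩
          refine (hD h.deriv_a p).congr_deriv ?_
          simp only [Function.comp_apply, hθ]
          ring
        · rintro _ ⟨p, rfl⟩
          refine (hD h.deriv_b p).congr_deriv ?_
          simp only [Function.comp_apply, hθ]
          ring
        · rintro _ ⟨p, rfl⟩
          refine (hD h.deriv_A p).congr_deriv ?_
          simp only [Function.comp_apply, hθ]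
          ring
        · rintro _ ⟨p, rfl⟩
          refine (hD h.deriv_B p).congr_deriv ?_
          simp only [Function.comp_apply, hθ]
          ring
        · rintro _ ⟨p, rfl⟩ hs
          simp only [Function.comp_apply, hθ]
          exact pos_of_mul_neg_right hs (hgneg p).le
        · rintro _ ⟨p, rfl⟩ hs
          simp only [Function.comp_apply, hθ]
          exact neg_of_mul_pos_right hs (hgneg p).le
      intro p U hU
      obtain ⟨V, hV, hVU⟩ := hf.exists_nhds ⟨p, rfl⟩ hU
      simp only [Function.comp_apply, hθ] at hV
      exact ⟨V, hV, fun q hq => hVU (G q) ⟨q, rfl⟩ (by simpa only [Function.comp_apply, hθ] using hq)⟩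
    · have hgpos : ∀ p, 0 < g (a p) := by
        intro p
        by_contra hcon
        obtain ⟨q, hq⟩ := mem_range_of_exists_le_of_exists_ge hgc ⟨p, not_lt.1 hcon⟩ ⟨p₀, hsign.le⟩
        exact hgne q hq
      -- When g > 0 the first coordinate decreases before the fold. The reflection a ↦ -a reverses
      -- `A` and the sign of the curvature, which turns (P, R) into (P(-x), -R(-x)).
      have hf : IsFoldedCurve (fun x => P (-x)) (fun x => -R (-x)) {x | -x ∈ Ω} (range G)
          (fun s => -a (θ s)) (b ∘ θ) (fun s => -A (θ s)) (B ∘ θ) (fun s => 1 / G₁ (θ s)) := by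
        refine ⟨hJo, hJc, hJ0, hP.comp continuous_neg.continuousOn fun x hx => hx,
          (hRc.comp continuous_neg.continuousOn fun x hx => hx).neg,
          ?_, ?_, ?_, ?_, ?_, ?_, ?_, ?_, ?_⟩
        · rintro _ ⟨p, rfl⟩
          simpa using h.mem _
        · rintro _ ⟨p, rfl⟩
          exact one_div_pos.2 (hG₁pos _)
        · rintro _ ⟨p, rfl⟩
          simpa using h.unit _
        · rintro _ ⟨p, rfl⟩
          refine (hD h.deriv_a p).neg.congr_deriv ?_
          simp only [hθ]
          ring
        · rintro _ ⟨p, rfl⟩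
          refine (hD h.deriv_b p).congr_deriv ?_
          simp only [Function.comp_apply, hθ]
          ring
        · rintro _ ⟨p, rfl⟩
          refine (hD h.deriv_A p).neg.congr_deriv ?_
          simp only [Function.comp_apply, hθ, neg_neg]
          ring
        · rintro _ ⟨p, rfl⟩
          refine (hD h.deriv_B p).congr_deriv ?_
          simp only [Function.comp_apply, hθ, neg_neg]
          ring
        · rintro _ ⟨p, rfl⟩ hs
          simp only [hθ]
          exact neg_pos.2 (neg_of_mul_neg_right hs (hgpos p).le)
        · rintro _ ⟨p, rfl⟩ hs
          simp only [hθ]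
          exact neg_neg_of_pos (pos_of_mul_pos_right hs (hgpos p).le)
      intro p U hU
      obtain ⟨V, hV, hVU⟩ := hf.exists_nhds ⟨p, rfl⟩ hU
      simp only [Function.comp_apply, hθ] at hV
      refine ⟨(fun x : ℝ × ℝ => (-x.1, x.2)) ⁻¹' V,
        ContinuousAt.preimage_mem_nhds (by fun_prop) hV, fun q hq => hVU (G q) ⟨q, rfl⟩ ?_⟩
      simpa only [Function.comp_apply, hθ, mem_preimage] using hq
  have hc : Continuous fun p => (a p, b p) := h.cont_a.prodMk h.cont_b
  refine IsInducing.isEmbedding (isInducing_iff_nhds.2 fun p => le_antisymm ?_ ?_)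
  · exact map_le_iff_le_comap.1 hc.continuousAt
  · intro U hU
    obtain ⟨V, hV, hVU⟩ := hfold p (G '' U) (hGe.image_mem_nhds.2 hU)
    refine mem_comap.2 ⟨V, hV, fun q hq => ?_⟩
    obtain ⟨r, hr, hrq⟩ := hVU q hq
    rwa [← hGe.injective hrq]

end PlaneCurve

/-! ### Partial derivatives of parametrizations with separated variables -/

section PartialDerivatives

/-- `u` has derivative `u₁` near `s`, and `u₁` has derivative `u₂` at `s`. -/
def HasDerivTwice (u u₁ : ℝ → ℝ) (u₂ s : ℝ) : Prop :=
  (∀ᶠ r in 𝓝 s, HasDerivAt u (u₁ r) r) ∧ HasDerivAt u₁ u₂ s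

theorem hasDerivTwice_const (c s : ℝ) : HasDerivTwice (fun _ => c) (fun _ => 0) 0 s :=
  ⟨Eventually.of_forall fun r => hasDerivAt_const r c, hasDerivAt_const s 0⟩

theorem hasDerivTwice_id (s : ℝ) : HasDerivTwice (fun t => t) (fun _ => 1) 0 s :=
  ⟨Eventually.of_forall fun r => hasDerivAt_id r, hasDerivAt_const s 1⟩

theorem hasDerivTwice_exp (s : ℝ) : HasDerivTwice Real.exp Real.exp (Real.exp s) s :=
  ⟨Eventually.of_forall fun r => Real.hasDerivAt_exp r, Real.hasDerivAt_exp s⟩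

theorem HasDerivTwice.comp {g g₁ g₂ : ℝ → ℝ} {u u₁ : ℝ → ℝ} {u₂ s : ℝ}
    (hg : ∀ x, HasDerivAt g (g₁ x) x) (hg₁ : ∀ x, HasDerivAt g₁ (g₂ x) x)
    (hu : HasDerivTwice u u₁ u₂ s) :
    HasDerivTwice (fun r => g (u r)) (fun r => g₁ (u r) * u₁ r)
      (g₂ (u s) * u₁ s ^ 2 + g₁ (u s) * u₂) s := by
  refine ⟨?_, ?_⟩
  · filter_upwards [hu.1] with r hr using (hg _).comp r hr
  · have h := hu.1.self_of_nhds
    exact (((hg₁ _).comp s h).mul hu.2).congr_deriv (by simp only [Function.comp_apply]; ring)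

theorem HasDerivTwice.mul {u u₁ v v₁ : ℝ → ℝ} {u₂ v₂ s : ℝ} (hu : HasDerivTwice u u₁ u₂ s)
    (hv : HasDerivTwice v v₁ v₂ s) :
    HasDerivTwice (fun r => u r * v r) (fun r => u₁ r * v r + u r * v₁ r)
      (u₂ * v s + 2 * (u₁ s * v₁ s) + u s * v₂) s := by
  refine ⟨?_, ?_⟩
  · filter_upwards [hu.1, hv.1] with r hr hr' using hr.mul hr'
  · have h := hu.1.self_of_nhds
    have h' := hv.1.self_of_nhds
    exact ((hu.2.mul h').add (h.mul hv.2)).congr_deriv (by ring)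

/-- A parametrization whose components are products, respectively a sum, of functions of one
variable. -/
def sepMap (u v z u' v' z' : ℝ → ℝ) (y : Param) : Coord :=
  ![u (y 0) * u' (y 1), v (y 0) * v' (y 1), z (y 0) + z' (y 1)]

variable {f : Param → Coord} {u v z u' v' z' : ℝ → ℝ} {x : Param}

/-- All the invariant parametrizations used below have this separated form, so their derivatives
reduce to those of functions of one variable. -/
theorem partialDeriv_sepMap {u₁ v₁ z₁ u₁' v₁' z₁' : ℝ} (hf : f =ᶠ[𝓝 x] sepMap u v z u' v' z')
    (hu : HasDerivAt u u₁ (x 0)) (hv : HasDerivAt v v₁ (x 0)) (hz : HasDerivAt z z₁ (x 0))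
    (hu' : HasDerivAt u' u₁' (x 1)) (hv' : HasDerivAt v' v₁' (x 1))
    (hz' : HasDerivAt z' z₁' (x 1)) :
    partialDeriv 0 f x = ![u₁ * u' (x 1), v₁ * v' (x 1), z₁] ∧
      partialDeriv 1 f x = ![u (x 0) * u₁', v (x 0) * v₁', z₁'] := by
  have hp : ∀ i : Fin 2, HasFDerivAt (fun y : Param => y i)
      (EuclideanSpace.proj i : Param →L[ℝ] ℝ) x := fun i =>
    (EuclideanSpace.proj i : Param →L[ℝ] ℝ).hasFDerivAt
  have hl : ∀ {g : ℝ → ℝ} {d : ℝ}, HasDerivAt g d (x 0) → HasFDerivAt (fun y : Param => g (y 0))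
      (d • (EuclideanSpace.proj 0 : Param →L[ℝ] ℝ)) x := fun h => h.comp_hasFDerivAt x (hp 0)
  have hr : ∀ {g : ℝ → ℝ} {d : ℝ}, HasDerivAt g d (x 1) → HasFDerivAt (fun y : Param => g (y 1))
      (d • (EuclideanSpace.proj 1 : Param →L[ℝ] ℝ)) x := fun h => h.comp_hasFDerivAt x (hp 1)
  have h0 := (hl hu).mul (hr hu')
  have h1 := (hl hv).mul (hr hv')
  have h2 := (hl hz).add (hr hz')
  have hd : DifferentiableAt ℝ f x := by
    refine DifferentiableAt.congr_of_eventuallyEq ?_ hf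
    rw [differentiableAt_pi]
    intro i
    fin_cases i
    · exact h0.differentiableAt
    · exact h1.differentiableAt
    · exact h2.differentiableAt
  have happ : ∀ w : Param, fderiv ℝ f x w = ![fderiv ℝ (fun y => f y 0) x w,
      fderiv ℝ (fun y => f y 1) x w, fderiv ℝ (fun y => f y 2) x w] := by
    intro w
    ext i
    have hi : fderiv ℝ f x w i = fderiv ℝ (fun y => f y i) x w := by
      rw [fderiv_apply hd]
      rfl
    rw [hi]
    fin_cases i <;> rfl
  have e0 : fderiv ℝ (fun y => f y 0) x = _ :=
    (h0.congr_of_eventuallyEq (f₁ := fun y => f y 0) (by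
      filter_upwards [hf] with y hy; rw [hy]; rfl)).fderiv
  have e1 : fderiv ℝ (fun y => f y 1) x = _ :=
    (h1.congr_of_eventuallyEq (f₁ := fun y => f y 1) (by
      filter_upwards [hf] with y hy; rw [hy]; rfl)).fderiv
  have e2 : fderiv ℝ (fun y => f y 2) x = _ :=
    (h2.congr_of_eventuallyEq (f₁ := fun y => f y 2) (by
      filter_upwards [hf] with y hy; rw [hy]; rfl)).fderiv
  constructor
  · unfold partialDeriv
    rw [happ, e0, e1, e2]
    ext i
    fin_cases i <;> simp [mul_comm]
  · unfold partialDeriv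
    rw [happ, e0, e1, e2]
    ext i
    fin_cases i <;> simp [mul_comm]

/-- The first partial derivatives are themselves separated maps near `x`, so the first order formula
can be applied to them again. -/
theorem partialDeriv_partialDeriv_sepMap {u₁ v₁ z₁ u₁' v₁' z₁' : ℝ → ℝ}
    {u₂ v₂ z₂ u₂' v₂' z₂' : ℝ} (hf : f =ᶠ[𝓝 x] sepMap u v z u' v' z')
    (hu : HasDerivTwice u u₁ u₂ (x 0)) (hv : HasDerivTwice v v₁ v₂ (x 0))
    (hz : HasDerivTwice z z₁ z₂ (x 0)) (hu' : HasDerivTwice u' u₁' u₂' (x 1))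
    (hv' : HasDerivTwice v' v₁' v₂' (x 1)) (hz' : HasDerivTwice z' z₁' z₂' (x 1)) :
    partialDeriv 0 (partialDeriv 0 f) x = ![u₂ * u' (x 1), v₂ * v' (x 1), z₂] ∧
    partialDeriv 0 (partialDeriv 1 f) x = ![u₁ (x 0) * u₁' (x 1), v₁ (x 0) * v₁' (x 1), 0] ∧
    partialDeriv 1 (partialDeriv 1 f) x = ![u (x 0) * u₂', v (x 0) * v₂', z₂'] := by
  have hp : ∀ i : Fin 2, Tendsto (fun y : Param => y i) (𝓝 x) (𝓝 (x i)) := fun i =>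
    (EuclideanSpace.proj i : Param →L[ℝ] ℝ).continuous.tendsto x
  have hev : ∀ᶠ y in 𝓝 x, partialDeriv 0 f y = sepMap u₁ v₁ z₁ u' v' (fun _ => 0) y ∧
      partialDeriv 1 f y = sepMap u v (fun _ => 0) u₁' v₁' z₁' y := by
    filter_upwards [hf.eventuallyEq_nhds, (hp 0).eventually hu.1, (hp 0).eventually hv.1,
      (hp 0).eventually hz.1, (hp 1).eventually hu'.1, (hp 1).eventually hv'.1,
      (hp 1).eventually hz'.1] with y hy h1 h2 h3 h4 h5 h6
    have := partialDeriv_sepMap hy h1 h2 h3 h4 h5 h6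
    rw [this.1, this.2]
    simp [sepMap]
  have k0 := partialDeriv_sepMap (hev.mono fun y hy => hy.1) hu.2 hv.2 hz.2 hu'.1.self_of_nhds
    hv'.1.self_of_nhds (hasDerivAt_const _ _)
  have k1 := partialDeriv_sepMap (hev.mono fun y hy => hy.2) hu.1.self_of_nhds
    hv.1.self_of_nhds (hasDerivAt_const _ _) hu'.2 hv'.2 hz'.2
  exact ⟨k0.1, k1.1, k1.2⟩

/-- The mean curvature in terms of the values of the derivatives of the parametrization. -/
theorem meanCurvature_mul_eq {n q f₀ f₁ f₀₀ f₀₁ f₁₁ : Coord} {g₀₀ g₀₁ g₁₁ b₀₀ b₀₁ b₁₁ H : ℝ}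
    (hH : meanCurvature f n x = H)
    (hq : f x = q) (h0 : partialDeriv 0 f x = f₀) (h1 : partialDeriv 1 f x = f₁)
    (h00 : partialDeriv 0 (partialDeriv 0 f) x = f₀₀)
    (h01 : partialDeriv 0 (partialDeriv 1 f) x = f₀₁)
    (h11 : partialDeriv 1 (partialDeriv 1 f) x = f₁₁)
    (hg₀₀ : inn q f₀ f₀ = g₀₀) (hg₀₁ : inn q f₀ f₁ = g₀₁) (hg₁₁ : inn q f₁ f₁ = g₁₁)
    (hb₀₀ : inn q n (f₀₀ + christoffel q f₀ f₀) = b₀₀)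
    (hb₀₁ : inn q n (f₀₁ + christoffel q f₀ f₁) = b₀₁)
    (hb₁₁ : inn q n (f₁₁ + christoffel q f₁ f₁) = b₁₁) (hW : g₀₀ * g₁₁ - g₀₁ ^ 2 ≠ 0) :
    b₀₀ * g₁₁ - 2 * b₀₁ * g₀₁ + b₁₁ * g₀₀ = H * (2 * (g₀₀ * g₁₁ - g₀₁ ^ 2)) := by
  unfold meanCurvature secondForm firstForm covDeriv at hH
  rwa [hq, h0, h1, h00, h01, h11, hg₀₀, hg₀₁, hg₁₁, hb₀₀, hb₀₁, hb₁₁, div_eq_iff] at hH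
  exact mul_ne_zero two_ne_zero hW

theorem inn_vec (q₀ q₁ q₂ a b c a' b' c' : ℝ) :
    inn ![q₀, q₁, q₂] ![a, b, c] ![a', b', c'] = (a * a' + b * b') / q₁ ^ 2 + c * c' := rfl

theorem christoffel_vec (q₀ q₁ q₂ a b c a' b' c' : ℝ) :
    christoffel ![q₀, q₁, q₂] ![a, b, c] ![a', b', c'] =
      ![-(a * b' + b * a') / q₁, (a * a' - b * b') / q₁, 0] := rfl

theorem add_vec (a b c a' b' c' : ℝ) :
    (![a, b, c] : Coord) + ![a', b', c'] = ![a + a', b + b', c + c'] := by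
  ext i
  fin_cases i <;> rfl

end PartialDerivatives

/-! ### The translator equation as a curvature equation of the profile -/

section Curvature

variable {f : Param → Coord} {n₀ n₁ n₂ X₀ X₁ X₂ : ℝ} {x : Param} {α β α₁ β₁ : ℝ → ℝ} {α₂ β₂ : ℝ}

/-- The curvature equation of a vertical cylinder over the curve `(β, α)` of the half-plane. -/
theorem curvature_vertical (hf : f =ᶠ[𝓝 x] fun y => ![β (y 0), α (y 0), y 1])
    (hα : HasDerivTwice α α₁ α₂ (x 0)) (hβ : HasDerivTwice β β₁ β₂ (x 0)) (hpos : 0 < α (x 0))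
    (hreg : α₁ (x 0) ^ 2 + β₁ (x 0) ^ 2 ≠ 0)
    (hn : inn (f x) ![n₀, n₁, n₂] ![n₀, n₁, n₂] = 1)
    (hn0 : inn (f x) ![n₀, n₁, n₂] (partialDeriv 0 f x) = 0)
    (hn1 : inn (f x) ![n₀, n₁, n₂] (partialDeriv 1 f x) = 0)
    (hH : meanCurvature f ![n₀, n₁, n₂] x = inn (f x) ![n₀, n₁, n₂] ![X₀, X₁, X₂]) {A B : ℝ}
    (hA : n₀ = α (x 0) * A) (hB : n₁ = -(α (x 0) * B)) :
    A ^ 2 + B ^ 2 = 1 ∧ A * β₁ (x 0) = B * α₁ (x 0) ∧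
      A * β₂ - B * α₂ = (B / α (x 0) + 2 / α (x 0) ^ 2 * (A * X₀ - B * X₁)) *
        (α₁ (x 0) ^ 2 + β₁ (x 0) ^ 2) := by
  have hfx : f x = ![β (x 0), α (x 0), x 1] := hf.self_of_nhds
  have hf' : f =ᶠ[𝓝 x] sepMap β α (fun _ => 0) (fun _ => 1) (fun _ => 1) (fun t => t) := by
    filter_upwards [hf] with y hy
    rw [hy]
    simp [sepMap]
  have c0 := hasDerivTwice_const 0 (x 0)
  have c1 := hasDerivTwice_const 1 (x 1)
  have ci := hasDerivTwice_id (x 1)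
  obtain ⟨p0, p1⟩ := partialDeriv_sepMap hf' hβ.1.self_of_nhds hα.1.self_of_nhds
    c0.1.self_of_nhds c1.1.self_of_nhds c1.1.self_of_nhds ci.1.self_of_nhds
  obtain ⟨p00, p01, p11⟩ := partialDeriv_partialDeriv_sepMap hf' hβ hα c0 c1 c1 ci
  beta_reduce at p0 p1 p00 p01 p11
  have hX := congrArg (fun q => inn q ![n₀, n₁, n₂] ![X₀, X₁, X₂]) hfx
  have hy : α (x 0) ≠ 0 := hpos.ne'
  rw [hfx] at hn
  rw [hfx, p0] at hn0
  rw [hfx, p1] at hn1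
  rw [inn_vec] at hn hn0 hn1
  have h2 : n₂ = 0 := by linear_combination hn1
  subst hA hB h2
  have hlin : A * β₁ (x 0) = B * α₁ (x 0) := by
    field_simp at hn0
    linarith
  refine ⟨?_, hlin, ?_⟩
  · field_simp at hn
    linarith
  -- The orbits are vertical geodesics orthogonal to the profile, so only `b₀₀` contributes to the
  -- mean curvature.
  have e := meanCurvature_mul_eq (hH.trans hX) hfx p0 p1 p00 p01 p11
    (g₀₀ := (α₁ (x 0) ^ 2 + β₁ (x 0) ^ 2) / α (x 0) ^ 2) (g₀₁ := 0) (g₁₁ := 1)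
    (b₀₀ := (A * β₂ - B * α₂) / α (x 0) -
      B * (α₁ (x 0) ^ 2 + β₁ (x 0) ^ 2) / α (x 0) ^ 2) (b₀₁ := 0) (b₁₁ := 0)
    (by rw [inn_vec]; ring) (by rw [inn_vec]; ring) (by rw [inn_vec]; ring)
    (by
      rw [christoffel_vec, add_vec, inn_vec]
      field_simp
      linear_combination (-2 * α₁ (x 0)) * hlin)
    (by rw [christoffel_vec, add_vec, inn_vec]; ring)
    (by rw [christoffel_vec, add_vec, inn_vec]; ring)
    (by
      simp only [mul_one, ne_eq, OfNat.ofNat_ne_zero, not_false_eq_true, zero_pow, sub_zero]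
      exact div_ne_zero hreg (pow_ne_zero 2 hy))
  rw [inn_vec] at e
  field_simp at e ⊢
  linear_combination e

/-- The curvature equation of a vertical cylinder, the curve of the half-plane being given in polar
coordinates. -/
theorem curvature_polar
    (hf : f =ᶠ[𝓝 x] fun y => ![Real.exp (β (y 0)) * Real.cos (α (y 0)),
      Real.exp (β (y 0)) * Real.sin (α (y 0)), y 1])
    (hα : HasDerivTwice α α₁ α₂ (x 0)) (hβ : HasDerivTwice β β₁ β₂ (x 0))
    (hpos : 0 < Real.sin (α (x 0))) (hreg : α₁ (x 0) ^ 2 + β₁ (x 0) ^ 2 ≠ 0)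
    (hn : inn (f x) ![n₀, n₁, n₂] ![n₀, n₁, n₂] = 1)
    (hn0 : inn (f x) ![n₀, n₁, n₂] (partialDeriv 0 f x) = 0)
    (hn1 : inn (f x) ![n₀, n₁, n₂] (partialDeriv 1 f x) = 0)
    (hH : meanCurvature f ![n₀, n₁, n₂] x = inn (f x) ![n₀, n₁, n₂]
      ![Real.exp (β (x 0)) * Real.cos (α (x 0)), Real.exp (β (x 0)) * Real.sin (α (x 0)), 0])
    {A B : ℝ}
    (hA : n₀ = Real.exp (β (x 0)) * Real.sin (α (x 0)) *
      (A * Real.cos (α (x 0)) + B * Real.sin (α (x 0))))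
    (hB : n₁ = Real.exp (β (x 0)) * Real.sin (α (x 0)) *
      (A * Real.sin (α (x 0)) - B * Real.cos (α (x 0)))) :
    A ^ 2 + B ^ 2 = 1 ∧ A * β₁ (x 0) = B * α₁ (x 0) ∧
      A * β₂ - B * α₂ = (2 / Real.sin (α (x 0)) ^ 2 * A +
        Real.cos (α (x 0)) / Real.sin (α (x 0)) * B) * (α₁ (x 0) ^ 2 + β₁ (x 0) ^ 2) := by
  have hfx : f x = ![Real.exp (β (x 0)) * Real.cos (α (x 0)),
    Real.exp (β (x 0)) * Real.sin (α (x 0)), x 1] := hf.self_of_nhds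
  have hf' : f =ᶠ[𝓝 x] sepMap (fun s => Real.exp (β s) * Real.cos (α s))
      (fun s => Real.exp (β s) * Real.sin (α s)) (fun _ => 0) (fun _ => 1) (fun _ => 1)
      (fun t => t) := by
    filter_upwards [hf] with y hy
    rw [hy]
    simp [sepMap]
  have hexp := HasDerivTwice.comp Real.hasDerivAt_exp Real.hasDerivAt_exp hβ
  have hcos := HasDerivTwice.comp (g₁ := fun t => -Real.sin t) (g₂ := fun t => -Real.cos t)
    Real.hasDerivAt_cos (fun t => (Real.hasDerivAt_sin t).neg) hα
  have hsin := HasDerivTwice.comp (g₂ := fun t => -Real.sin t) Real.hasDerivAt_sin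
    Real.hasDerivAt_cos hα
  have hx := hexp.mul hcos
  have hy := hexp.mul hsin
  have c0 := hasDerivTwice_const 0 (x 0)
  have c1 := hasDerivTwice_const 1 (x 1)
  have ci := hasDerivTwice_id (x 1)
  obtain ⟨p0, p1⟩ := partialDeriv_sepMap hf' hx.1.self_of_nhds hy.1.self_of_nhds
    c0.1.self_of_nhds c1.1.self_of_nhds c1.1.self_of_nhds ci.1.self_of_nhds
  obtain ⟨p00, p01, p11⟩ := partialDeriv_partialDeriv_sepMap hf' hx hy c0 c1 c1 ci
  beta_reduce at p0 p1 p00 p01 p11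
  have hX := congrArg (fun q => inn q ![n₀, n₁, n₂] ![Real.exp (β (x 0)) * Real.cos (α (x 0)),
    Real.exp (β (x 0)) * Real.sin (α (x 0)), 0]) hfx
  have hE0 := (Real.exp_pos (β (x 0))).ne'
  have hS0 := hpos.ne'
  have hsc := Real.sin_sq_add_cos_sq (α (x 0))
  rw [hfx] at hn
  rw [hfx, p0] at hn0
  rw [hfx, p1] at hn1
  rw [inn_vec] at hn hn0 hn1
  have hH' := hH.trans hX
  simp only [inn_vec] at hH'
  -- From here the claims are algebraic identities in free variables, the only relation between S
  -- and C being S² + C² = 1.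
  generalize Real.exp (β (x 0)) = E at *
  generalize Real.sin (α (x 0)) = S at *
  generalize Real.cos (α (x 0)) = C at *
  generalize α₁ (x 0) = a₁ at *
  generalize β₁ (x 0) = b₁ at *
  have h2 : n₂ = 0 := by linear_combination hn1
  subst hA hB h2
  have hlin : A * b₁ = B * a₁ := by
    field_simp at hn0
    linear_combination hn0 - (A * b₁ - B * a₁) * hsc
  refine ⟨?_, hlin, ?_⟩
  · field_simp at hn
    linear_combination hn - (A ^ 2 + B ^ 2) * hsc
  have e := meanCurvature_mul_eq hH' hfx p0 p1 p00 p01 p11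
    (g₀₀ := (a₁ ^ 2 + b₁ ^ 2) / S ^ 2) (g₀₁ := 0) (g₁₁ := 1)
    (b₀₀ := (A * β₂ - B * α₂) / S - C * B * (a₁ ^ 2 + b₁ ^ 2) / S ^ 2) (b₀₁ := 0) (b₁₁ := 0)
    (by
      rw [inn_vec]
      field_simp
      linear_combination (a₁ ^ 2 + b₁ ^ 2) * hsc)
    (by rw [inn_vec]; ring) (by rw [inn_vec]; ring)
    (by
      rw [christoffel_vec, add_vec, inn_vec]
      field_simp
      linear_combination (S * (A * β₂ - B * α₂) - C * (B * (b₁ ^ 2 - a₁ ^ 2) + 2 * A * a₁ * b₁)) * hsc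
        - 2 * C * a₁ * hlin)
    (by rw [christoffel_vec, add_vec, inn_vec]; ring)
    (by rw [christoffel_vec, add_vec, inn_vec]; ring)
    (by
      simp only [mul_one, ne_eq, OfNat.ofNat_ne_zero, not_false_eq_true, zero_pow, sub_zero]
      exact div_ne_zero hreg (pow_ne_zero 2 hS0))
  field_simp at e ⊢
  linear_combination e + 2 * A * (a₁ ^ 2 + b₁ ^ 2) * hsc

/-- The curvature equation of the surface generated by parabolic translations of a curve `(α, β)`. -/
theorem curvature_parabolic
    (hf : f =ᶠ[𝓝 x] fun y => ![y 1, Real.exp (α (y 0)), β (y 0)])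
    (hα : HasDerivTwice α α₁ α₂ (x 0)) (hβ : HasDerivTwice β β₁ β₂ (x 0))
    (hreg : α₁ (x 0) ^ 2 + β₁ (x 0) ^ 2 ≠ 0)
    (hn : inn (f x) ![n₀, n₁, n₂] ![n₀, n₁, n₂] = 1)
    (hn0 : inn (f x) ![n₀, n₁, n₂] (partialDeriv 0 f x) = 0)
    (hn1 : inn (f x) ![n₀, n₁, n₂] (partialDeriv 1 f x) = 0)
    (hH : meanCurvature f ![n₀, n₁, n₂] x = inn (f x) ![n₀, n₁, n₂] ![X₀, X₁, X₂])
    {A B : ℝ} (hA : n₂ = A) (hB : n₁ = -(Real.exp (α (x 0)) * B)) :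
    A ^ 2 + B ^ 2 = 1 ∧ A * β₁ (x 0) = B * α₁ (x 0) ∧
      A * β₂ - B * α₂ = (B + 2 * (A * X₂ - B * X₁ / Real.exp (α (x 0)))) *
        (α₁ (x 0) ^ 2 + β₁ (x 0) ^ 2) := by
  have hfx : f x = ![x 1, Real.exp (α (x 0)), β (x 0)] := hf.self_of_nhds
  have hf' : f =ᶠ[𝓝 x] sepMap (fun _ => 1) (fun s => Real.exp (α s)) β (fun t => t) (fun _ => 1)
      (fun _ => 0) := by
    filter_upwards [hf] with y hy
    rw [hy]
    simp [sepMap]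
  have hexp := HasDerivTwice.comp Real.hasDerivAt_exp Real.hasDerivAt_exp hα
  have c1 := hasDerivTwice_const 1 (x 0)
  have c1' := hasDerivTwice_const 1 (x 1)
  have c0 := hasDerivTwice_const 0 (x 1)
  have ci := hasDerivTwice_id (x 1)
  obtain ⟨p0, p1⟩ := partialDeriv_sepMap hf' c1.1.self_of_nhds hexp.1.self_of_nhds
    hβ.1.self_of_nhds ci.1.self_of_nhds c1'.1.self_of_nhds c0.1.self_of_nhds
  obtain ⟨p00, p01, p11⟩ := partialDeriv_partialDeriv_sepMap hf' c1 hexp hβ ci c1' c0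
  beta_reduce at p0 p1 p00 p01 p11
  have hX := congrArg (fun q => inn q ![n₀, n₁, n₂] ![X₀, X₁, X₂]) hfx
  have hy := (Real.exp_pos (α (x 0))).ne'
  rw [hfx] at hn
  rw [hfx, p0] at hn0
  rw [hfx, p1] at hn1
  rw [inn_vec] at hn hn0 hn1
  have hH' := hH.trans hX
  simp only [inn_vec] at hH'
  generalize Real.exp (α (x 0)) = y at *
  generalize α₁ (x 0) = a₁ at *
  generalize β₁ (x 0) = b₁ at *
  have h2 : n₀ = 0 := by
    field_simp at hn1
    linarith
  subst hA hB h2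
  have hlin : n₂ * b₁ = B * a₁ := by
    linear_combination (norm := (field_simp; ring)) hn0
  refine ⟨?_, hlin, ?_⟩
  · linear_combination (norm := (field_simp; ring)) hn
  -- The orbits are horocycles; their curvature enters through `b₁₁` and produces the summand B of
  -- the final equation.
  have e := meanCurvature_mul_eq hH' hfx p0 p1 p00 p01 p11
    (g₀₀ := a₁ ^ 2 + b₁ ^ 2) (g₀₁ := 0) (g₁₁ := 1 / y ^ 2)
    (b₀₀ := n₂ * β₂ - B * α₂) (b₀₁ := 0) (b₁₁ := -B / y ^ 2)
    (by rw [inn_vec]; field_simp; ring) (by rw [inn_vec]; ring) (by rw [inn_vec]; ring)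
    (by rw [christoffel_vec, add_vec, inn_vec]; field_simp; ring)
    (by rw [christoffel_vec, add_vec, inn_vec]; ring)
    (by rw [christoffel_vec, add_vec, inn_vec]; field_simp; ring)
    (by
      simp only [ne_eq, OfNat.ofNat_ne_zero, not_false_eq_true, zero_pow, sub_zero]
      exact mul_ne_zero hreg (one_div_ne_zero (pow_ne_zero 2 hy)))
  linear_combination (norm := (field_simp; ring)) y ^ 2 * e

/-- The curvature equation of the surface generated by hyperbolic translations of a curve. -/
theorem curvature_hyperbolic
    (hf : f =ᶠ[𝓝 x] fun y => ![Real.exp (y 1) * Real.sinh (α (y 0)), Real.exp (y 1), β (y 0)])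
    (hα : HasDerivTwice α α₁ α₂ (x 0)) (hβ : HasDerivTwice β β₁ β₂ (x 0))
    (hreg : α₁ (x 0) ^ 2 + β₁ (x 0) ^ 2 ≠ 0)
    (hn : inn (f x) ![n₀, n₁, n₂] ![n₀, n₁, n₂] = 1)
    (hn0 : inn (f x) ![n₀, n₁, n₂] (partialDeriv 0 f x) = 0)
    (hn1 : inn (f x) ![n₀, n₁, n₂] (partialDeriv 1 f x) = 0)
    (hH : meanCurvature f ![n₀, n₁, n₂] x = inn (f x) ![n₀, n₁, n₂] ![X₀, X₁, X₂])
    {A B : ℝ} (hA : n₂ = A) (hB : n₀ = -(Real.exp (x 1) * B / Real.cosh (α (x 0)))) :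
    A ^ 2 + B ^ 2 = 1 ∧ A * β₁ (x 0) = B * α₁ (x 0) ∧
      A * β₂ - B * α₂ = (-(Real.sinh (α (x 0)) / Real.cosh (α (x 0))) * B +
        2 * (A * X₂ + B * (X₁ * Real.sinh (α (x 0)) - X₀) /
          (Real.exp (x 1) * Real.cosh (α (x 0))))) * (α₁ (x 0) ^ 2 + β₁ (x 0) ^ 2) := by
  have hfx : f x = ![Real.exp (x 1) * Real.sinh (α (x 0)), Real.exp (x 1), β (x 0)] :=
    hf.self_of_nhds
  have hf' : f =ᶠ[𝓝 x] sepMap (fun s => Real.sinh (α s)) (fun _ => 1) β Real.exp Real.exp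
      (fun _ => 0) := by
    filter_upwards [hf] with y hy
    rw [hy]
    simp [sepMap, mul_comm]
  have hsinh := HasDerivTwice.comp Real.hasDerivAt_sinh Real.hasDerivAt_cosh hα
  have c1 := hasDerivTwice_const 1 (x 0)
  have c0 := hasDerivTwice_const 0 (x 1)
  have ce := hasDerivTwice_exp (x 1)
  obtain ⟨p0, p1⟩ := partialDeriv_sepMap hf' hsinh.1.self_of_nhds c1.1.self_of_nhds
    hβ.1.self_of_nhds ce.1.self_of_nhds ce.1.self_of_nhds c0.1.self_of_nhds
  obtain ⟨p00, p01, p11⟩ := partialDeriv_partialDeriv_sepMap hf' hsinh c1 hβ ce ce c0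
  beta_reduce at p0 p1 p00 p01 p11
  have hX := congrArg (fun q => inn q ![n₀, n₁, n₂] ![X₀, X₁, X₂]) hfx
  have hy := (Real.exp_pos (x 1)).ne'
  have hC := (Real.cosh_pos (α (x 0))).ne'
  have hcs := Real.cosh_sq (α (x 0))
  rw [hfx] at hn
  rw [hfx, p0] at hn0
  rw [hfx, p1] at hn1
  rw [inn_vec] at hn hn0 hn1
  have hH' := hH.trans hX
  simp only [inn_vec] at hH'
  generalize Real.exp (x 1) = y at *
  generalize Real.sinh (α (x 0)) = S at *
  generalize Real.cosh (α (x 0)) = C at *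
  generalize α₁ (x 0) = a₁ at *
  generalize β₁ (x 0) = b₁ at *
  have h2 : n₁ = y * B / C * S := by
    subst hA hB
    field_simp at hn1 ⊢
    linarith
  subst hA hB h2
  have hlin : n₂ * b₁ = B * a₁ := by
    linear_combination (norm := (field_simp; ring)) hn0
  refine ⟨?_, hlin, ?_⟩
  · have : n₂ ^ 2 + B ^ 2 * (S ^ 2 + 1) / C ^ 2 = 1 := by
      field_simp at hn ⊢
      linear_combination hn
    rw [← hcs] at this
    field_simp at this
    exact this
  -- The profile curve lies in the plane y = 1, which is not orthogonal to the orbits; hence the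
  -- mixed terms. Even so the determinant of the first form is C²(a₁² + b₁²).
  have e := meanCurvature_mul_eq hH' hfx p0 p1 p00 p01 p11
    (g₀₀ := C ^ 2 * a₁ ^ 2 + b₁ ^ 2) (g₀₁ := C * S * a₁) (g₁₁ := C ^ 2)
    (b₀₀ := n₂ * β₂ - B * α₂ + B * S / C * a₁ ^ 2 * S ^ 2) (b₀₁ := B * S ^ 2 * a₁)
    (b₁₁ := B * S * C)
    (by rw [inn_vec]; field_simp; ring) (by rw [inn_vec]; field_simp; ring)
    (by rw [inn_vec]; field_simp; linear_combination -hcs)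
    (by
      rw [christoffel_vec, add_vec, inn_vec]
      field_simp
      linear_combination B * S * a₁ ^ 2 * hcs)
    (by rw [christoffel_vec, add_vec, inn_vec]; field_simp; ring)
    (by
      rw [christoffel_vec, add_vec, inn_vec]
      field_simp
      linear_combination (-B * S) * hcs)
    (by
      have : (C ^ 2 * a₁ ^ 2 + b₁ ^ 2) * C ^ 2 - (C * S * a₁) ^ 2 = C ^ 2 * (a₁ ^ 2 + b₁ ^ 2) := by
        linear_combination C ^ 2 * a₁ ^ 2 * hcs
      rw [this]
      exact mul_ne_zero (pow_ne_zero 2 hC) hreg)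
  have hW : (C ^ 2 * a₁ ^ 2 + b₁ ^ 2) * C ^ 2 - (C * S * a₁) ^ 2 = C ^ 2 * (a₁ ^ 2 + b₁ ^ 2) := by
    linear_combination C ^ 2 * a₁ ^ 2 * hcs
  rw [hW] at e
  have e' : C ^ 2 * (n₂ * β₂ - B * α₂) + B * S * C * (a₁ ^ 2 + b₁ ^ 2) =
      ((-(y * B / C) * X₀ + y * B / C * S * X₁) / y ^ 2 + n₂ * X₂) *
        (2 * (C ^ 2 * (a₁ ^ 2 + b₁ ^ 2))) := by
    rw [← e]
    field_simp
    linear_combination (-a₁ ^ 2 * B * S) * hcs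
  field_simp at e' ⊢
  linear_combination e'

end Curvature

/-! ### Straightened coordinates and charts adapted to the orbits -/

section AdaptedCharts

/-- Coordinates `(a, b, h)` of `ℍ² × ℝ` in which the translations are `h ↦ h + t`. -/
structure Straightening (τ : TranslationKind) where
  a : Coord → ℝ
  b : Coord → ℝ
  h : Coord → ℝ
  inv : Coord → Coord
  contDiffOn_a : ContDiffOn ℝ ∞ a {q | 0 < q 1}
  contDiffOn_b : ContDiffOn ℝ ∞ b {q | 0 < q 1}
  contDiffOn_h : ContDiffOn ℝ ∞ h {q | 0 < q 1}
  contDiff_inv : ContDiff ℝ ∞ inv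
  inv_apply : ∀ q : Coord, 0 < q 1 → inv ![a q, b q, h q] = q
  a_translation : ∀ t (q : Coord), 0 < q 1 → a (translation τ t q) = a q
  b_translation : ∀ t (q : Coord), 0 < q 1 → b (translation τ t q) = b q
  h_translation : ∀ t (q : Coord), 0 < q 1 → h (translation τ t q) = h q + t

theorem translation_zero (τ : TranslationKind) (q : Coord) : translation τ 0 q = q := by
  cases τ <;> ext i <;> fin_cases i <;> simp [translation]

theorem differentiable_translation (τ : TranslationKind) (q : Coord) :
    Differentiable ℝ fun t => translation τ t q := by
  rw [differentiable_pi]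
  intro i
  cases τ <;> fin_cases i <;> simp only [translation] <;> simp <;> fun_prop

variable {M : Type*} [TopologicalSpace M] [ChartedSpace Param M]

/-- An immersion has a smooth left inverse in suitable charts. -/
theorem exists_leftInverse {ψ : M → Coord}
    (hψ : Manifold.IsImmersion (𝓡 2) 𝓘(ℝ, Coord) ∞ ψ) (p : M) :
    ∃ e ∈ IsManifold.maximalAtlas (𝓡 2) ∞ M, p ∈ e.source ∧
      ∃ r : Coord → Param, DifferentiableAt ℝ r (ψ p) ∧ ∀ q ∈ e.source, r (ψ q) = e q := by
  have h := hψ.isImmersionAt p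
  -- In these charts the immersion is the inclusion u ↦ (u, 0), so the first component inverts it.
  refine ⟨h.domChart, h.domChart_mem_maximalAtlas, h.mem_domChart_source,
    fun v => (h.equiv.symm (h.codChart v)).1, ?_, ?_⟩
  · have h1 : ContMDiffAt 𝓘(ℝ, Coord) 𝓘(ℝ, Coord) ∞ h.codChart (ψ p) :=
      contMDiffAt_of_mem_maximalAtlas h.codChart_mem_maximalAtlas h.mem_codChart_source
    have h2 : DifferentiableAt ℝ h.codChart (ψ p) :=
      (contMDiffAt_iff_contDiffAt.1 h1).differentiableAt (by simp)
    exact (h.equiv.symm.differentiableAt.comp _ h2).fst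
  · intro q hq
    have hw := h.writtenInCharts
    have hx : h.domChart q ∈ (h.domChart.extend (𝓡 2)).target := by
      simpa using h.domChart.map_source hq
    have := hw hx
    simp [h.domChart.left_inv hq] at this
    simp [this]

theorem contDiffOn_comp_symm [IsManifold (𝓡 2) ∞ M] {ψ : M → Coord}
    (hψ : Manifold.IsImmersion (𝓡 2) 𝓘(ℝ, Coord) ∞ ψ) {e : OpenPartialHomeomorph M Param}
    (he : e ∈ IsManifold.maximalAtlas (𝓡 2) ∞ M) : ContDiffOn ℝ ∞ (ψ ∘ e.symm) e.target := by
  have h1 : ContMDiffOn (𝓡 2) 𝓘(ℝ, Coord) ∞ (ψ ∘ e.symm) e.target :=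
    hψ.contMDiff.comp_contMDiffOn (contMDiffOn_symm_of_mem_maximalAtlas he)
  exact contMDiffOn_iff_contDiffOn.1 h1

variable {τ : TranslationKind}

/-- The straightened coordinates of a point of the surface. -/
def Straightening.coord (σ : Straightening τ) (q : Coord) : Coord := ![σ.a q, σ.b q, σ.h q]

theorem Straightening.contDiffOn_coord (σ : Straightening τ) :
    ContDiffOn ℝ ∞ σ.coord {q | 0 < q 1} := by
  rw [contDiffOn_pi]
  intro i
  fin_cases i
  · exact σ.contDiffOn_a
  · exact σ.contDiffOn_b
  · exact σ.contDiffOn_h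

theorem Straightening.coord_translation (σ : Straightening τ) (t : ℝ) {q : Coord}
    (hq : 0 < q 1) : σ.coord (translation τ t q) = σ.coord q + t • ![0, 0, 1] := by
  ext i
  fin_cases i
  · simp [coord, σ.a_translation t q hq]
  · simp [coord, σ.b_translation t q hq]
  · simp [coord, σ.h_translation t q hq]

/-- At each point there is a chart in which the derivative of the surface, in straightened
coordinates, is injective and has the direction of the orbits in its range. -/
theorem exists_chart_fderiv [IsManifold (𝓡 2) ∞ M] (σ : Straightening τ) {ψ : M → Coord}
    (hψ : IsImmersedSurface ψ) {φ : Flow ℝ M}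
    (hφ : ∀ (t : ℝ) (p : M), ψ (φ t p) = translation τ t (ψ p)) (p : M) :
    ∃ e ∈ IsManifold.maximalAtlas (𝓡 2) ∞ M, p ∈ e.source ∧
      ContDiffOn ℝ ∞ (σ.coord ∘ ψ ∘ e.symm) e.target ∧
      Function.Injective (fderiv ℝ (σ.coord ∘ ψ ∘ e.symm) (e p)) ∧
      ∃ v, fderiv ℝ (σ.coord ∘ ψ ∘ e.symm) (e p) v = ![0, 0, 1] := by
  obtain ⟨e, he, hp, r, hr, hre⟩ := exists_leftInverse hψ.immersion p
  have hsm : ContDiffOn ℝ ∞ (σ.coord ∘ ψ ∘ e.symm) e.target :=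
    σ.contDiffOn_coord.comp (contDiffOn_comp_symm hψ.immersion he) fun x _ => hψ.pos _
  have hx : e p ∈ e.target := e.map_source hp
  have hd : HasFDerivAt (σ.coord ∘ ψ ∘ e.symm) (fderiv ℝ (σ.coord ∘ ψ ∘ e.symm) (e p)) (e p) :=
    ((hsm.contDiffAt (e.open_target.mem_nhds hx)).differentiableAt (by simp)).hasFDerivAt
  have hval : (σ.coord ∘ ψ ∘ e.symm) (e p) = σ.coord (ψ p) := by simp [e.left_inv hp]
  refine ⟨e, he, hp, hsm, ?_, ?_⟩
  · have hinv : σ.inv (σ.coord (ψ p)) = ψ p := σ.inv_apply _ (hψ.pos p)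
    have hG : DifferentiableAt ℝ (r ∘ σ.inv) ((σ.coord ∘ ψ ∘ e.symm) (e p)) := by
      rw [hval]
      refine DifferentiableAt.comp _ (by rw [hinv]; exact hr) ?_
      exact (σ.contDiff_inv.differentiable (by simp)) _
    have hcomp := hG.hasFDerivAt.comp (e p) hd
    have hid : (r ∘ σ.inv) ∘ (σ.coord ∘ ψ ∘ e.symm) =ᶠ[𝓝 (e p)] id := by
      filter_upwards [e.open_target.mem_nhds hx] with x hx'
      have h1 : σ.inv (σ.coord (ψ (e.symm x))) = ψ (e.symm x) := σ.inv_apply _ (hψ.pos _)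
      simp [h1, hre _ (e.map_target hx'), e.right_inv hx']
    have huniq := (hcomp.congr_of_eventuallyEq hid.symm).unique (hasFDerivAt_id (e p))
    intro u w huw
    have h1 := congrArg (fun L : Param →L[ℝ] Param => L u) huniq
    have h2 := congrArg (fun L : Param →L[ℝ] Param => L w) huniq
    simp only [ContinuousLinearMap.comp_apply, ContinuousLinearMap.id_apply] at h1 h2
    rw [← h1, ← h2, huw]
  -- The flow on the surface is only continuous. In the chart, however, the orbit of `p` is `r`
  -- applied to the orbit of `ψ p`, which is differentiable; its velocity at 0 is the required
  -- vector.
  · have hT : HasDerivAt (fun t => translation τ t (ψ p))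
        (deriv (fun t => translation τ t (ψ p)) 0) 0 :=
      ((differentiable_translation τ (ψ p)) 0).hasDerivAt
    have hc : HasDerivAt (fun t => r (translation τ t (ψ p))) _ 0 :=
      HasFDerivAt.comp_hasDerivAt 0 (l := r) (by rw [translation_zero]; exact hr.hasFDerivAt) hT
    have hr0 : r (translation τ 0 (ψ p)) = e p := by rw [translation_zero, hre p hp]
    have hc2 := HasFDerivAt.comp_hasDerivAt 0 (l := σ.coord ∘ ψ ∘ e.symm)
      (by rw [hr0]; exact hd) hc
    have hflow : ∀ᶠ t : ℝ in 𝓝 0, φ t p ∈ e.source := by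
      have : Continuous fun t : ℝ => φ t p := φ.continuous continuous_id continuous_const
      have h0 : φ 0 p = p := φ.map_zero_apply p
      exact this.continuousAt.eventually (e.open_source.mem_nhds (by simpa only [h0] using hp))
    have hline : HasDerivAt (fun t : ℝ => σ.coord (ψ p) + t • (![0, 0, 1] : Coord)) ![0, 0, 1] 0 := by
      simpa using ((hasDerivAt_id (0 : ℝ)).smul_const (![0, 0, 1] : Coord)).const_add
        (σ.coord (ψ p))
    have heq : (σ.coord ∘ ψ ∘ e.symm) ∘ (fun t => r (translation τ t (ψ p))) =ᶠ[𝓝 0]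
        fun t : ℝ => σ.coord (ψ p) + t • (![0, 0, 1] : Coord) := by
      filter_upwards [hflow] with t ht
      have h1 : r (translation τ t (ψ p)) = e (φ t p) := by rw [← hφ, hre _ ht]
      simp only [Function.comp_apply]
      rw [h1, e.left_inv ht, hφ, σ.coord_translation t (hψ.pos p)]
    exact ⟨_, hc2.unique (hline.congr_of_eventuallyEq heq)⟩

/-- A linear map to the space with the third axis in its range becomes bijective after projection
along a suitable direction of the first two axes. -/
theorem exists_projection_bijective (L : Param →L[ℝ] Coord) (hL : Function.Injective L) {v : Param}
    (hv : L v = ![0, 0, 1]) : ∃ c₁ c₂ : ℝ, Function.Bijective fun w : Param =>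
      (!₂[c₁ * L w 0 + c₂ * L w 1, L w 2] : Param) := by
  -- Otherwise the image of `L` is the third axis, and by injectivity every vector is a multiple of
  -- `v`, impossible in dimension two.
  have hw : ∃ w, L w 0 ^ 2 + L w 1 ^ 2 ≠ 0 := by
    by_contra hcon
    push Not at hcon
    have hall : ∀ w, w = L w 2 • v := by
      intro w
      apply hL
      have h0 : L w 0 = 0 := by nlinarith [hcon w, sq_nonneg (L w 0), sq_nonneg (L w 1)]
      have h1 : L w 1 = 0 := by nlinarith [hcon w, sq_nonneg (L w 0), sq_nonneg (L w 1)]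
      rw [map_smul, hv]
      ext i
      fin_cases i
      · simpa using h0
      · simpa using h1
      · simp
    have e0 := hall (EuclideanSpace.single 0 1)
    have e1 := hall (EuclideanSpace.single 1 1)
    set k0 := L (EuclideanSpace.single 0 1) 2
    set k1 := L (EuclideanSpace.single 1 1) 2
    have a00 := congrArg (fun x : Param => x 0) e0
    have a01 := congrArg (fun x : Param => x 1) e0
    have a10 := congrArg (fun x : Param => x 0) e1
    have a11 := congrArg (fun x : Param => x 1) e1
    simp at a00 a01 a10 a11
    rcases a01 with h | h
    · rw [h] at a00
      simp at a00
    · rw [h] at a11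
      simp at a11
  obtain ⟨w, hw⟩ := hw
  -- Projecting on the horizontal part of `L w` itself makes the first component of the image of `w`
  -- equal to `L w 0 ^ 2 + L w 1 ^ 2`, while `v` is sent to (0, 1).
  refine ⟨L w 0, L w 1, ?_⟩
  set Λ : Param →ₗ[ℝ] Param :=
    { toFun := fun u => !₂[L w 0 * L u 0 + L w 1 * L u 1, L u 2]
      map_add' := fun x y => by
        ext i
        fin_cases i
        · simp
          ring
        · simp
      map_smul' := fun c x => by
        ext i
        fin_cases i
        · simp
          ring
        · simp } with hΛ
  have hsurj : Function.Surjective Λ := by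
    intro y
    refine ⟨(y 0 / (L w 0 ^ 2 + L w 1 ^ 2)) • w +
      (y 1 - y 0 / (L w 0 ^ 2 + L w 1 ^ 2) * L w 2) • v, ?_⟩
    ext i
    fin_cases i
    · simp [hΛ, hv]
      field_simp
    · simp [hΛ, hv]
  exact ⟨LinearMap.injective_iff_surjective.2 hsurj, hsurj⟩

/-- The open rectangle with centre `(s₀, t₀)`. -/
def rect (s₀ t₀ ε : ℝ) : Set Param := {x | |x 0 - s₀| < ε ∧ |x 1 - t₀| < ε}

theorem continuous_param_apply (i : Fin 2) : Continuous fun x : Param => x i :=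
  (EuclideanSpace.proj i : Param →L[ℝ] ℝ).continuous

theorem isOpen_rect (s₀ t₀ ε : ℝ) : IsOpen (rect s₀ t₀ ε) :=
  (isOpen_lt ((continuous_param_apply 0).sub continuous_const).abs continuous_const).inter
    (isOpen_lt ((continuous_param_apply 1).sub continuous_const).abs continuous_const)

theorem exists_rect_subset {U : Set Param} {x : Param} (hU : U ∈ 𝓝 x) :
    ∃ ε > 0, rect (x 0) (x 1) ε ⊆ U := by
  obtain ⟨δ, hδ, hsub⟩ := Metric.mem_nhds_iff.1 hU
  refine ⟨δ / 2, half_pos hδ, fun y hy => hsub ?_⟩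
  rw [Metric.mem_ball, EuclideanSpace.dist_eq, Fin.sum_univ_two, Real.sqrt_lt' hδ, Real.dist_eq,
    Real.dist_eq]
  have h1 := hy.1
  have h2 := hy.2
  nlinarith [abs_nonneg (y 0 - x 0), abs_nonneg (y 1 - x 1)]

/-- A chart of the surface over a rectangle, whose second coordinate is the parameter of the orbits
and in which the two other straightened coordinates depend on the first coordinate only. -/
structure IsAdaptedChart (σ : Straightening τ) (ψ : M → Coord) (e : OpenPartialHomeomorph M Param)
    (c₁ c₂ s₀ t₀ ε : ℝ) (α β : ℝ → ℝ) : Prop where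
  mem_maximalAtlas : e ∈ IsManifold.maximalAtlas (𝓡 2) ∞ M
  pos : 0 < ε
  target_eq : e.target = rect s₀ t₀ ε
  fst : ∀ q ∈ e.source, e q 0 = c₁ * σ.a (ψ q) + c₂ * σ.b (ψ q)
  snd : ∀ q ∈ e.source, e q 1 = σ.h (ψ q)
  contDiffOn_α : ContDiffOn ℝ ∞ α (Metric.ball s₀ ε)
  contDiffOn_β : ContDiffOn ℝ ∞ β (Metric.ball s₀ ε)
  a_eq : ∀ q ∈ e.source, σ.a (ψ q) = α (e q 0)
  b_eq : ∀ q ∈ e.source, σ.b (ψ q) = β (e q 0)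

end AdaptedCharts

/-! ### Existence of adapted charts -/

section AdaptedChartExistence

variable {M : Type*} [TopologicalSpace M] [ChartedSpace Param M]

theorem mem_rect_self {ε : ℝ} (hε : 0 < ε) (x : Param) : x ∈ rect (x 0) (x 1) ε := by
  simp [rect, hε]

/-- A chart followed by a smooth map with invertible derivative restricts to a chart. -/
theorem exists_chart_comp [IsManifold (𝓡 2) ∞ M] {e₀ : OpenPartialHomeomorph M Param}
    (he₀ : e₀ ∈ IsManifold.maximalAtlas (𝓡 2) ∞ M) {p : M} (hp : p ∈ e₀.source)
    {k : Param → Param} (hk : ContDiffOn ℝ ∞ k e₀.target) {L : Param ≃L[ℝ] Param}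
    (hL : HasFDerivAt k (L : Param →L[ℝ] Param) (e₀ p)) :
    ∃ e ∈ IsManifold.maximalAtlas (𝓡 2) ∞ M, p ∈ e.source ∧ e.source ⊆ e₀.source ∧
      (∀ q, e q = k (e₀ q)) ∧ ∃ ε > 0, e.target = rect (k (e₀ p) 0) (k (e₀ p) 1) ε := by
  have hx : e₀ p ∈ e₀.target := e₀.map_source hp
  have hkp : ContDiffAt ℝ ∞ k (e₀ p) := hk.contDiffAt (e₀.open_target.mem_nhds hx)
  set K := hkp.toOpenPartialHomeomorph k hL (by simp) with hK
  have hKc : ∀ x, K x = k x := fun x => rfl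
  -- The inverse function theorem gives smoothness of the inverse at one point only. Restriction to
  -- the open set where the derivative is invertible gives it at every point.
  set U : Set Param := e₀.target ∩
    fderiv ℝ k ⁻¹' range ((↑) : (Param ≃L[ℝ] Param) → Param →L[ℝ] Param) with hU
  have hUo : IsOpen U :=
    (hk.continuousOn_fderiv_of_isOpen e₀.open_target (by simp)).isOpen_inter_preimage
      e₀.open_target ContinuousLinearEquiv.isOpen
  have hpU : e₀ p ∈ U := ⟨hx, L, hL.fderiv.symm⟩
  set K' := K.restrOpen U hUo with hK'
  have hK's : K'.source = K.source ∩ U := K.restrOpen_source U hUo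
  have hK'c : ∀ x, K' x = k x := fun x => rfl
  have hpK : e₀ p ∈ K'.source := by
    rw [hK's]
    exact ⟨hkp.mem_toOpenPartialHomeomorph_source hL (by simp), hpU⟩
  set e₁ := e₀.trans K' with he₁
  have hp₁ : p ∈ e₁.source := by
    rw [he₁, OpenPartialHomeomorph.trans_source]
    exact ⟨hp, hpK⟩
  have he₁p : e₁ p = k (e₀ p) := rfl
  obtain ⟨ε, hε, hsub⟩ := exists_rect_subset (e₁.open_target.mem_nhds (e₁.map_source hp₁))
  rw [he₁p] at hsub
  set V := rect (k (e₀ p) 0) (k (e₀ p) 1) ε with hV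
  set e := e₁.trans (OpenPartialHomeomorph.ofSet V (isOpen_rect _ _ _)) with he
  have het : e.target = V := by
    rw [he, OpenPartialHomeomorph.trans_target]
    simp only [OpenPartialHomeomorph.ofSet_target, OpenPartialHomeomorph.ofSet_symm,
      OpenPartialHomeomorph.ofSet_apply, preimage_id]
    exact inter_eq_left.2 hsub
  have hec : ∀ q, e q = k (e₀ q) := fun q => rfl
  have hes : e.source ⊆ e₁.source := by
    rw [he, OpenPartialHomeomorph.trans_source]
    exact inter_subset_left
  have hes0 : e.source ⊆ e₀.source := by
    refine hes.trans ?_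
    rw [he₁, OpenPartialHomeomorph.trans_source]
    exact inter_subset_left
  have hesymm : ∀ x, e.symm x = e₀.symm (K'.symm x) := fun x => rfl
  refine ⟨e, ?_, ?_, hes0, hec, ε, hε, het⟩
  · apply OpenPartialHomeomorph.mem_maximalAtlas_of_contMDiffOn
    · have h1 : ContMDiffOn (𝓡 2) (𝓡 2) ∞ (k ∘ e₀) e₀.source :=
        (contMDiffOn_iff_contDiffOn.2 hk).comp (contMDiffOn_of_mem_maximalAtlas he₀)
          fun q hq => e₀.map_source hq
      exact h1.mono hes0
    · have hVK : V ⊆ K'.target := fun x hx' => by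
        have := hsub hx'
        rw [he₁, OpenPartialHomeomorph.trans_target] at this
        exact this.1
      have h1 : ContDiffOn ℝ ∞ K'.symm V := by
        intro x hx'
        have hxs : K'.symm x ∈ K.source ∩ U := by
          rw [← hK's]
          exact K'.map_target (hVK hx')
        obtain ⟨L', hL'⟩ := hxs.2.2
        have hkx : ContDiffAt ℝ ∞ k (K'.symm x) :=
          hk.contDiffAt (e₀.open_target.mem_nhds hxs.2.1)
        refine (K'.contDiffAt_symm (f₀' := L') (hVK hx') ?_ hkx).contDiffWithinAt
        rw [hL']
        exact (hkx.differentiableAt (by simp)).hasFDerivAt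
      rw [het]
      refine (contMDiffOn_symm_of_mem_maximalAtlas he₀).comp
        (contMDiffOn_iff_contDiffOn.2 h1) fun x hx' => ?_
      have hxs : K'.symm x ∈ K.source ∩ U := by
        rw [← hK's]
        exact K'.map_target (hVK hx')
      exact hxs.2.1
  · rw [he, OpenPartialHomeomorph.trans_source]
    exact ⟨hp₁, mem_rect_self hε (k (e₀ p))⟩

variable {τ : TranslationKind}

/-- In a chart whose second coordinate is the orbit parameter and whose first coordinate is
invariant, invariant functions depend on the first coordinate only. -/
theorem invariant_eq_of_chart (σ : Straightening τ) {ψ : M → Coord}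
    (hψ : IsImmersedSurface ψ) {φ : Flow ℝ M}
    (hφ : ∀ (t : ℝ) (p : M), ψ (φ t p) = translation τ t (ψ p))
    {e : OpenPartialHomeomorph M Param} {c₁ c₂ s₀ t₀ ε : ℝ} (htarget : e.target = rect s₀ t₀ ε)
    (hfst : ∀ q ∈ e.source, e q 0 = c₁ * σ.a (ψ q) + c₂ * σ.b (ψ q))
    (hsnd : ∀ q ∈ e.source, e q 1 = σ.h (ψ q)) {u : Coord → ℝ}
    (hu : ∀ t (q : Coord), 0 < q 1 → u (translation τ t q) = u q) {q : M} (hq : q ∈ e.source) :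
    u (ψ q) = u (ψ (e.symm !₂[e q 0, t₀])) := by
  have hqt : e q ∈ rect s₀ t₀ ε := htarget ▸ e.map_source hq
  have hε : 0 < ε := (abs_nonneg _).trans_lt hqt.1
  set s := e q 0 with hs
  have hmem : ∀ t ∈ Ioo (t₀ - ε) (t₀ + ε), (!₂[s, t] : Param) ∈ e.target := by
    intro t ht
    rw [htarget]
    refine ⟨by simpa using hqt.1, ?_⟩
    have : |t - t₀| < ε := abs_lt.2 ⟨by linarith [ht.1], by linarith [ht.2]⟩
    simpa using this
  -- For small times the flow stays in the chart and moves (s, t) along its vertical line, so `u ∘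
  -- ψ` is locally constant there. The vertical segment is connected even though the flow may leave
  -- the chart before joining its points.
  have hder : ∀ t ∈ Ioo (t₀ - ε) (t₀ + ε),
      HasDerivAt (fun t => u (ψ (e.symm !₂[s, t]))) 0 t := by
    intro t ht
    set r := e.symm !₂[s, t] with hr
    have hrs : r ∈ e.source := e.map_target (hmem t ht)
    have her : e r = !₂[s, t] := e.right_inv (hmem t ht)
    have hflow : ∀ᶠ t' : ℝ in 𝓝 t, φ (t' - t) r ∈ e.source := by
      have hc : Continuous fun t' : ℝ => φ (t' - t) r :=
        φ.continuous (continuous_id.sub continuous_const) continuous_const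
      have h0 : φ (t - t) r = r := by rw [sub_self]; exact φ.map_zero_apply r
      exact hc.continuousAt.eventually (e.open_source.mem_nhds (by simpa only [h0] using hrs))
    refine (hasDerivAt_const t (u (ψ r))).congr_of_eventuallyEq ?_
    filter_upwards [hflow] with t' ht'
    have h1 : e (φ (t' - t) r) = !₂[s, t'] := by
      have e0 := hfst _ ht'
      have e1 := hsnd _ ht'
      rw [hφ, σ.a_translation _ _ (hψ.pos r), σ.b_translation _ _ (hψ.pos r), ← hfst r hrs,
        her] at e0
      rw [hφ, σ.h_translation _ _ (hψ.pos r), ← hsnd r hrs, her] at e1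
      ext i
      fin_cases i
      · simpa using e0
      · simpa using e1
    rw [← h1, e.left_inv ht', hφ, hu _ _ (hψ.pos r)]
  have hconst := (isOpen_Ioo (a := t₀ - ε) (b := t₀ + ε)).is_const_of_deriv_eq_zero
    isPreconnected_Ioo (fun t ht => (hder t ht).differentiableAt.differentiableWithinAt)
    (fun t ht => (hder t ht).deriv) (x := e q 1) (y := t₀)
    ⟨by linarith [(abs_lt.1 hqt.2).1], by linarith [(abs_lt.1 hqt.2).2]⟩
    ⟨by linarith, by linarith⟩
  have hqe : (!₂[s, e q 1] : Param) = e q := by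
    ext i
    fin_cases i <;> simp [hs]
  simp only [hqe, e.left_inv hq] at hconst
  exact hconst

/-- Since the orbit direction is tangent to the surface, some c₁a + c₂b completes h to local
coordinates. The functions `α` and `β` are then a and b restricted to the horizontal line through
`p`. -/
theorem exists_adaptedChart [IsManifold (𝓡 2) ∞ M] (σ : Straightening τ) {ψ : M → Coord}
    (hψ : IsImmersedSurface ψ) {φ : Flow ℝ M}
    (hφ : ∀ (t : ℝ) (p : M), ψ (φ t p) = translation τ t (ψ p)) (p : M) :
    ∃ (e : OpenPartialHomeomorph M Param) (c₁ c₂ s₀ ε : ℝ) (α β : ℝ → ℝ), p ∈ e.source ∧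
      IsAdaptedChart σ ψ e c₁ c₂ s₀ (σ.h (ψ p)) ε α β := by
  obtain ⟨e₀, he₀, hp, hF, hinj, v, hv⟩ := exists_chart_fderiv σ hψ hφ p
  set F := σ.coord ∘ ψ ∘ e₀.symm with hFdef
  obtain ⟨c₁, c₂, hbij⟩ := exists_projection_bijective _ hinj hv
  set k : Param → Param := fun x => !₂[c₁ * F x 0 + c₂ * F x 1, F x 2] with hk
  have hFi : ∀ i, ContDiffOn ℝ ∞ (fun x => F x i) e₀.target := fun i => contDiffOn_pi.1 hF i
  have hkd : ContDiffOn ℝ ∞ k e₀.target := by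
    rw [contDiffOn_euclidean]
    intro i
    fin_cases i
    · exact (contDiffOn_const.mul (hFi 0)).add (contDiffOn_const.mul (hFi 1))
    · exact hFi 2
  have hx : e₀ p ∈ e₀.target := e₀.map_source hp
  have hFp : HasFDerivAt F (fderiv ℝ F (e₀ p)) (e₀ p) :=
    ((hF.contDiffAt (e₀.open_target.mem_nhds hx)).differentiableAt (by simp)).hasFDerivAt
  have hkp : HasFDerivAt k (fderiv ℝ k (e₀ p)) (e₀ p) :=
    ((hkd.contDiffAt (e₀.open_target.mem_nhds hx)).differentiableAt (by simp)).hasFDerivAt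
  have hFpi : ∀ i, HasFDerivAt (fun x => F x i)
      ((ContinuousLinearMap.proj i : Coord →L[ℝ] ℝ).comp (fderiv ℝ F (e₀ p))) (e₀ p) :=
    hasFDerivAt_pi'.1 hFp
  have hkval : ∀ w, fderiv ℝ k (e₀ p) w =
      !₂[c₁ * fderiv ℝ F (e₀ p) w 0 + c₂ * fderiv ℝ F (e₀ p) w 1, fderiv ℝ F (e₀ p) w 2] := by
    intro w
    have hki := fun i => (EuclideanSpace.proj i : Param →L[ℝ] ℝ).hasFDerivAt.comp (e₀ p) hkp
    ext i
    fin_cases i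
    · have h1 := (hki 0).unique (((hFpi 0).const_mul c₁).add ((hFpi 1).const_mul c₂))
      simpa using congrArg (fun L : Param →L[ℝ] ℝ => L w) h1
    · have h1 := (hki 1).unique (hFpi 2)
      simpa using congrArg (fun L : Param →L[ℝ] ℝ => L w) h1
  have hkb : Function.Bijective (fderiv ℝ k (e₀ p)) := by
    convert hbij using 1
    funext w
    exact hkval w
  set L : Param ≃L[ℝ] Param := ContinuousLinearEquiv.ofBijective (fderiv ℝ k (e₀ p))
    (LinearMap.ker_eq_bot.2 hkb.1) (LinearMap.range_eq_top.2 hkb.2) with hL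
  have hLk : HasFDerivAt k (L : Param →L[ℝ] Param) (e₀ p) := by
    rw [hL, ContinuousLinearEquiv.coe_ofBijective]
    exact hkp
  obtain ⟨e, he, hpe, hsub, hek, ε, hε, htarget⟩ := exists_chart_comp he₀ hp hkd hLk
  have hFe : ∀ q ∈ e.source, F (e₀ q) = σ.coord (ψ q) := fun q hq => by
    simp [hFdef, e₀.left_inv (hsub hq)]
  have hfst : ∀ q ∈ e.source, e q 0 = c₁ * σ.a (ψ q) + c₂ * σ.b (ψ q) := fun q hq => by
    rw [hek q, hk]
    simp [hFe q hq, Straightening.coord]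
  have hsnd : ∀ q ∈ e.source, e q 1 = σ.h (ψ q) := fun q hq => by
    rw [hek q, hk]
    simp [hFe q hq, Straightening.coord]
  have ht₀ : k (e₀ p) 1 = σ.h (ψ p) := by rw [← hek p, hsnd p hpe]
  rw [ht₀] at htarget
  set s₀ := k (e₀ p) 0 with hs₀
  have hψe := contDiffOn_comp_symm hψ.immersion he
  have hline : ContDiff ℝ ∞ fun s : ℝ => (!₂[s, σ.h (ψ p)] : Param) := by
    rw [contDiff_euclidean]
    intro i
    fin_cases i
    · exact contDiff_id
    · exact contDiff_const
  have hmaps : MapsTo (fun s : ℝ => (!₂[s, σ.h (ψ p)] : Param)) (Metric.ball s₀ ε) e.target := by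
    intro s hs
    rw [htarget]
    refine ⟨?_, by simpa using hε⟩
    simpa [Real.dist_eq] using hs
  have hcomp : ContDiffOn ℝ ∞ (fun s : ℝ => ψ (e.symm !₂[s, σ.h (ψ p)])) (Metric.ball s₀ ε) :=
    hψe.comp hline.contDiffOn hmaps
  refine ⟨e, c₁, c₂, s₀, ε, fun s => σ.a (ψ (e.symm !₂[s, σ.h (ψ p)])),
    fun s => σ.b (ψ (e.symm !₂[s, σ.h (ψ p)])), hpe, he, hε, htarget, hfst, hsnd, ?_, ?_, ?_, ?_⟩
  · exact σ.contDiffOn_a.comp hcomp fun s _ => hψ.pos _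
  · exact σ.contDiffOn_b.comp hcomp fun s _ => hψ.pos _
  · exact fun q hq => invariant_eq_of_chart σ hψ hφ htarget hfst hsnd σ.a_translation hq
  · exact fun q hq => invariant_eq_of_chart σ hψ hφ htarget hfst hsnd σ.b_translation hq

end AdaptedChartExistence

/-! ### Differentiability of the unit tangent -/

section UnitTangent

/-- The derivative of a continuous unit field parallel to a regular curve. -/
theorem hasDerivAt_unitTangent {I : Set ℝ} (hI : IsOpen I) (hI' : IsPreconnected I)
    {α₁ β₁ α₂ β₂ A B : ℝ → ℝ} (hα : ∀ s ∈ I, HasDerivAt α₁ (α₂ s) s)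
    (hβ : ∀ s ∈ I, HasDerivAt β₁ (β₂ s) s) (hA : ContinuousOn A I) (hB : ContinuousOn B I)
    (hunit : ∀ s ∈ I, A s ^ 2 + B s ^ 2 = 1) (hpar : ∀ s ∈ I, A s * β₁ s = B s * α₁ s)
    (hreg : ∀ s ∈ I, α₁ s ^ 2 + β₁ s ^ 2 ≠ 0) {K s : ℝ} (hs : s ∈ I)
    (hK : A s * β₂ s - B s * α₂ s = K * (α₁ s ^ 2 + β₁ s ^ 2)) :
    HasDerivAt A ((A s * α₁ s + B s * β₁ s) * -(K * B s)) s ∧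
      HasDerivAt B ((A s * α₁ s + B s * β₁ s) * (K * A s)) s := by
  -- The normal, hence (A, B), is only known to be continuous. But μ is the Euclidean speed up to a
  -- sign that is constant on the connected set `I`, so it is differentiable, and A = α₁/μ, B =
  -- β₁/μ.
  set μ : ℝ → ℝ := fun s => A s * α₁ s + B s * β₁ s with hμ
  have hμA : ∀ s ∈ I, μ s * A s = α₁ s := fun s hs => by
    linear_combination B s * hpar s hs + α₁ s * hunit s hs
  have hμB : ∀ s ∈ I, μ s * B s = β₁ s := fun s hs => by
    linear_combination -A s * hpar s hs + β₁ s * hunit s hs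
  have hμ2 : ∀ s ∈ I, μ s ^ 2 = α₁ s ^ 2 + β₁ s ^ 2 := fun s hs => by
    rw [← hμA s hs, ← hμB s hs]
    linear_combination -μ s ^ 2 * hunit s hs
  have hμ0 : ∀ s ∈ I, μ s ≠ 0 := fun s hs h0 => hreg s hs (by rw [← hμ2 s hs, h0]; ring)
  have hq : ∀ s ∈ I, 0 < α₁ s ^ 2 + β₁ s ^ 2 := fun s hs =>
    lt_of_le_of_ne (by positivity) (hreg s hs).symm
  have hcα : ContinuousOn α₁ I := fun s hs => (hα s hs).continuousAt.continuousWithinAt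
  have hcβ : ContinuousOn β₁ I := fun s hs => (hβ s hs).continuousAt.continuousWithinAt
  have hcμ : ContinuousOn μ I := (hA.mul hcα).add (hB.mul hcβ)
  have hsign : EqOn μ (fun s => √(α₁ s ^ 2 + β₁ s ^ 2)) I ∨
      EqOn μ (-fun s => √(α₁ s ^ 2 + β₁ s ^ 2)) I := by
    refine hI'.eq_or_eq_neg_of_sq_eq hcμ ((hcα.pow 2).add (hcβ.pow 2)).sqrt ?_ ?_
    · intro s hs
      simp only [Pi.pow_apply]
      rw [hμ2 s hs, Real.sq_sqrt (hq s hs).le]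
    · intro s hs
      exact (Real.sqrt_pos.2 (hq s hs)).ne'
  have hroot : HasDerivAt (fun s => √(α₁ s ^ 2 + β₁ s ^ 2)) _ s :=
    (((hα s hs).pow 2).add ((hβ s hs).pow 2)).sqrt (hreg s hs)
  have hdμ : HasDerivAt μ ((α₁ s * α₂ s + β₁ s * β₂ s) / μ s) s := by
    rcases hsign with h | h
    · refine (hroot.congr_of_eventuallyEq (h.eventuallyEq_of_mem (hI.mem_nhds hs))).congr_deriv ?_
      have h1 := h hs
      have h0 := hμ0 s hs
      simp only at h1
      simp only [Pi.add_apply, Pi.pow_apply]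
      rw [← h1]
      field_simp
      norm_num
      ring
    · refine (hroot.neg.congr_of_eventuallyEq
        (h.eventuallyEq_of_mem (hI.mem_nhds hs))).congr_deriv ?_
      have h1 := h hs
      have h0 := hμ0 s hs
      simp only [Pi.neg_apply] at h1
      simp only [Pi.add_apply, Pi.pow_apply]
      rw [show √(α₁ s ^ 2 + β₁ s ^ 2) = -μ s by rw [h1]; ring]
      field_simp
      norm_num
      ring
  have h0 := hμ0 s hs
  have eA := hμA s hs
  have eB := hμB s hs
  have e2 := hμ2 s hs
  rw [← e2] at hK
  have eU := hunit s hs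
  have hAeq : A =ᶠ[𝓝 s] fun r => α₁ r / μ r := by
    filter_upwards [hI.mem_nhds hs] with r hr
    rw [eq_div_iff (hμ0 r hr), mul_comm, hμA r hr]
  have hBeq : B =ᶠ[𝓝 s] fun r => β₁ r / μ r := by
    filter_upwards [hI.mem_nhds hs] with r hr
    rw [eq_div_iff (hμ0 r hr), mul_comm, hμB r hr]
  refine ⟨(((hα s hs).div hdμ h0).congr_of_eventuallyEq hAeq).congr_deriv ?_,
    (((hβ s hs).div hdμ h0).congr_of_eventuallyEq hBeq).congr_deriv ?_⟩
  · change _ = μ s * _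
    rw [← eA, ← eB]
    field_simp
    linear_combination -B s * hK - α₂ s * eU
  · change _ = μ s * _
    rw [← eA, ← eB]
    field_simp
    linear_combination A s * hK - β₂ s * eU

end UnitTangent

/-! ### The slice transverse to the orbits -/

section Slice

variable {M : Type*} [TopologicalSpace M] {τ : TranslationKind}

/-- The points of the surface with orbit parameter zero. -/
abbrev Slice (σ : Straightening τ) (ψ : M → Coord) : Type _ := {p : M // σ.h (ψ p) = 0}

/-- The point of the slice on the orbit of `q`. -/
def toSlice (σ : Straightening τ) {ψ : M → Coord} (hpos : ∀ p, 0 < ψ p 1) {φ : Flow ℝ M}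
    (hφ : ∀ (t : ℝ) (p : M), ψ (φ t p) = translation τ t (ψ p)) (q : M) : Slice σ ψ :=
  ⟨φ (-σ.h (ψ q)) q, by rw [hφ, σ.h_translation _ _ (hpos q)]; ring⟩

variable {σ : Straightening τ} {ψ : M → Coord} {hpos : ∀ p, 0 < ψ p 1} {φ : Flow ℝ M}
  {hφ : ∀ (t : ℝ) (p : M), ψ (φ t p) = translation τ t (ψ p)}

theorem toSlice_val (q : M) : (toSlice σ hpos hφ q : M) = φ (-σ.h (ψ q)) q := rfl

theorem toSlice_of_eq_zero {q : M} (hq : σ.h (ψ q) = 0) : toSlice σ hpos hφ q = ⟨q, hq⟩ := by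
  apply Subtype.ext
  rw [toSlice_val, hq, neg_zero]
  exact φ.map_zero_apply q

theorem flow_toSlice (q : M) : φ (σ.h (ψ q)) (toSlice σ hpos hφ q) = q := by
  rw [toSlice_val, ← φ.map_add, add_neg_cancel]
  exact φ.map_zero_apply q

theorem continuous_comp_of_contDiffOn {u : Coord → ℝ} (hu : ContDiffOn ℝ ∞ u {q | 0 < q 1})
    (hψ : Continuous ψ) (hpos : ∀ p, 0 < ψ p 1) : Continuous fun p => u (ψ p) :=
  hu.continuousOn.comp_continuous hψ hpos

theorem continuous_toSlice (hψ : Continuous ψ) : Continuous (toSlice σ hpos hφ) :=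
  Continuous.subtype_mk
    (φ.continuous (continuous_comp_of_contDiffOn σ.contDiffOn_h hψ hpos).neg continuous_id) _

/-- The surface retracts onto the slice along the orbits. -/
theorem connectedSpace_slice [ConnectedSpace M] (hψ : Continuous ψ) (hpos : ∀ p, 0 < ψ p 1)
    (hφ : ∀ (t : ℝ) (p : M), ψ (φ t p) = translation τ t (ψ p)) :
    ConnectedSpace (Slice σ ψ) :=
  Function.Surjective.connectedSpace (f := toSlice σ hpos hφ)
    (fun p => ⟨p, toSlice_of_eq_zero p.2⟩) (continuous_toSlice hψ)

/-- If the slice is embedded by the invariant coordinates, then the surface is embedded. -/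
theorem isEmbedding_of_slice (hψ : Continuous ψ) (hpos : ∀ p, 0 < ψ p 1)
    (hφ : ∀ (t : ℝ) (p : M), ψ (φ t p) = translation τ t (ψ p))
    (hs : IsEmbedding fun p : Slice σ ψ => (σ.a (ψ p), σ.b (ψ p))) : IsEmbedding ψ := by
  have hh := continuous_comp_of_contDiffOn σ.contDiffOn_h hψ hpos
  -- The flow inverts this map. Composing it with the embedding of the slice shows that (a, b, h) ∘
  -- ψ is an embedding; as (a, b, h) is continuous on the half-space, `ψ` is one too.
  have hι : IsEmbedding fun q : M => (toSlice σ hpos hφ q, σ.h (ψ q)) := by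
    refine IsEmbedding.of_leftInverse (f := fun x : Slice σ ψ × ℝ => φ x.2 x.1) ?_ ?_ ?_
    · exact fun q => flow_toSlice (hpos := hpos) (hφ := hφ) q
    · exact φ.continuous continuous_snd (continuous_subtype_val.comp continuous_fst)
    · exact (continuous_toSlice hψ).prodMk hh
  have hF := (hs.prodMap (IsEmbedding.id (X := ℝ))).comp hι
  have hFeq : (Prod.map (fun p : Slice σ ψ => (σ.a (ψ p), σ.b (ψ p))) (id : ℝ → ℝ)) ∘
      (fun q : M => (toSlice σ hpos hφ q, σ.h (ψ q))) =
      fun q => ((σ.a (ψ q), σ.b (ψ q)), σ.h (ψ q)) := by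
    funext q
    simp only [Function.comp_apply, Prod.map_apply, id_eq, toSlice_val, hφ,
      σ.a_translation _ _ (hpos q), σ.b_translation _ _ (hpos q)]
  rw [hFeq] at hF
  have hψ' : Continuous fun q => (⟨ψ q, hpos q⟩ : {q : Coord // 0 < q 1}) := hψ.subtype_mk _
  have hG : Continuous fun q : {q : Coord // 0 < q 1} =>
      ((σ.a (q : Coord), σ.b (q : Coord)), σ.h (q : Coord)) :=
    ((σ.contDiffOn_a.continuousOn.domRestrict).prodMk (σ.contDiffOn_b.continuousOn.domRestrict)).prodMk
      (σ.contDiffOn_h.continuousOn.domRestrict)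
  exact IsEmbedding.subtypeVal.comp (IsEmbedding.of_comp hψ' hG hF)

end Slice

/-! ### The slice as a plane curve -/

section AdaptedCurve

variable {M : Type*} [TopologicalSpace M] [ChartedSpace Param M] {τ : TranslationKind}
  {σ : Straightening τ} {ψ : M → Coord} {e : OpenPartialHomeomorph M Param}
  {c₁ c₂ s₀ t₀ ε : ℝ} {α β : ℝ → ℝ}

namespace IsAdaptedChart

theorem fst_mem (h : IsAdaptedChart σ ψ e c₁ c₂ s₀ t₀ ε α β) {q : M} (hq : q ∈ e.source) :
    e q 0 ∈ Metric.ball s₀ ε := by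
  have : e q ∈ rect s₀ t₀ ε := h.target_eq ▸ e.map_source hq
  simpa [Real.dist_eq] using this.1

theorem mem_target (h : IsAdaptedChart σ ψ e c₁ c₂ s₀ t₀ ε α β) {s t : ℝ}
    (hs : s ∈ Metric.ball s₀ ε) (ht : t ∈ Metric.ball t₀ ε) : (!₂[s, t] : Param) ∈ e.target := by
  rw [h.target_eq]
  refine ⟨?_, ?_⟩
  · simpa [Real.dist_eq] using hs
  · simpa [Real.dist_eq] using ht

theorem apply_symm (h : IsAdaptedChart σ ψ e c₁ c₂ s₀ t₀ ε α β) (hpos : ∀ p, 0 < ψ p 1)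
    {x : Param} (hx : x ∈ e.target) : ψ (e.symm x) = σ.inv ![α (x 0), β (x 0), x 1] := by
  have hs := e.map_target hx
  rw [← σ.inv_apply _ (hpos (e.symm x)), h.a_eq _ hs, h.b_eq _ hs, ← h.snd _ hs, e.right_inv hx]

theorem hasDerivAt_α (h : IsAdaptedChart σ ψ e c₁ c₂ s₀ t₀ ε α β) {s : ℝ}
    (hs : s ∈ Metric.ball s₀ ε) : HasDerivAt α (deriv α s) s :=
  ((h.contDiffOn_α.contDiffAt (Metric.isOpen_ball.mem_nhds hs)).differentiableAt
    (by simp)).hasDerivAt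

theorem hasDerivAt_β (h : IsAdaptedChart σ ψ e c₁ c₂ s₀ t₀ ε α β) {s : ℝ}
    (hs : s ∈ Metric.ball s₀ ε) : HasDerivAt β (deriv β s) s :=
  ((h.contDiffOn_β.contDiffAt (Metric.isOpen_ball.mem_nhds hs)).differentiableAt
    (by simp)).hasDerivAt

theorem hasDerivAt_deriv_α (h : IsAdaptedChart σ ψ e c₁ c₂ s₀ t₀ ε α β) {s : ℝ}
    (hs : s ∈ Metric.ball s₀ ε) : HasDerivAt (deriv α) (deriv (deriv α) s) s :=
  (((h.contDiffOn_α.deriv_of_isOpen Metric.isOpen_ball (m := ∞) (by simp)).contDiffAt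
    (Metric.isOpen_ball.mem_nhds hs)).differentiableAt (by simp)).hasDerivAt

theorem hasDerivAt_deriv_β (h : IsAdaptedChart σ ψ e c₁ c₂ s₀ t₀ ε α β) {s : ℝ}
    (hs : s ∈ Metric.ball s₀ ε) : HasDerivAt (deriv β) (deriv (deriv β) s) s :=
  (((h.contDiffOn_β.deriv_of_isOpen Metric.isOpen_ball (m := ∞) (by simp)).contDiffAt
    (Metric.isOpen_ball.mem_nhds hs)).differentiableAt (by simp)).hasDerivAt

theorem hasDerivTwice_α (h : IsAdaptedChart σ ψ e c₁ c₂ s₀ t₀ ε α β) {s : ℝ}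
    (hs : s ∈ Metric.ball s₀ ε) : HasDerivTwice α (deriv α) (deriv (deriv α) s) s :=
  ⟨by filter_upwards [Metric.isOpen_ball.mem_nhds hs] with r hr using h.hasDerivAt_α hr,
    h.hasDerivAt_deriv_α hs⟩

theorem hasDerivTwice_β (h : IsAdaptedChart σ ψ e c₁ c₂ s₀ t₀ ε α β) {s : ℝ}
    (hs : s ∈ Metric.ball s₀ ε) : HasDerivTwice β (deriv β) (deriv (deriv β) s) s :=
  ⟨by filter_upwards [Metric.isOpen_ball.mem_nhds hs] with r hr using h.hasDerivAt_β hr,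
    h.hasDerivAt_deriv_β hs⟩

/-- The first chart coordinate is c₁α + c₂β, so c₁α' + c₂β' = 1. -/
theorem regular (h : IsAdaptedChart σ ψ e c₁ c₂ s₀ t₀ ε α β) {s : ℝ}
    (hs : s ∈ Metric.ball s₀ ε) : deriv α s ^ 2 + deriv β s ^ 2 ≠ 0 := by
  have heq : (fun r => c₁ * α r + c₂ * β r) =ᶠ[𝓝 s] id := by
    filter_upwards [Metric.isOpen_ball.mem_nhds hs] with r hr
    have hx := h.mem_target hr (Metric.mem_ball_self h.pos)
    have hq := e.map_target hx
    have h1 := h.fst _ hq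
    rw [h.a_eq _ hq, h.b_eq _ hq, e.right_inv hx] at h1
    simpa using h1.symm
  have h1 := (((h.hasDerivAt_α hs).const_mul c₁).add ((h.hasDerivAt_β hs).const_mul c₂)).unique
    ((hasDerivAt_id s).congr_of_eventuallyEq heq)
  intro h0
  have e1 : deriv α s = 0 := by nlinarith [sq_nonneg (deriv α s), sq_nonneg (deriv β s)]
  have e2 : deriv β s = 0 := by nlinarith [sq_nonneg (deriv α s), sq_nonneg (deriv β s)]
  rw [e1, e2] at h1
  simp at h1

end IsAdaptedChart

/-- The chart of the slice induced by an adapted chart. -/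
def sliceChart (h : IsAdaptedChart σ ψ e c₁ c₂ s₀ 0 ε α β) (hψ : Continuous ψ)
    (hpos : ∀ p, 0 < ψ p 1) {φ : Flow ℝ M}
    (hφ : ∀ (t : ℝ) (p : M), ψ (φ t p) = translation τ t (ψ p)) :
    OpenPartialHomeomorph (Slice σ ψ) ℝ where
  toFun p := e p 0
  -- The inverse has to land in the slice for every `s`; `toSlice` ensures this and changes nothing
  -- when `s` is in the target.
  invFun s := toSlice σ hpos hφ (e.symm !₂[s, 0])
  source := {p | (p : M) ∈ e.source}
  target := Metric.ball s₀ ε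
  map_source' p hp := h.fst_mem hp
  map_target' s hs := by
    have hx := h.mem_target hs (Metric.mem_ball_self h.pos)
    have hq := e.map_target hx
    have h0 : σ.h (ψ (e.symm !₂[s, 0])) = 0 := by
      rw [← h.snd _ hq, e.right_inv hx]
      simp
    rw [toSlice_of_eq_zero h0]
    exact hq
  left_inv' p hp := by
    have h1 : (!₂[e p 0, 0] : Param) = e p := by
      have := h.snd _ hp
      rw [p.2] at this
      ext i
      fin_cases i
      · simp
      · simp [this]
    rw [h1, e.left_inv hp]
    exact toSlice_of_eq_zero p.2
  right_inv' s hs := by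
    have hx := h.mem_target hs (Metric.mem_ball_self h.pos)
    have hq := e.map_target hx
    have h0 : σ.h (ψ (e.symm !₂[s, 0])) = 0 := by
      rw [← h.snd _ hq, e.right_inv hx]
      simp
    rw [toSlice_of_eq_zero h0]
    simp only
    rw [e.right_inv hx]
    simp
  open_source := e.open_source.preimage continuous_subtype_val
  open_target := Metric.isOpen_ball
  continuousOn_toFun := (continuous_param_apply 0).comp_continuousOn
    (e.continuousOn.comp continuous_subtype_val.continuousOn fun p hp => hp)
  continuousOn_invFun := by
    refine (continuous_toSlice hψ).comp_continuousOn (e.continuousOn_symm.comp ?_ ?_)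
    · refine Continuous.continuousOn ?_
      have : ContDiff ℝ ∞ fun s : ℝ => (!₂[s, 0] : Param) := by
        rw [contDiff_euclidean]
        intro i
        fin_cases i
        · exact contDiff_id
        · exact contDiff_const
      exact this.continuous
    · intro s hs
      exact h.mem_target hs (Metric.mem_ball_self h.pos)

variable {h : IsAdaptedChart σ ψ e c₁ c₂ s₀ 0 ε α β} {hψ : Continuous ψ}
    {hpos : ∀ p, 0 < ψ p 1} {φ : Flow ℝ M}
    {hφ : ∀ (t : ℝ) (p : M), ψ (φ t p) = translation τ t (ψ p)}

theorem sliceChart_target : (sliceChart h hψ hpos hφ).target = Metric.ball s₀ ε := rfl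

theorem sliceChart_symm_mem {s : ℝ} (hs : s ∈ Metric.ball s₀ ε) :
    ((sliceChart h hψ hpos hφ).symm s : M) ∈ e.source :=
  (sliceChart h hψ hpos hφ).map_target hs

theorem sliceChart_apply_symm {s : ℝ} (hs : s ∈ Metric.ball s₀ ε) :
    e ((sliceChart h hψ hpos hφ).symm s : M) 0 = s :=
  (sliceChart h hψ hpos hφ).right_inv hs

/-- The slice of an invariant surface whose profile has, in every adapted chart, the unit tangent
`(A, B)` and the curvature `P A + R B`. -/
theorem exists_isPlaneCurve [IsManifold (𝓡 2) ∞ M] (σ : Straightening τ)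
    (hψ : IsImmersedSurface ψ) (hφ : ∀ (t : ℝ) (p : M), ψ (φ t p) = translation τ t (ψ p))
    {A B : M → ℝ} (hA : Continuous A) (hB : Continuous B) {P R : ℝ → ℝ} {Ω : Set ℝ}
    (hmem : ∀ p, σ.a (ψ p) ∈ Ω)
    (hcurv : ∀ (e : OpenPartialHomeomorph M Param) (c₁ c₂ s₀ t₀ ε : ℝ) (α β : ℝ → ℝ),
      IsAdaptedChart σ ψ e c₁ c₂ s₀ t₀ ε α β → ∀ p ∈ e.source,
      A p ^ 2 + B p ^ 2 = 1 ∧ A p * deriv β (e p 0) = B p * deriv α (e p 0) ∧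
      A p * deriv (deriv β) (e p 0) - B p * deriv (deriv α) (e p 0) =
        (P (σ.a (ψ p)) * A p + R (σ.a (ψ p)) * B p) *
          (deriv α (e p 0) ^ 2 + deriv β (e p 0) ^ 2)) :
    ∃ 𝒜, IsPlaneCurve (S := Slice σ ψ) 𝒜 P R Ω (fun p => σ.a (ψ p)) (fun p => σ.b (ψ p))
      (fun p => A p) (fun p => B p) := by
  have hψc : Continuous ψ := hψ.immersion.contMDiff.continuous
  set 𝒜 : Set (OpenPartialHomeomorph (Slice σ ψ) ℝ × (ℝ → ℝ)) :=
    {x | ∃ (e : OpenPartialHomeomorph M Param) (c₁ c₂ s₀ ε : ℝ) (α β : ℝ → ℝ)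
      (h : IsAdaptedChart σ ψ e c₁ c₂ s₀ 0 ε α β), x.1 = sliceChart h hψc hψ.pos hφ ∧
      x.2 = fun s => A ((sliceChart h hψc hψ.pos hφ).symm s) * deriv α s +
        B ((sliceChart h hψc hψ.pos hφ).symm s) * deriv β s} with h𝒜
  have hcurvS : ∀ (e : OpenPartialHomeomorph M Param) (c₁ c₂ s₀ ε : ℝ) (α β : ℝ → ℝ)
      (h : IsAdaptedChart σ ψ e c₁ c₂ s₀ 0 ε α β), ∀ s ∈ Metric.ball s₀ ε,
      A ((sliceChart h hψc hψ.pos hφ).symm s) ^ 2 + B ((sliceChart h hψc hψ.pos hφ).symm s) ^ 2 = 1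
      ∧ A ((sliceChart h hψc hψ.pos hφ).symm s) * deriv β s =
        B ((sliceChart h hψc hψ.pos hφ).symm s) * deriv α s ∧
      A ((sliceChart h hψc hψ.pos hφ).symm s) * deriv (deriv β) s -
        B ((sliceChart h hψc hψ.pos hφ).symm s) * deriv (deriv α) s =
        (P (σ.a (ψ ((sliceChart h hψc hψ.pos hφ).symm s))) *
            A ((sliceChart h hψc hψ.pos hφ).symm s) +
          R (σ.a (ψ ((sliceChart h hψc hψ.pos hφ).symm s))) *
            B ((sliceChart h hψc hψ.pos hφ).symm s)) *
          (deriv α s ^ 2 + deriv β s ^ 2) := by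
    intro e c₁ c₂ s₀ ε α β h s hs
    have := hcurv e c₁ c₂ s₀ 0 ε α β h _ (sliceChart_symm_mem (hψ := hψc) (hpos := hψ.pos)
      (hφ := hφ) (h := h) hs)
    rwa [sliceChart_apply_symm hs] at this
  have hsymm : ∀ (e : OpenPartialHomeomorph M Param) (c₁ c₂ s₀ ε : ℝ) (α β : ℝ → ℝ)
      (h : IsAdaptedChart σ ψ e c₁ c₂ s₀ 0 ε α β) {F : M → ℝ}, Continuous F →
      ContinuousOn (fun s => F ((sliceChart h hψc hψ.pos hφ).symm s)) (Metric.ball s₀ ε) := by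
    intro e c₁ c₂ s₀ ε α β h F hF
    exact (hF.comp continuous_subtype_val).comp_continuousOn
      (sliceChart h hψc hψ.pos hφ).continuousOn_symm
  refine ⟨𝒜, ?_⟩
  have hatlas : IsCurveAtlas 𝒜 := by
    refine ⟨?_, ?_, ?_, ?_⟩
    · intro p
      obtain ⟨e, c₁, c₂, s₀, ε, α, β, hp, h⟩ := exists_adaptedChart σ hψ hφ (p : M)
      -- At a point of the slice the adapted chart is centred at orbit parameter 0.
      rw [p.2] at h
      exact ⟨(sliceChart h hψc hψ.pos hφ, _), ⟨e, c₁, c₂, s₀, ε, α, β, h, rfl, rfl⟩, hp⟩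
    · rintro ⟨x, μ⟩ ⟨e, c₁, c₂, s₀, ε, α, β, h, h1, h2⟩
      simp only at h1 h2
      subst h1 h2
      rw [sliceChart_target, Real.ball_eq_Ioo]
      exact ordConnected_Ioo
    · rintro ⟨x, μ⟩ ⟨e, c₁, c₂, s₀, ε, α, β, h, h1, h2⟩ s hs
      simp only at h1 h2
      subst h1 h2
      have hreg := h.regular hs
      obtain ⟨hu, hp, -⟩ := hcurvS e c₁ c₂ s₀ ε α β h s hs
      simp only
      intro h0
      apply hreg
      generalize A ((sliceChart h hψc hψ.pos hφ).symm s) = A' at *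
      generalize B ((sliceChart h hψc hψ.pos hφ).symm s) = B' at *
      -- Lagrange's identity: as (A, B) is a unit vector parallel to (α', β'), the squared speed is
      -- α'² + β'².
      have : (A' * deriv α s + B' * deriv β s) ^ 2 + (A' * deriv β s - B' * deriv α s) ^ 2 =
          (A' ^ 2 + B' ^ 2) * (deriv α s ^ 2 + deriv β s ^ 2) := by ring
      rw [hu, h0, hp] at this
      linarith
    · rintro ⟨x, μ⟩ ⟨e, c₁, c₂, s₀, ε, α, β, h, h1, h2⟩
      simp only at h1 h2
      subst h1 h2
      exact ((hsymm e c₁ c₂ s₀ ε α β h hA).mul fun s hs =>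
        (h.hasDerivAt_deriv_α hs).continuousAt.continuousWithinAt).add
        ((hsymm e c₁ c₂ s₀ ε α β h hB).mul fun s hs =>
        (h.hasDerivAt_deriv_β hs).continuousAt.continuousWithinAt)
  refine ⟨hatlas,
    (continuous_comp_of_contDiffOn σ.contDiffOn_a hψc hψ.pos).comp continuous_subtype_val,
    (continuous_comp_of_contDiffOn σ.contDiffOn_b hψc hψ.pos).comp continuous_subtype_val,
    hA.comp continuous_subtype_val, hB.comp continuous_subtype_val, fun p => hmem p, ?_, ?_, ?_,
    ?_, ?_⟩
  · intro p
    obtain ⟨e, c₁, c₂, s₀, ε, α, β, hp, h⟩ := exists_adaptedChart σ hψ hφ (p : M)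
    exact (hcurv _ _ _ _ _ _ _ _ h p hp).1
  · rintro ⟨x, μ⟩ ⟨e, c₁, c₂, s₀, ε, α, β, h, h1, h2⟩ s hs
    simp only at h1 h2
    subst h1 h2
    obtain ⟨hu, hp, -⟩ := hcurvS e c₁ c₂ s₀ ε α β h s hs
    refine ((h.hasDerivAt_α hs).congr_of_eventuallyEq ?_).congr_deriv ?_
    · filter_upwards [Metric.isOpen_ball.mem_nhds hs] with r hr
      have := h.a_eq _ (sliceChart_symm_mem (hψ := hψc) (hpos := hψ.pos)
        (hφ := hφ) (h := h) hr)
      rw [sliceChart_apply_symm hr] at this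
      exact this
    · linear_combination -deriv α s * hu -
        B ((sliceChart h hψc hψ.pos hφ).symm s) * hp
  · rintro ⟨x, μ⟩ ⟨e, c₁, c₂, s₀, ε, α, β, h, h1, h2⟩ s hs
    simp only at h1 h2
    subst h1 h2
    obtain ⟨hu, hp, -⟩ := hcurvS e c₁ c₂ s₀ ε α β h s hs
    refine ((h.hasDerivAt_β hs).congr_of_eventuallyEq ?_).congr_deriv ?_
    · filter_upwards [Metric.isOpen_ball.mem_nhds hs] with r hr
      have := h.b_eq _ (sliceChart_symm_mem (hψ := hψc) (hpos := hψ.pos)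
        (hφ := hφ) (h := h) hr)
      rw [sliceChart_apply_symm hr] at this
      exact this
    · linear_combination -deriv β s * hu +
        A ((sliceChart h hψc hψ.pos hφ).symm s) * hp
  · rintro ⟨x, μ⟩ ⟨e, c₁, c₂, s₀, ε, α, β, h, h1, h2⟩ s hs
    simp only at h1 h2
    subst h1 h2
    exact (hasDerivAt_unitTangent Metric.isOpen_ball (Metric.isPreconnected_ball)
      (fun r hr => h.hasDerivAt_deriv_α hr) (fun r hr => h.hasDerivAt_deriv_β hr)
      (hsymm e c₁ c₂ s₀ ε α β h hA) (hsymm e c₁ c₂ s₀ ε α β h hB)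
      (fun r hr => (hcurvS e c₁ c₂ s₀ ε α β h r hr).1)
      (fun r hr => (hcurvS e c₁ c₂ s₀ ε α β h r hr).2.1)
      (fun r hr => h.regular hr) hs (hcurvS e c₁ c₂ s₀ ε α β h s hs).2.2).1
  · rintro ⟨x, μ⟩ ⟨e, c₁, c₂, s₀, ε, α, β, h, h1, h2⟩ s hs
    simp only at h1 h2
    subst h1 h2
    exact (hasDerivAt_unitTangent Metric.isOpen_ball (Metric.isPreconnected_ball)
      (fun r hr => h.hasDerivAt_deriv_α hr) (fun r hr => h.hasDerivAt_deriv_β hr)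
      (hsymm e c₁ c₂ s₀ ε α β h hA) (hsymm e c₁ c₂ s₀ ε α β h hB)
      (fun r hr => (hcurvS e c₁ c₂ s₀ ε α β h r hr).1)
      (fun r hr => (hcurvS e c₁ c₂ s₀ ε α β h r hr).2.1)
      (fun r hr => h.regular hr) hs (hcurvS e c₁ c₂ s₀ ε α β h s hs).2.2).2

end AdaptedCurve

/-! ### Normality in terms of partial derivatives -/

section Normal

variable {M : Type*} [TopologicalSpace M] [ChartedSpace Param M]

theorem inn_partialDeriv_eq_zero [IsManifold (𝓡 2) ∞ M] {ψ N : M → Coord}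
    (hψ : IsImmersedSurface ψ) (hN : IsUnitNormal ψ N) {e : OpenPartialHomeomorph M Param}
    (he : e ∈ IsManifold.maximalAtlas (𝓡 2) ∞ M) {p : M} (hp : p ∈ e.source) (i : Fin 2) :
    inn (ψ p) (N p) (partialDeriv i (ψ ∘ e.symm) (e p)) = 0 := by
  have hx := e.map_source hp
  have h1 : MDifferentiableAt (𝓡 2) (𝓡 2) e.symm (e p) :=
    ((contMDiffOn_symm_of_mem_maximalAtlas he).contMDiffAt
      (e.open_target.mem_nhds hx)).mdifferentiableAt (by simp)
  have h2 : MDifferentiableAt (𝓡 2) 𝓘(ℝ, Coord) ψ (e.symm (e p)) :=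
    hψ.immersion.contMDiff.contMDiffAt.mdifferentiableAt (by simp)
  have h3 := mfderiv_comp (e p) h2 h1
  rw [mfderiv_eq_fderiv] at h3
  unfold partialDeriv
  rw [h3]
  -- The base point is kept variable because `e.symm (e p)` is only propositionally equal to `p` and
  -- the tangent space depends on it.
  have h4 : ∀ q, q = p → ∀ v : TangentSpace (𝓡 2) q,
      inn (ψ p) (N p) (mfderiv (𝓡 2) 𝓘(ℝ, Coord) ψ q v) = 0 := by
    rintro q rfl v
    exact hN.normal q v
  exact h4 _ (e.left_inv hp) _

end Normal

/-! ### The four coordinate systems -/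

section Straightenings

theorem contDiffOn_apply (i : Fin 3) : ContDiffOn ℝ ∞ (fun q : Coord => q i) {q | 0 < q 1} :=
  (contDiff_apply ℝ ℝ i).contDiffOn

theorem contDiffOn_slope : ContDiffOn ℝ ∞ (fun q : Coord => q 0 / q 1) {q | 0 < q 1} :=
  (contDiffOn_apply 0).div (contDiffOn_apply 1) fun _ hq => (mem_ofPred.1 hq).ne'

theorem contDiffOn_log_apply_one :
    ContDiffOn ℝ ∞ (fun q : Coord => Real.log (q 1)) {q | 0 < q 1} :=
  (contDiffOn_apply 1).log fun _ hq => (mem_ofPred.1 hq).ne'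

theorem contDiff_of_apply {f : Coord → Coord} (h0 : ContDiff ℝ ∞ fun q => f q 0)
    (h1 : ContDiff ℝ ∞ fun q => f q 1) (h2 : ContDiff ℝ ∞ fun q => f q 2) : ContDiff ℝ ∞ f := by
  rw [contDiff_pi]
  intro i
  fin_cases i
  · exact h0
  · exact h1
  · exact h2

/-- Vertical translations in Cartesian coordinates of the half-plane. -/
def cartesianStraightening : Straightening .vertical where
  a q := q 1
  b q := q 0
  h q := q 2
  inv q := ![q 1, q 0, q 2]
  contDiffOn_a := contDiffOn_apply 1
  contDiffOn_b := contDiffOn_apply 0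
  contDiffOn_h := contDiffOn_apply 2
  contDiff_inv := contDiff_of_apply (contDiff_apply ℝ ℝ 1) (contDiff_apply ℝ ℝ 0)
    (contDiff_apply ℝ ℝ 2)
  inv_apply q _ := by
    ext i
    fin_cases i <;> simp
  a_translation t q _ := by simp [translation]
  b_translation t q _ := by simp [translation]
  h_translation t q _ := by simp [translation]

/-- Vertical translations in polar coordinates of the half-plane. -/
def polarStraightening : Straightening .vertical where
  a q := Real.pi / 2 - Real.arctan (q 0 / q 1)
  b q := Real.log (q 1 * √(1 + (q 0 / q 1) ^ 2))
  h q := q 2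
  inv q := ![Real.exp (q 1) * Real.cos (q 0), Real.exp (q 1) * Real.sin (q 0), q 2]
  contDiffOn_a := contDiffOn_const.sub (Real.contDiff_arctan.comp_contDiffOn contDiffOn_slope)
  contDiffOn_b := by
    refine ((contDiffOn_apply 1).mul ((contDiffOn_const.add (contDiffOn_slope.pow 2)).sqrt
      fun q _ => ?_)).log fun q hq => ?_
    · positivity
    · have : 0 < q 1 := hq
      positivity
  contDiffOn_h := contDiffOn_apply 2
  contDiff_inv := contDiff_of_apply
    ((Real.contDiff_exp.comp (contDiff_apply ℝ ℝ 1)).mul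
      (Real.contDiff_cos.comp (contDiff_apply ℝ ℝ 0)))
    ((Real.contDiff_exp.comp (contDiff_apply ℝ ℝ 1)).mul
      (Real.contDiff_sin.comp (contDiff_apply ℝ ℝ 0)))
    (contDiff_apply ℝ ℝ 2)
  inv_apply q hq := by
    have h1 : 0 < √(1 + (q 0 / q 1) ^ 2) := by positivity
    ext i
    fin_cases i
    · simp [Real.cos_pi_div_two_sub, Real.sin_arctan, Real.exp_log (mul_pos hq h1)]
      field_simp
    · simp [Real.sin_pi_div_two_sub, Real.cos_arctan, Real.exp_log (mul_pos hq h1)]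
      field_simp
    · simp
  a_translation t q _ := by simp [translation]
  b_translation t q _ := by simp [translation]
  h_translation t q _ := by simp [translation]

/-- With a = log y the metric of the slice x = 0 is da² + db². -/
def parabolicStraightening : Straightening .parabolic where
  a q := Real.log (q 1)
  b q := q 2
  h q := q 0
  inv q := ![q 2, Real.exp (q 0), q 1]
  contDiffOn_a := contDiffOn_log_apply_one
  contDiffOn_b := contDiffOn_apply 2
  contDiffOn_h := contDiffOn_apply 0
  contDiff_inv := contDiff_of_apply (contDiff_apply ℝ ℝ 2)
    (Real.contDiff_exp.comp (contDiff_apply ℝ ℝ 0)) (contDiff_apply ℝ ℝ 1)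
  inv_apply q hq := by
    ext i
    fin_cases i
    · simp
    · simp [Real.exp_log hq]
    · simp
  a_translation t q _ := by simp [translation]
  b_translation t q _ := by simp [translation]
  h_translation t q _ := by simp [translation]

/-- The coordinate a is the signed distance to the geodesic x = 0 of the half-plane, so the metric
orthogonal to the orbits is da² + db². -/
def hyperbolicStraightening : Straightening .hyperbolic where
  a q := Real.arsinh (q 0 / q 1)
  b q := q 2
  h q := Real.log (q 1)
  inv q := ![Real.exp (q 2) * Real.sinh (q 0), Real.exp (q 2), q 1]
  contDiffOn_a := Real.contDiff_arsinh.comp_contDiffOn contDiffOn_slope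
  contDiffOn_b := contDiffOn_apply 2
  contDiffOn_h := contDiffOn_log_apply_one
  contDiff_inv := contDiff_of_apply
    ((Real.contDiff_exp.comp (contDiff_apply ℝ ℝ 2)).mul
      (Real.contDiff_sinh.comp (contDiff_apply ℝ ℝ 0)))
    (Real.contDiff_exp.comp (contDiff_apply ℝ ℝ 2)) (contDiff_apply ℝ ℝ 1)
  inv_apply q hq := by
    ext i
    fin_cases i
    · simp [Real.exp_log hq]
      field_simp
    · simp [Real.exp_log hq]
    · simp
  a_translation t q hq := by
    simp only [translation, Matrix.cons_val_zero, Matrix.cons_val_one]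
    rw [mul_div_mul_left _ _ (Real.exp_pos t).ne']
  b_translation t q _ := by simp [translation]
  h_translation t q hq := by
    simp only [translation, Matrix.cons_val_one, Matrix.cons_val_zero]
    rw [Real.log_mul (Real.exp_pos t).ne' hq.ne', Real.log_exp, add_comm]

end Straightenings

/-! ### Curvature equations in adapted charts -/

section Profiles

theorem vec_eta (v : Coord) : ![v 0, v 1, v 2] = v := by
  ext i
  fin_cases i <;> rfl

variable {M : Type*} [TopologicalSpace M] [ChartedSpace Param M] {τ : TranslationKind}
  {σ : Straightening τ} {ψ N : M → Coord} {e : OpenPartialHomeomorph M Param}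
  {c₁ c₂ s₀ t₀ ε : ℝ} {α β : ℝ → ℝ} {δ : FieldKind} {p : M}

theorem IsAdaptedChart.eventuallyEq (h : IsAdaptedChart σ ψ e c₁ c₂ s₀ t₀ ε α β)
    (hpos : ∀ p, 0 < ψ p 1) (hp : p ∈ e.source) :
    ψ ∘ e.symm =ᶠ[𝓝 (e p)] fun y => σ.inv ![α (y 0), β (y 0), y 1] := by
  filter_upwards [e.open_target.mem_nhds (e.map_source hp)] with y hy
  exact h.apply_symm hpos hy

/-- The translator equation and the normal conditions in a chart, in coordinates. -/
theorem translator_chart [IsManifold (𝓡 2) ∞ M] (hψ : IsImmersedSurface ψ) (hN : IsUnitNormal ψ N)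
    (hH : ∀ e ∈ IsManifold.maximalAtlas (𝓡 2) ∞ M, ∀ p ∈ e.source,
      meanCurvature (ψ ∘ e.symm) (N p) (e p) = inn (ψ p) (N p) (field δ (ψ p)))
    (he : e ∈ IsManifold.maximalAtlas (𝓡 2) ∞ M) (hp : p ∈ e.source) :
    inn ((ψ ∘ e.symm) (e p)) ![N p 0, N p 1, N p 2] ![N p 0, N p 1, N p 2] = 1 ∧
    inn ((ψ ∘ e.symm) (e p)) ![N p 0, N p 1, N p 2] (partialDeriv 0 (ψ ∘ e.symm) (e p)) = 0 ∧
    inn ((ψ ∘ e.symm) (e p)) ![N p 0, N p 1, N p 2] (partialDeriv 1 (ψ ∘ e.symm) (e p)) = 0 ∧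
    meanCurvature (ψ ∘ e.symm) ![N p 0, N p 1, N p 2] (e p) =
      inn ((ψ ∘ e.symm) (e p)) ![N p 0, N p 1, N p 2]
        ![field δ (ψ p) 0, field δ (ψ p) 1, field δ (ψ p) 2] := by
  have h1 : (ψ ∘ e.symm) (e p) = ψ p := by simp [e.left_inv hp]
  rw [vec_eta, vec_eta, h1]
  exact ⟨hN.unit p, inn_partialDeriv_eq_zero hψ hN he hp 0,
    inn_partialDeriv_eq_zero hψ hN he hp 1, hH e he p hp⟩

/-- `A` and `B` come from the normal and not from the chart, so the equations obtained in different
charts concern the same tangent field. -/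
theorem profile_cartesian [IsManifold (𝓡 2) ∞ M] (hψ : IsImmersedSurface ψ)
    (hN : IsUnitNormal ψ N)
    (hH : ∀ e ∈ IsManifold.maximalAtlas (𝓡 2) ∞ M, ∀ p ∈ e.source,
      meanCurvature (ψ ∘ e.symm) (N p) (e p) = inn (ψ p) (N p) (field δ (ψ p)))
    (h : IsAdaptedChart cartesianStraightening ψ e c₁ c₂ s₀ t₀ ε α β) (hp : p ∈ e.source)
    {A B : ℝ} (hA : N p 0 = ψ p 1 * A) (hB : N p 1 = -(ψ p 1 * B)) :
    A ^ 2 + B ^ 2 = 1 ∧ A * deriv β (e p 0) = B * deriv α (e p 0) ∧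
      A * deriv (deriv β) (e p 0) - B * deriv (deriv α) (e p 0) =
        (B / ψ p 1 + 2 / ψ p 1 ^ 2 * (A * field δ (ψ p) 0 - B * field δ (ψ p) 1)) *
        (deriv α (e p 0) ^ 2 + deriv β (e p 0) ^ 2) := by
  have hs := h.fst_mem hp
  obtain ⟨h1, h2, h3, h4⟩ := translator_chart hψ hN hH h.mem_maximalAtlas hp
  have ha : ψ p 1 = α (e p 0) := h.a_eq p hp
  have hf := h.eventuallyEq hψ.pos hp
  have hpos := hψ.pos p
  rw [ha] at hA hB hpos ⊢
  exact curvature_vertical (by simpa [cartesianStraightening] using hf) (h.hasDerivTwice_α hs)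
    (h.hasDerivTwice_β hs) hpos (h.regular hs) h1 h2 h3 h4 hA hB

theorem profile_polar [IsManifold (𝓡 2) ∞ M] (hψ : IsImmersedSurface ψ)
    (hN : IsUnitNormal ψ N)
    (hH : ∀ e ∈ IsManifold.maximalAtlas (𝓡 2) ∞ M, ∀ p ∈ e.source,
      meanCurvature (ψ ∘ e.symm) (N p) (e p) = inn (ψ p) (N p) (field .h (ψ p)))
    (h : IsAdaptedChart polarStraightening ψ e c₁ c₂ s₀ t₀ ε α β) (hp : p ∈ e.source)
    {A B : ℝ}
    (hA : N p 0 = ψ p 1 * (A * Real.cos (polarStraightening.a (ψ p)) +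
      B * Real.sin (polarStraightening.a (ψ p))))
    (hB : N p 1 = ψ p 1 * (A * Real.sin (polarStraightening.a (ψ p)) -
      B * Real.cos (polarStraightening.a (ψ p)))) :
    A ^ 2 + B ^ 2 = 1 ∧ A * deriv β (e p 0) = B * deriv α (e p 0) ∧
      A * deriv (deriv β) (e p 0) - B * deriv (deriv α) (e p 0) =
        (2 / Real.sin (polarStraightening.a (ψ p)) ^ 2 * A +
          Real.cos (polarStraightening.a (ψ p)) / Real.sin (polarStraightening.a (ψ p)) * B) *
        (deriv α (e p 0) ^ 2 + deriv β (e p 0) ^ 2) := by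
  have hs := h.fst_mem hp
  obtain ⟨h1, h2, h3, h4⟩ := translator_chart hψ hN hH h.mem_maximalAtlas hp
  have hf := h.eventuallyEq hψ.pos hp
  have hval := h.apply_symm hψ.pos (e.map_source hp)
  rw [e.left_inv hp] at hval
  have hx : ψ p 0 = Real.exp (β (e p 0)) * Real.cos (α (e p 0)) := by
    rw [hval]
    simp [polarStraightening]
  have hy : ψ p 1 = Real.exp (β (e p 0)) * Real.sin (α (e p 0)) := by
    rw [hval]
    simp [polarStraightening]
  have hpos : 0 < Real.sin (α (e p 0)) := by
    have := hψ.pos p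
    rw [hy] at this
    exact pos_of_mul_pos_right this (Real.exp_pos _).le
  rw [h.a_eq p hp, hy] at hA hB
  rw [h.a_eq p hp]
  refine curvature_polar (by simpa [polarStraightening] using hf) (h.hasDerivTwice_α hs)
    (h.hasDerivTwice_β hs) hpos (h.regular hs) h1 h2 h3 ?_ hA hB
  rw [h4]
  simp [field, hx, hy]

theorem profile_parabolic [IsManifold (𝓡 2) ∞ M] (hψ : IsImmersedSurface ψ)
    (hN : IsUnitNormal ψ N)
    (hH : ∀ e ∈ IsManifold.maximalAtlas (𝓡 2) ∞ M, ∀ p ∈ e.source,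
      meanCurvature (ψ ∘ e.symm) (N p) (e p) = inn (ψ p) (N p) (field δ (ψ p)))
    (h : IsAdaptedChart parabolicStraightening ψ e c₁ c₂ s₀ t₀ ε α β) (hp : p ∈ e.source)
    {B : ℝ} (hB : N p 1 = -(ψ p 1 * B)) :
    N p 2 ^ 2 + B ^ 2 = 1 ∧ N p 2 * deriv β (e p 0) = B * deriv α (e p 0) ∧
      N p 2 * deriv (deriv β) (e p 0) - B * deriv (deriv α) (e p 0) =
        (B + 2 * (N p 2 * field δ (ψ p) 2 - B * field δ (ψ p) 1 / ψ p 1)) *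
        (deriv α (e p 0) ^ 2 + deriv β (e p 0) ^ 2) := by
  have hs := h.fst_mem hp
  obtain ⟨h1, h2, h3, h4⟩ := translator_chart hψ hN hH h.mem_maximalAtlas hp
  have hf := h.eventuallyEq hψ.pos hp
  have ha : ψ p 1 = Real.exp (α (e p 0)) := by
    rw [← h.a_eq p hp]
    exact (Real.exp_log (hψ.pos p)).symm
  rw [ha] at hB ⊢
  exact curvature_parabolic (by simpa [parabolicStraightening] using hf) (h.hasDerivTwice_α hs)
    (h.hasDerivTwice_β hs) (h.regular hs) h1 h2 h3 h4 rfl hB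

theorem profile_hyperbolic [IsManifold (𝓡 2) ∞ M] (hψ : IsImmersedSurface ψ)
    (hN : IsUnitNormal ψ N)
    (hH : ∀ e ∈ IsManifold.maximalAtlas (𝓡 2) ∞ M, ∀ p ∈ e.source,
      meanCurvature (ψ ∘ e.symm) (N p) (e p) = inn (ψ p) (N p) (field δ (ψ p)))
    (h : IsAdaptedChart hyperbolicStraightening ψ e c₁ c₂ s₀ t₀ ε α β) (hp : p ∈ e.source)
    {B : ℝ}
    (hB : N p 0 = -(ψ p 1 * B / Real.cosh (hyperbolicStraightening.a (ψ p)))) :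
    N p 2 ^ 2 + B ^ 2 = 1 ∧ N p 2 * deriv β (e p 0) = B * deriv α (e p 0) ∧
      N p 2 * deriv (deriv β) (e p 0) - B * deriv (deriv α) (e p 0) =
        (-(Real.sinh (hyperbolicStraightening.a (ψ p)) /
            Real.cosh (hyperbolicStraightening.a (ψ p))) * B +
          2 * (N p 2 * field δ (ψ p) 2 +
            B * (field δ (ψ p) 1 * Real.sinh (hyperbolicStraightening.a (ψ p)) - field δ (ψ p) 0) /
            (ψ p 1 * Real.cosh (hyperbolicStraightening.a (ψ p))))) *
        (deriv α (e p 0) ^ 2 + deriv β (e p 0) ^ 2) := by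
  have hs := h.fst_mem hp
  obtain ⟨h1, h2, h3, h4⟩ := translator_chart hψ hN hH h.mem_maximalAtlas hp
  have hf := h.eventuallyEq hψ.pos hp
  have ht : ψ p 1 = Real.exp (e p 1) := by
    rw [h.snd p hp]
    exact (Real.exp_log (hψ.pos p)).symm
  rw [h.a_eq p hp, ht] at hB ⊢
  exact curvature_hyperbolic (by simpa [hyperbolicStraightening] using hf) (h.hasDerivTwice_α hs)
    (h.hasDerivTwice_β hs) (h.regular hs) h1 h2 h3 h4 rfl hB

/-- If the right-hand side of the curvature equation scales along the orbits, it vanishes. -/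
theorem mul_eq_zero_of_scaling {A B A' B' a₁ b₁ a₂ b₂ K κ y y' : ℝ} (hq : a₁ ^ 2 + b₁ ^ 2 ≠ 0)
    (hne : y ≠ y') (h1 : A * b₁ = B * a₁)
    (h' : A' ^ 2 + B' ^ 2 = 1) (h1' : A' * b₁ = B' * a₁)
    (h2 : A * b₂ - B * a₂ = (K * B + 2 * (B * κ / y)) * (a₁ ^ 2 + b₁ ^ 2))
    (h2' : A' * b₂ - B' * a₂ = (K * B' + 2 * (B' * κ / y')) * (a₁ ^ 2 + b₁ ^ 2)) :
    B * κ = 0 := by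
  -- The two unit normals are only used up to proportionality, so no choice of sign matters.
  -- Weighting the two equations by B' and B eliminates everything but the scaling term.
  have hpar : A * B' = A' * B := by
    refine mul_right_cancel₀ hq ?_
    linear_combination (-A * a₁ - B * b₁) * h1' + (A' * a₁ + B' * b₁) * h1
  have h3 : B * B' * κ * (1 / y - 1 / y') = 0 := by
    refine (mul_eq_zero.1 ?_).resolve_right hq
    linear_combination (-B' / 2) * h2 + (B / 2) * h2' + b₂ / 2 * hpar
  have hd : 1 / y - 1 / y' ≠ 0 := by
    rw [sub_ne_zero]
    intro h
    exact hne (by simpa using h)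
  rcases mul_eq_zero.1 ((mul_eq_zero.1 h3).resolve_right hd) with h4 | h4
  · rcases mul_eq_zero.1 h4 with h5 | h5
    · rw [h5, zero_mul]
    · have hA' : A' ≠ 0 := by
        rintro rfl
        rw [h5] at h'
        norm_num at h'
      rw [h5, mul_zero] at hpar
      rw [(mul_eq_zero.1 hpar.symm).resolve_left hA', zero_mul]
  · rw [h4, mul_zero]

/-- A hyperbolic-invariant translator of a field whose normal component scales along the orbits is
minimal. -/
theorem profile_hyperbolic_of_scaling [IsManifold (𝓡 2) ∞ M] (hψ : IsImmersedSurface ψ)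
    (hN : IsUnitNormal ψ N)
    (hH : ∀ e ∈ IsManifold.maximalAtlas (𝓡 2) ∞ M, ∀ p ∈ e.source,
      meanCurvature (ψ ∘ e.symm) (N p) (e p) = inn (ψ p) (N p) (field δ (ψ p)))
    {X₀ X₁ : ℝ} (hX : ∀ q, field δ q = ![X₀, X₁, 0])
    (h : IsAdaptedChart hyperbolicStraightening ψ e c₁ c₂ s₀ t₀ ε α β) (hp : p ∈ e.source)
    {B : ℝ}
    (hB : N p 0 = -(ψ p 1 * B / Real.cosh (hyperbolicStraightening.a (ψ p)))) :
    N p 2 ^ 2 + B ^ 2 = 1 ∧ N p 2 * deriv β (e p 0) = B * deriv α (e p 0) ∧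
      N p 2 * deriv (deriv β) (e p 0) - B * deriv (deriv α) (e p 0) =
        (0 * N p 2 + -(Real.sinh (hyperbolicStraightening.a (ψ p)) /
          Real.cosh (hyperbolicStraightening.a (ψ p))) * B) *
        (deriv α (e p 0) ^ 2 + deriv β (e p 0) ^ 2) := by
  have hep : e p ∈ rect s₀ t₀ ε := h.target_eq ▸ e.map_source hp
  have hs := h.fst_mem hp
  -- A second point over the same profile point, at a different height y, for the comparison of the
  -- two curvature equations.
  obtain ⟨t, ht, hne⟩ : ∃ t ∈ Metric.ball t₀ ε, t ≠ e p 1 := by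
    by_cases h0 : t₀ = e p 1
    · refine ⟨t₀ + ε / 2, ?_, ?_⟩
      · have := h.pos
        rw [Metric.mem_ball, Real.dist_eq, add_sub_cancel_left, abs_of_pos (by positivity)]
        linarith
      · have := h.pos
        rw [← h0]
        linarith
    · exact ⟨t₀, Metric.mem_ball_self h.pos, h0⟩
  have hx := h.mem_target hs ht
  set p' := e.symm !₂[e p 0, t] with hp'
  have hp's : p' ∈ e.source := e.map_target hx
  have hep' : e p' = !₂[e p 0, t] := e.right_inv hx
  have hep'0 : e p' 0 = e p 0 := by rw [hep']; simp
  have hep'1 : e p' 1 = t := by rw [hep']; simp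
  have haa : hyperbolicStraightening.a (ψ p') = hyperbolicStraightening.a (ψ p) := by
    rw [h.a_eq _ hp's, h.a_eq _ hp, hep'0]
  have hc := (Real.cosh_pos (hyperbolicStraightening.a (ψ p))).ne'
  have hy := (hψ.pos p).ne'
  have hy' := (hψ.pos p').ne'
  have hyy : ψ p 1 ≠ ψ p' 1 := by
    intro hcon
    apply hne
    rw [← hep'1, h.snd _ hp's, h.snd _ hp]
    simp only [hyperbolicStraightening]
    rw [hcon]
  obtain ⟨u1, u2, u3⟩ := profile_hyperbolic hψ hN hH h hp hB
  obtain ⟨v1, v2, v3⟩ := profile_hyperbolic hψ hN hH h hp's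
    (B := -(N p' 0 * Real.cosh (hyperbolicStraightening.a (ψ p)) / ψ p' 1)) (by
      rw [haa]
      field_simp)
  rw [hep'0] at v2 v3
  rw [haa] at v3
  set a := hyperbolicStraightening.a (ψ p)
  set B' := -(N p' 0 * Real.cosh a / ψ p' 1)
  simp only [hX, Matrix.cons_val_zero, Matrix.cons_val_one, Matrix.cons_val] at u3 v3
  have hκ := mul_eq_zero_of_scaling (κ := (X₁ * Real.sinh a - X₀) / Real.cosh a)
    (K := -(Real.sinh a / Real.cosh a)) (h.regular hs) hyy u2 v1 v2
    (u3.trans (by field_simp; ring)) (v3.trans (by field_simp; ring))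
  refine ⟨u1, u2, u3.trans ?_⟩
  have hκ' : B * (X₁ * Real.sinh a - X₀) / (ψ p 1 * Real.cosh a) = 0 := by
    have : B * (X₁ * Real.sinh a - X₀) / (ψ p 1 * Real.cosh a) =
        B * ((X₁ * Real.sinh a - X₀) / Real.cosh a) / ψ p 1 := by field_simp
    rw [this, hκ, zero_div]
  rw [hκ']
  ring

end Profiles

/-! ### The fifteen cases -/

section Embeddings

theorem continuous_comp_apply {S : Type*} [TopologicalSpace S] {u : S → Coord} (hu : Continuous u)
    (i : Fin 3) : Continuous fun p => u p i := (continuous_apply i).comp hu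

variable {M : Type*} [TopologicalSpace M] [ConnectedSpace M] [ChartedSpace Param M]
  [IsManifold (𝓡 2) ∞ M] {ψ N : M → Coord} {φ : Flow ℝ M} {δ : FieldKind} {τ : TranslationKind}

/-- An invariant surface is embedded if its profile satisfies a curvature equation whose
solutions are embedded curves. -/
theorem isEmbedding_of_isPlaneCurve (σ : Straightening τ)
    (hψ : IsImmersedSurface ψ) (hφ : ∀ (t : ℝ) (p : M), ψ (φ t p) = translation τ t (ψ p))
    {A B : M → ℝ} (hA : Continuous A) (hB : Continuous B) {P R : ℝ → ℝ} {Ω : Set ℝ}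
    (hmem : ∀ p, σ.a (ψ p) ∈ Ω)
    (hcurv : ∀ (e : OpenPartialHomeomorph M Param) (c₁ c₂ s₀ t₀ ε : ℝ) (α β : ℝ → ℝ),
      IsAdaptedChart σ ψ e c₁ c₂ s₀ t₀ ε α β → ∀ p ∈ e.source,
      A p ^ 2 + B p ^ 2 = 1 ∧ A p * deriv β (e p 0) = B p * deriv α (e p 0) ∧
      A p * deriv (deriv β) (e p 0) - B p * deriv (deriv α) (e p 0) =
        (P (σ.a (ψ p)) * A p + R (σ.a (ψ p)) * B p) *
          (deriv α (e p 0) ^ 2 + deriv β (e p 0) ^ 2))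
    (hemb : ∀ 𝒜, ConnectedSpace (Slice σ ψ) → IsPlaneCurve (S := Slice σ ψ) 𝒜 P R Ω
      (fun p => σ.a (ψ p)) (fun p => σ.b (ψ p)) (fun p => A p) (fun p => B p) →
      IsEmbedding fun p : Slice σ ψ => (σ.a (ψ p), σ.b (ψ p))) : IsEmbedding ψ := by
  have hψc : Continuous ψ := hψ.immersion.contMDiff.continuous
  obtain ⟨𝒜, h𝒜⟩ := exists_isPlaneCurve σ hψ hφ hA hB hmem hcurv
  exact isEmbedding_of_slice hψc hψ.pos hφ
    (hemb 𝒜 (connectedSpace_slice hψc hψ.pos hφ) h𝒜)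

theorem isEmbedding_cartesian (hψ : IsImmersedSurface ψ)
    (hφ : ∀ (t : ℝ) (p : M), ψ (φ t p) = translation .vertical t (ψ p)) (hN : IsUnitNormal ψ N)
    (hH : ∀ e ∈ IsManifold.maximalAtlas (𝓡 2) ∞ M, ∀ p ∈ e.source,
      meanCurvature (ψ ∘ e.symm) (N p) (e p) = inn (ψ p) (N p) (field δ (ψ p))) {P R : ℝ → ℝ}
    (hPR : ∀ (q : Coord) (A B : ℝ), 0 < q 1 →
      B / q 1 + 2 / q 1 ^ 2 * (A * field δ q 0 - B * field δ q 1) = P (q 1) * A + R (q 1) * B)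
    (hemb : ∀ 𝒜, ConnectedSpace (Slice cartesianStraightening ψ) →
      ∀ a b A B : Slice cartesianStraightening ψ → ℝ, IsPlaneCurve 𝒜 P R (Ioi 0) a b A B →
      IsEmbedding fun p => (a p, b p)) : IsEmbedding ψ := by
  have hψc : Continuous ψ := hψ.immersion.contMDiff.continuous
  have hy := continuous_comp_apply hψc 1
  have hy0 : ∀ p, ψ p 1 ≠ 0 := fun p => (hψ.pos p).ne'
  refine isEmbedding_of_isPlaneCurve (A := fun p => N p 0 / ψ p 1) (B := fun p => -(N p 1 / ψ p 1))
    (P := P) (R := R) (Ω := Ioi 0) cartesianStraightening hψ hφ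
    ((continuous_comp_apply hN.cont 0).div hy hy0)
    ((continuous_comp_apply hN.cont 1).div hy hy0).neg hψ.pos ?_ fun 𝒜 hc h => hemb 𝒜 hc _ _ _ _ h
  intro e c₁ c₂ s₀ t₀ ε α β h p hp
  obtain ⟨h1, h2, h3⟩ := profile_cartesian hψ hN hH h hp (A := N p 0 / ψ p 1)
    (B := -(N p 1 / ψ p 1)) (by field_simp [hy0 p]) (by field_simp [hy0 p])
  refine ⟨h1, h2, h3.trans ?_⟩
  rw [hPR _ _ _ (hψ.pos p)]
  rfl

/-- In the coordinates a = polar angle, b = log r the field x∂_x + y∂_y is ∂_b, so the coefficients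
depend on a only. -/
theorem isEmbedding_polar [T2Space M] (hψ : IsImmersedSurface ψ)
    (hφ : ∀ (t : ℝ) (p : M), ψ (φ t p) = translation .vertical t (ψ p)) (hN : IsUnitNormal ψ N)
    (hH : ∀ e ∈ IsManifold.maximalAtlas (𝓡 2) ∞ M, ∀ p ∈ e.source,
      meanCurvature (ψ ∘ e.symm) (N p) (e p) = inn (ψ p) (N p) (field .h (ψ p))) :
    IsEmbedding ψ := by
  have hψc : Continuous ψ := hψ.immersion.contMDiff.continuous
  have hy := continuous_comp_apply hψc 1
  have hy0 : ∀ p, ψ p 1 ≠ 0 := fun p => (hψ.pos p).ne'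
  have ha := continuous_comp_of_contDiffOn polarStraightening.contDiffOn_a hψc hψ.pos
  have hN0 := continuous_comp_apply hN.cont 0
  have hN1 := continuous_comp_apply hN.cont 1
  refine isEmbedding_of_isPlaneCurve
    (A := fun p => (N p 0 * Real.cos (polarStraightening.a (ψ p)) +
      N p 1 * Real.sin (polarStraightening.a (ψ p))) / ψ p 1)
    (B := fun p => (N p 0 * Real.sin (polarStraightening.a (ψ p)) -
      N p 1 * Real.cos (polarStraightening.a (ψ p))) / ψ p 1)
    (P := fun a => 2 / Real.sin a ^ 2) (R := fun a => Real.cos a / Real.sin a)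
    (Ω := Ioo 0 Real.pi) polarStraightening hψ hφ
    (((hN0.mul (Real.continuous_cos.comp ha)).add (hN1.mul (Real.continuous_sin.comp ha))).div
      hy hy0)
    (((hN0.mul (Real.continuous_sin.comp ha)).sub (hN1.mul (Real.continuous_cos.comp ha))).div
      hy hy0) ?_ ?_ ?_
  · intro p
    have h1 := Real.arctan_lt_pi_div_two (ψ p 0 / ψ p 1)
    have h2 := Real.neg_pi_div_two_lt_arctan (ψ p 0 / ψ p 1)
    simp only [polarStraightening, mem_Ioo]
    constructor <;> linarith
  · intro e c₁ c₂ s₀ t₀ ε α β h p hp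
    have hsc := Real.sin_sq_add_cos_sq (polarStraightening.a (ψ p))
    have hyp := hy0 p
    refine profile_polar hψ hN hH h hp ?_ ?_
    · field_simp
      linear_combination -N p 0 * hsc
    · field_simp
      linear_combination -N p 1 * hsc
  · intro 𝒜 hc h
    have hsin : ∀ x ∈ Ioo (0 : ℝ) Real.pi, Real.sin x ≠ 0 := fun x hx =>
      (Real.sin_pos_of_mem_Ioo hx).ne'
    -- With g = -m cos, the summand -gR is m cos²/sin, which vanishes only where R does. The weight
    -- m solves m'/m = -cos/sin³ - 2cos/sin, which makes the quadratic form a sum of squares.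
    refine h.isEmbedding_of_lyapunov (g := fun x => -(Real.cos x *
      (Real.exp (1 / (2 * Real.sin x ^ 2)) / Real.sin x ^ 2)))
      (g' := fun x => Real.exp (1 / (2 * Real.sin x ^ 2)) / Real.sin x ^ 2 *
        (Real.sin x + Real.cos x ^ 2 / Real.sin x ^ 3 + 2 * Real.cos x ^ 2 / Real.sin x))
      ?_ ?_ ?_ ?_
    · exact continuousOn_const.div (Real.continuous_sin.continuousOn.pow 2) fun x hx =>
        pow_ne_zero 2 (hsin x hx)
    · exact fun x hx => Real.differentiableAt_cos.div Real.differentiableAt_sin (hsin x hx)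
    · intro x hx
      have h0 := hsin x hx
      have hsq := (Real.hasDerivAt_sin x).pow 2
      have hE := ((hasDerivAt_const x (1 : ℝ)).div (hsq.const_mul 2)
        (mul_ne_zero two_ne_zero (pow_ne_zero 2 h0))).exp
      refine ((Real.hasDerivAt_cos x).mul (hE.div hsq (pow_ne_zero 2 h0))).neg.congr_deriv ?_
      simp only [Pi.pow_apply, Pi.div_apply]
      generalize Real.exp _ = E
      field_simp
      norm_num
      ring
    · intro x hx X Y hXY hne
      have hs := Real.sin_pos_of_mem_Ioo hx
      have hsc := Real.sin_sq_add_cos_sq x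
      have hm : 0 < Real.exp (1 / (2 * Real.sin x ^ 2)) / Real.sin x ^ 2 := by positivity
      set m := Real.exp (1 / (2 * Real.sin x ^ 2)) / Real.sin x ^ 2
      set s := Real.sin x
      set c := Real.cos x
      have key : m * (s + c ^ 2 / s ^ 3 + 2 * c ^ 2 / s) * X ^ 2 - -(c * m) * (2 / s ^ 2) * X * Y -
          -(c * m) * (c / s) * Y ^ 2 = m / s * ((X / s + c * Y) ^ 2 + c ^ 2 * X ^ 2) := by
        field_simp
        linear_combination (X ^ 2 * s ^ 2 + X ^ 2) * hsc
      rw [key]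
      refine mul_pos (div_pos hm hs) ?_
      by_cases hc0 : c = 0
      · have hX : X ≠ 0 := by
          rcases hne with h1 | h1
          · exact h1
          · exact absurd (by simp [hc0]) h1
        rw [hc0]
        have : X / s ≠ 0 := div_ne_zero hX hs.ne'
        simp only [zero_mul, add_zero]
        positivity
      · by_cases hX : X = 0
        · have hY : Y ≠ 0 := by
            rintro rfl
            rw [hX] at hXY
            norm_num at hXY
          rw [hX]
          simp only [zero_div, zero_add]
          positivity
        · positivity

theorem isEmbedding_parabolic [T2Space M] (hψ : IsImmersedSurface ψ)
    (hφ : ∀ (t : ℝ) (p : M), ψ (φ t p) = translation .parabolic t (ψ p)) (hN : IsUnitNormal ψ N)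
    (hH : ∀ e ∈ IsManifold.maximalAtlas (𝓡 2) ∞ M, ∀ p ∈ e.source,
      meanCurvature (ψ ∘ e.symm) (N p) (e p) = inn (ψ p) (N p) (field δ (ψ p))) {ρ : ℝ → ℝ}
    {k₁ k₂ : ℝ} (hρ : Continuous ρ) (hk : k₁ ^ 2 + k₂ ^ 2 ≠ 0)
    (hPR : ∀ (q : Coord) (A B : ℝ), 0 < q 1 → B + 2 * (A * field δ q 2 - B * field δ q 1 / q 1) =
      ρ (Real.log (q 1)) * k₁ * A + ρ (Real.log (q 1)) * k₂ * B) : IsEmbedding ψ := by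
  have hψc : Continuous ψ := hψ.immersion.contMDiff.continuous
  have hy := continuous_comp_apply hψc 1
  have hy0 : ∀ p, ψ p 1 ≠ 0 := fun p => (hψ.pos p).ne'
  refine isEmbedding_of_isPlaneCurve (A := fun p => N p 2) (B := fun p => -(N p 1 / ψ p 1))
    (P := fun x => ρ x * k₁) (R := fun x => ρ x * k₂) (Ω := univ) parabolicStraightening hψ hφ
    (continuous_comp_apply hN.cont 2)
    ((continuous_comp_apply hN.cont 1).div hy hy0).neg (fun _ => mem_univ _) ?_
    fun 𝒜 hc h => h.isEmbedding_of_proportional hk hρ.continuousOn (fun _ _ => rfl) fun _ _ => rfl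
  intro e c₁ c₂ s₀ t₀ ε α β h p hp
  obtain ⟨h1, h2, h3⟩ := profile_parabolic hψ hN hH h hp
    (B := -(N p 1 / ψ p 1)) (by field_simp [hy0 p])
  refine ⟨h1, h2, h3.trans ?_⟩
  rw [hPR _ _ _ (hψ.pos p)]
  rfl

theorem isEmbedding_hyperbolic (hψ : IsImmersedSurface ψ)
    (hφ : ∀ (t : ℝ) (p : M), ψ (φ t p) = translation .hyperbolic t (ψ p)) (hN : IsUnitNormal ψ N)
    {P R : ℝ → ℝ}
    (hcurv : ∀ (e : OpenPartialHomeomorph M Param) (c₁ c₂ s₀ t₀ ε : ℝ) (α β : ℝ → ℝ),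
      IsAdaptedChart hyperbolicStraightening ψ e c₁ c₂ s₀ t₀ ε α β → ∀ p ∈ e.source, ∀ B : ℝ,
      N p 0 = -(ψ p 1 * B / Real.cosh (hyperbolicStraightening.a (ψ p))) →
      N p 2 ^ 2 + B ^ 2 = 1 ∧ N p 2 * deriv β (e p 0) = B * deriv α (e p 0) ∧
      N p 2 * deriv (deriv β) (e p 0) - B * deriv (deriv α) (e p 0) =
        (P (hyperbolicStraightening.a (ψ p)) * N p 2 + R (hyperbolicStraightening.a (ψ p)) * B) *
          (deriv α (e p 0) ^ 2 + deriv β (e p 0) ^ 2))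
    (hemb : ∀ 𝒜, ConnectedSpace (Slice hyperbolicStraightening ψ) →
      ∀ a b A B : Slice hyperbolicStraightening ψ → ℝ, IsPlaneCurve 𝒜 P R univ a b A B →
      IsEmbedding fun p => (a p, b p)) : IsEmbedding ψ := by
  have hψc : Continuous ψ := hψ.immersion.contMDiff.continuous
  have hy := continuous_comp_apply hψc 1
  have hy0 : ∀ p, ψ p 1 ≠ 0 := fun p => (hψ.pos p).ne'
  have ha := continuous_comp_of_contDiffOn hyperbolicStraightening.contDiffOn_a hψc hψ.pos
  refine isEmbedding_of_isPlaneCurve (A := fun p => N p 2)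
    (B := fun p => -(N p 0 * Real.cosh (hyperbolicStraightening.a (ψ p)) / ψ p 1))
    (P := P) (R := R) (Ω := univ) hyperbolicStraightening hψ hφ
    (continuous_comp_apply hN.cont 2)
    (((continuous_comp_apply hN.cont 0).mul (Real.continuous_cosh.comp ha)).div hy hy0).neg
    (fun _ => mem_univ _) ?_ fun 𝒜 hc h => hemb 𝒜 hc _ _ _ _ h
  intro e c₁ c₂ s₀ t₀ ε α β h p hp
  refine hcurv e c₁ c₂ s₀ t₀ ε α β h p hp _ ?_
  have := (Real.cosh_pos (hyperbolicStraightening.a (ψ p))).ne'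
  have := hy0 p
  field_simp

/-- Here κ = -tanh(a) B, so `B` vanishes identically or nowhere: the profile is monotone in a or in
b. -/
theorem isEmbedding_hyperbolic_of_minimal [T2Space M] (hψ : IsImmersedSurface ψ)
    (hφ : ∀ (t : ℝ) (p : M), ψ (φ t p) = translation .hyperbolic t (ψ p)) (hN : IsUnitNormal ψ N)
    (hcurv : ∀ (e : OpenPartialHomeomorph M Param) (c₁ c₂ s₀ t₀ ε : ℝ) (α β : ℝ → ℝ),
      IsAdaptedChart hyperbolicStraightening ψ e c₁ c₂ s₀ t₀ ε α β → ∀ p ∈ e.source, ∀ B : ℝ,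
      N p 0 = -(ψ p 1 * B / Real.cosh (hyperbolicStraightening.a (ψ p))) →
      N p 2 ^ 2 + B ^ 2 = 1 ∧ N p 2 * deriv β (e p 0) = B * deriv α (e p 0) ∧
      N p 2 * deriv (deriv β) (e p 0) - B * deriv (deriv α) (e p 0) =
        (0 * N p 2 + -(Real.sinh (hyperbolicStraightening.a (ψ p)) /
          Real.cosh (hyperbolicStraightening.a (ψ p))) * B) *
          (deriv α (e p 0) ^ 2 + deriv β (e p 0) ^ 2)) : IsEmbedding ψ := by
  refine isEmbedding_hyperbolic (P := fun _ => 0)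
    (R := fun x => -(Real.sinh x / Real.cosh x)) hψ hφ hN hcurv fun 𝒜 hc a b A B h => ?_
  exact h.isEmbedding_of_proportional (ρ := fun x => -(Real.sinh x / Real.cosh x)) (c₁ := 0)
    (c₂ := 1) (by norm_num)
    (Real.continuous_sinh.div Real.continuous_cosh fun x => (Real.cosh_pos x).ne').neg.continuousOn
    (fun x _ => by simp) fun x _ => by simp

theorem isEmbedding_vertical [T2Space M] (hψ : IsImmersedSurface ψ)
    (hφ : ∀ (t : ℝ) (p : M), ψ (φ t p) = translation .vertical t (ψ p)) (hN : IsUnitNormal ψ N)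
    (hH : ∀ e ∈ IsManifold.maximalAtlas (𝓡 2) ∞ M, ∀ p ∈ e.source,
      meanCurvature (ψ ∘ e.symm) (N p) (e p) = inn (ψ p) (N p) (field δ (ψ p))) :
    IsEmbedding ψ := by
  have hinv : ContinuousOn (fun x : ℝ => 1 / x) (Ioi 0) :=
    continuousOn_const.div continuousOn_id fun x hx => (mem_Ioi.1 hx).ne'
  have hinv2 : ContinuousOn (fun x : ℝ => 2 / x ^ 2) (Ioi 0) :=
    continuousOn_const.div (continuousOn_id.pow 2) fun x hx => pow_ne_zero 2 (mem_Ioi.1 hx).ne'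
  cases δ with
  | v =>
    refine isEmbedding_cartesian (P := fun _ => 0) (R := fun x => 1 / x) hψ hφ hN hH ?_ ?_
    · intro q A B hq
      simp [field]
      ring
    · exact fun 𝒜 hc a b A B h => h.isEmbedding_of_proportional (ρ := fun x => 1 / x) (c₁ := 0)
        (c₂ := 1) (by norm_num) hinv (fun x _ => by simp) fun x _ => by simp
  | p =>
    refine isEmbedding_cartesian (P := fun x => 2 / x ^ 2) (R := fun x => 1 / x) hψ hφ hN hH ?_ ?_
    · intro q A B hq
      simp [field]
      ring
    · intro 𝒜 hc a b A B h
      -- The exponent 1/(2x²) supplies exactly the X² term that completes the square, and -x makes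
      -- the form definite.
      refine h.isEmbedding_of_lyapunov (g := fun x => -Real.exp (1 / (2 * x ^ 2) - x))
        (g' := fun x => Real.exp (1 / (2 * x ^ 2) - x) * (1 / x ^ 3 + 1)) hinv2 ?_ ?_ ?_
      · exact fun x hx => (differentiableAt_const _).div differentiableAt_id (mem_Ioi.1 hx).ne'
      · intro x hx
        have h0 : x ≠ 0 := (mem_Ioi.1 hx).ne'
        have h1 := (((hasDerivAt_const x (1 : ℝ)).div (((hasDerivAt_id x).pow 2).const_mul 2)
          (mul_ne_zero two_ne_zero (pow_ne_zero 2 h0))).sub (hasDerivAt_id x)).exp.neg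
        refine h1.congr_deriv ?_
        simp only [Pi.pow_apply, Pi.div_apply, Pi.sub_apply, id_eq]
        generalize Real.exp _ = E
        field_simp
        norm_num
        ring
      · intro x hx X Y hXY _
        have h0 : 0 < x := hx
        have hE := Real.exp_pos (1 / (2 * x ^ 2) - x)
        generalize Real.exp (1 / (2 * x ^ 2) - x) = E at hE
        have key : E * (1 / x ^ 3 + 1) * X ^ 2 - -E * (2 / x ^ 2) * X * Y - -E * (1 / x) * Y ^ 2 =
            E / x * ((X / x + Y) ^ 2 + x * X ^ 2) := by
          field_simp
          ring
        rw [key]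
        refine mul_pos (div_pos hE h0) ?_
        by_cases hX : X = 0
        · have hY : Y ≠ 0 := by
            rintro rfl
            rw [hX] at hXY
            norm_num at hXY
          rw [hX]
          simp only [zero_div, zero_add]
          positivity
        · positivity
  | h => exact isEmbedding_polar hψ hφ hN hH
  | cPlus =>
    refine isEmbedding_cartesian (P := fun _ => 0) (R := fun x => 1 / x - 2 / x ^ 2) hψ hφ hN hH
      ?_ ?_
    · intro q A B hq
      simp [field]
      ring
    · exact fun 𝒜 hc a b A B h => h.isEmbedding_of_proportional
        (ρ := fun x => 1 / x - 2 / x ^ 2) (c₁ := 0) (c₂ := 1) (by norm_num) (hinv.sub hinv2)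
        (fun x _ => by simp) fun x _ => by simp
  | cMinus =>
    refine isEmbedding_cartesian (P := fun _ => 0) (R := fun x => 1 / x + 2 / x ^ 2) hψ hφ hN hH
      ?_ ?_
    · intro q A B hq
      simp [field]
      ring
    · exact fun 𝒜 hc a b A B h => h.isEmbedding_of_proportional
        (ρ := fun x => 1 / x + 2 / x ^ 2) (c₁ := 0) (c₂ := 1) (by norm_num) (hinv.add hinv2)
        (fun x _ => by simp) fun x _ => by simp

theorem isEmbedding_of_parabolic [T2Space M] (hψ : IsImmersedSurface ψ)
    (hφ : ∀ (t : ℝ) (p : M), ψ (φ t p) = translation .parabolic t (ψ p)) (hN : IsUnitNormal ψ N)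
    (hH : ∀ e ∈ IsManifold.maximalAtlas (𝓡 2) ∞ M, ∀ p ∈ e.source,
      meanCurvature (ψ ∘ e.symm) (N p) (e p) = inn (ψ p) (N p) (field δ (ψ p))) :
    IsEmbedding ψ := by
  have hexp : Continuous fun x : ℝ => 2 / Real.exp x :=
    continuous_const.div Real.continuous_exp fun x => (Real.exp_pos x).ne'
  cases δ with
  | v =>
    refine isEmbedding_parabolic (ρ := fun _ => 1) (k₁ := 2) (k₂ := 1) hψ hφ hN hH
      continuous_const (by norm_num) fun q A B hq => ?_
    simp [field]
    ring
  | p =>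
    refine isEmbedding_parabolic (ρ := fun _ => 1) (k₁ := 0) (k₂ := 1) hψ hφ hN hH
      continuous_const (by norm_num) fun q A B hq => ?_
    simp [field]
  | h =>
    -- The x-component of the field is tangent to the orbits; the y-component contributes -2B, which
    -- turns B into -B.
    refine isEmbedding_parabolic (ρ := fun _ => -1) (k₁ := 0) (k₂ := 1) hψ hφ hN hH
      continuous_const (by norm_num) fun q A B hq => ?_
    simp [field]
    field_simp
    ring
  | cPlus =>
    refine isEmbedding_parabolic (ρ := fun x => 1 - 2 / Real.exp x) (k₁ := 0) (k₂ := 1) hψ hφ hN hH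
      (continuous_const.sub hexp) (by norm_num) fun q A B hq => ?_
    simp [field, Real.exp_log hq]
    ring
  | cMinus =>
    refine isEmbedding_parabolic (ρ := fun x => 1 + 2 / Real.exp x) (k₁ := 0) (k₂ := 1) hψ hφ hN hH
      (continuous_const.add hexp) (by norm_num) fun q A B hq => ?_
    simp [field, Real.exp_log hq]
    ring

theorem isEmbedding_of_hyperbolic [T2Space M] (hψ : IsImmersedSurface ψ)
    (hφ : ∀ (t : ℝ) (p : M), ψ (φ t p) = translation .hyperbolic t (ψ p)) (hN : IsUnitNormal ψ N)
    (hH : ∀ e ∈ IsManifold.maximalAtlas (𝓡 2) ∞ M, ∀ p ∈ e.source,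
      meanCurvature (ψ ∘ e.symm) (N p) (e p) = inn (ψ p) (N p) (field δ (ψ p))) :
    IsEmbedding ψ := by
  cases δ with
  | v =>
    refine isEmbedding_hyperbolic (P := fun _ => 2)
      (R := fun x => -(Real.sinh x / Real.cosh x)) hψ hφ hN ?_ ?_
    · intro e c₁ c₂ s₀ t₀ ε α β h p hp B hB
      obtain ⟨h1, h2, h3⟩ := profile_hyperbolic hψ hN hH h hp hB
      refine ⟨h1, h2, h3.trans ?_⟩
      simp [field]
      left
      ring
    · intro 𝒜 hc a b A B h
      -- With this g the form is (cosh · X - sinh · Y)² + (sinh · X)², which is zero for a unit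
      -- vector only at the equilibrium x = 0, X = 0.
      refine h.isEmbedding_of_lyapunov (g := fun x => Real.sinh x * Real.cosh x)
        (g' := fun x => Real.cosh x * Real.cosh x + Real.sinh x * Real.sinh x)
        continuousOn_const ?_ ?_ ?_
      · exact fun x _ => (Real.differentiableAt_sinh.div Real.differentiableAt_cosh
          (Real.cosh_pos x).ne').neg
      · exact fun x _ => (Real.hasDerivAt_sinh x).mul (Real.hasDerivAt_cosh x)
      · intro x _ X Y hXY hne
        have hc := Real.cosh_pos x
        have key : (Real.cosh x * Real.cosh x + Real.sinh x * Real.sinh x) * X ^ 2 -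
            Real.sinh x * Real.cosh x * 2 * X * Y -
            Real.sinh x * Real.cosh x * -(Real.sinh x / Real.cosh x) * Y ^ 2 =
            (Real.cosh x * X - Real.sinh x * Y) ^ 2 + (Real.sinh x * X) ^ 2 := by
          field_simp
          ring
        rw [key]
        by_cases hs : Real.sinh x = 0
        · have hX : X ≠ 0 := by
            rcases hne with h1 | h1
            · exact h1
            · exact absurd (by simp [hs]) h1
          rw [hs]
          simp only [zero_mul, sub_zero]
          positivity
        · by_cases hX : X = 0
          · have hY : Y ≠ 0 := by
              rintro rfl
              rw [hX] at hXY
              norm_num at hXY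
            rw [hX]
            simp only [mul_zero, zero_sub]
            have : -(Real.sinh x * Y) ≠ 0 := neg_ne_zero.2 (mul_ne_zero hs hY)
            positivity
          · have : Real.sinh x * X ≠ 0 := mul_ne_zero hs hX
            positivity
  | p =>
    exact isEmbedding_hyperbolic_of_minimal hψ hφ hN fun e c₁ c₂ s₀ t₀ ε α β h p hp B hB =>
      profile_hyperbolic_of_scaling hψ hN hH (X₀ := 1) (X₁ := 0) (fun _ => rfl) h hp hB
  | h =>
    refine isEmbedding_hyperbolic_of_minimal hψ hφ hN fun e c₁ c₂ s₀ t₀ ε α β h p hp B hB => ?_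
    obtain ⟨h1, h2, h3⟩ := profile_hyperbolic hψ hN hH h hp hB
    refine ⟨h1, h2, h3.trans ?_⟩
    have hy := (hψ.pos p).ne'
    -- The field generates the translations, so it is tangent to the surface and its normal
    -- component is zero.
    have h0 : ψ p 1 * Real.sinh (hyperbolicStraightening.a (ψ p)) - ψ p 0 = 0 := by
      simp only [hyperbolicStraightening, Real.sinh_arsinh]
      field_simp
      ring
    simp [field, h0]
  | cPlus =>
    exact isEmbedding_hyperbolic_of_minimal hψ hφ hN fun e c₁ c₂ s₀ t₀ ε α β h p hp B hB =>
      profile_hyperbolic_of_scaling hψ hN hH (X₀ := 0) (X₁ := 1) (fun _ => rfl) h hp hB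
  | cMinus =>
    exact isEmbedding_hyperbolic_of_minimal hψ hφ hN fun e c₁ c₂ s₀ t₀ ε α β h p hp B hB =>
      profile_hyperbolic_of_scaling hψ hN hH (X₀ := 0) (X₁ := -1) (fun _ => rfl) h hp hB

theorem IsGrimReaper.isEmbedding [T2Space M] (h : IsGrimReaper τ δ ψ) : IsEmbedding ψ := by
  obtain ⟨N, hN, hH⟩ := h.translator
  obtain ⟨φ, hφ⟩ := h.invariant
  cases τ with
  | vertical => exact isEmbedding_vertical h.surface hφ hN hH
  | parabolic => exact isEmbedding_of_parabolic h.surface hφ hN hH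
  | hyperbolic => exact isEmbedding_of_hyperbolic h.surface hφ hN hH

end Embeddings

end GrimReaper

end

theorem mainTheorem1 {M : Type*} [TopologicalSpace M] [T2Space M] [SecondCountableTopology M]
    [ConnectedSpace M] [ChartedSpace (EuclideanSpace ℝ (Fin 2)) M] [IsManifold (𝓡 2) ∞ M]
    (τ : GrimReaper.TranslationKind) (δ : GrimReaper.FieldKind) (ψ : M → Fin 3 → ℝ)
    (hψ : GrimReaper.IsGrimReaper τ δ ψ) :
    Manifold.IsSmoothEmbedding (𝓡 2) 𝓘(ℝ, Fin 3 → ℝ) ∞ ψ :=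
  ⟨hψ.surface.immersion, hψ.isEmbedding⟩
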